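/- A *second-order holonomic instance* consists of rational functions $P,Q\in\mathbb{Q}(x)$ without poles in $\mathbb{N}=\{0,1,2,\dots\}$ and rational numbers $a,b$; it describes the unique sequence $f=\{f(n)\}_{n\in\mathbb{N}}$ with $f(0)=a$, $f(1)=b$ and $$f(n+2)=P(n)\,f(n+1)+Q(n)\,f(n)\qquad(n\in\mathbb{N}).$$ Instances are encoded by natural numbers in the usual way (rational functions as quotients of polynomials given by their coefficients). A sequence $f\in\mathbb{R}^{\mathbb{N}}$ has the *ultimate sign* $(s_0,\dots,s_{\tau-1})\in\{+,-,0\}^{\tau}$, $\tau\ge 1$, *at* $N\in\mathbb{N}$ if $\operatorname{sgn} f(n)=s_{n\bmod\tau}$ for all $n\ge N$. *Ultimate Sign Problem* (for second-order holonomic sequences): given an instance, output an ultimate sign of the described sequence $f$ together with an index $N$ at which $f$ has it, or report that $f$ has no ultimate sign. *Minimality Problem* (for second-order holonomic sequences): given an instance in which moreover $P$ and $Q$ have no zeros in $\mathbb{N}$, decide whether $f$ is minimal, i.e. whether $f(n)/g(n)\to 0$ as $n\to\infty$ (with $g(n)\neq 0$ for all large $n$) for every real sequence $g$ that satisfies the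 same recurrence and is such that $f$ and $g$ are linearly independent. **Theorem.** The Ultimate Sign Problem Turing-reduces to the Minimality Problem: there is an algorithm with an oracle for the Minimality Problem that halts with a correct output on every instance of the Ultimate Sign Problem. -/

import Mathlib

namespace HolonomicSign

open Filter Topology Polynomial

/-! ### Ultimate signs -/

/-- `f` has the ultimate sign `s` (a nonempty word over `{+, -, 0}`) at the index `N`:
`sgn (f n) = s_(n mod τ)` for all `n ≥ N`, where `τ` is the length of `s`. -/
def HasUltimateSignAt (f : ℕ → ℝ) (s : List SignType) (N : ℕ) : Prop :=
  s ≠ [] ∧ ∀ n : ℕ, N ≤ n → s[n % s.length]? = some (SignType.sign (f n))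

/-! ### Second-order holonomic sequences with coefficients in `ℚ(x)` -/

/-- The value of the rational function `P ∈ ℚ(x)` at the natural number `n`, as a real number. -/
noncomputable def valueAt (P : RatFunc ℚ) (n : ℕ) : ℝ :=
  RatFunc.eval (algebraMap ℚ ℝ) (n : ℝ) P

/-- `P` has no poles in `ℕ`. -/
def NoPoles (P : RatFunc ℚ) : Prop :=
  ∀ n : ℕ, P.denom.eval (n : ℚ) ≠ 0

/-- `P` has no zeros in `ℕ`. -/
def NoZeros (P : RatFunc ℚ) : Prop :=
  ∀ n : ℕ, P.num.eval (n : ℚ) ≠ 0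

/-- `f` is a `(P, Q)`-holonomic sequence. -/
def IsHolonomic (P Q : RatFunc ℚ) (f : ℕ → ℝ) : Prop :=
  ∀ n : ℕ, f (n + 2) = valueAt P n * f (n + 1) + valueAt Q n * f n

/-- The `(P, Q)`-holonomic sequence with initial value `(a, b)`. -/
noncomputable def holonomicSeq (P Q : RatFunc ℚ) (a b : ℝ) : ℕ → ℝ
  | 0 => a
  | 1 => b
  | n + 2 => valueAt P n * holonomicSeq P Q a b (n + 1) + valueAt Q n * holonomicSeq P Q a b n

/-- `f` is a minimal solution of the `(P, Q)`-recurrence: for every (real) solution `g` such that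
`f` and `g` are linearly independent, `f n / g n → 0` (in particular, the quotient is defined
for all large `n`). -/
def IsMinimal (P Q : RatFunc ℚ) (f : ℕ → ℝ) : Prop :=
  IsHolonomic P Q f ∧
    ∀ g : ℕ → ℝ, IsHolonomic P Q g → LinearIndependent ℝ ![f, g] →
      (∀ᶠ n in atTop, g n ≠ 0) ∧ Tendsto (fun n => f n / g n) atTop (𝓝 0)

/-! ### Finite descriptions of the inputs -/

/-- The polynomial with the given list of integer coefficients, constant coefficient first. -/
noncomputable def toPoly : List ℤ → ℚ[X]
  | [] => 0
  | a :: l => C (a : ℚ) + X * toPoly l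

/-- A rational function over `ℚ` is given by the integer coefficients of a numerator and of a
denominator (not necessarily in lowest terms). -/
abbrev RatFuncCode : Type := List ℤ × List ℤ

noncomputable def RatFuncCode.toRatFunc (c : RatFuncCode) : RatFunc ℚ :=
  algebraMap ℚ[X] (RatFunc ℚ) (toPoly c.1) / algebraMap ℚ[X] (RatFunc ℚ) (toPoly c.2)

/-- A rational number is given by a pair `(p, q)`, which stands for `p / (q + 1)`. -/
abbrev RatCode : Type := ℤ × ℕ

def RatCode.toRat (c : RatCode) : ℚ := (c.1 : ℚ) / ((c.2 : ℚ) + 1)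

/-- An instance: descriptions of `P`, `Q` and of the initial values `f(0)`, `f(1)`. -/
abbrev Instance : Type := (RatFuncCode × RatFuncCode) × (RatCode × RatCode)

namespace Instance

noncomputable def P (x : Instance) : RatFunc ℚ := RatFuncCode.toRatFunc x.1.1

noncomputable def Q (x : Instance) : RatFunc ℚ := RatFuncCode.toRatFunc x.1.2

/-- The sequence described by the instance. -/
noncomputable def seq (x : Instance) : ℕ → ℝ :=
  holonomicSeq x.P x.Q (RatCode.toRat x.2.1 : ℝ) (RatCode.toRat x.2.2 : ℝ)

/-- The instance describes rational functions `P`, `Q` without poles in `ℕ`: both denominators are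
nonzero polynomials, and the rational functions that the two fractions represent have no poles
in `ℕ`. -/
def IsValid (x : Instance) : Prop :=
  toPoly x.1.1.2 ≠ 0 ∧ toPoly x.1.2.2 ≠ 0 ∧ NoPoles x.P ∧ NoPoles x.Q

end Instance

/-! ### The two problems -/

/-- A correct answer to the Ultimate Sign Problem for `f`: an ultimate sign of `f` together with an
index at which `f` has it, or `none` if `f` has no ultimate sign. -/
def IsUltimateSignAnswer (f : ℕ → ℝ) : Option (List SignType × ℕ) → Prop
  | some (s, N) => HasUltimateSignAt f s N
  | none => ∀ (s : List SignType) (N : ℕ), ¬ HasUltimateSignAt f s N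

/-- The inputs of the Ultimate Sign Problem: all `(P, Q)` without poles in `ℕ`, all rational
initial values. -/
def ultimateSignInputs : Set Instance := {x | x.IsValid}

/-- The (search) Ultimate Sign Problem for second-order holonomic sequences. -/
def UltimateSignProblem (x : Instance) (y : Option (List SignType × ℕ)) : Prop :=
  IsUltimateSignAnswer x.seq y

/-- The Minimality Problem for second-order holonomic sequences, as a decision problem, i.e. the set
of its yes-instances: `P` and `Q` have neither poles nor zeros in `ℕ`, and the given sequence is
minimal. -/
def MinimalityProblem : Set Instance :=
  {x | x.IsValid ∧ NoZeros x.P ∧ NoZeros x.Q ∧ IsMinimal x.P x.Q x.seq}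

/-! ### Turing reductions -/

instance : Primcodable SignType := Primcodable.ofEquiv (Fin 3) SignType.fin3Equiv.toEquiv

open Classical in
/-- The oracle for a decision problem: the characteristic function of the set of the codes of its
yes-instances. -/
noncomputable def oracleOf {γ : Type*} [Primcodable γ] (S : Set γ) : ℕ →. ℕ :=
  fun n => Part.some (if ∃ x ∈ S, Encodable.encode x = n then 1 else 0)

/-- The search problem "given `x ∈ D`, find some `y` with `R x y`" Turing-reduces to the decision
problem `S`: some algorithm with oracle `S` halts on every `x ∈ D` with a correct answer. -/
def TuringReducesTo {α β γ : Type*} [Primcodable α] [Primcodable β] [Primcodable γ]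
    (D : Set α) (R : α → β → Prop) (S : Set γ) : Prop :=
  ∃ U : α →. β, RecursiveIn {oracleOf S} U ∧ ∀ x ∈ D, ∃ y ∈ U x, R x y

end HolonomicSign

namespace HolonomicSign

open Filter Topology Polynomial

/-! ### Normalized recurrences -/

/-! If `P` and `Q` have no zeros, dividing a solution by a product of values of `P / 2` turns the
recurrence into `h (n + 2) = 2 h (n + 1) - c n h n`, where `c` is again a rational function of `n`.
The limit `L` of `c` governs the signs. For `L > 1` the characteristic roots are `√L e^{±iθ}` with
`cos² θ = 1 / L`.

Elliptic case. A periodic sign pattern makes some progression of terms have constant sign. The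
positive ratios along it would obey a Riccati recurrence without real fixed points in the limit,
which is impossible unless `sin (2Tθ) = 0` (`limCoeff_eq_zero_of_period`). Then `4 / L - 2 = 2 cos
2θ` is a rational algebraic integer in `(-2, 2)`, so `L` is `4`, `2` or `4/3`
(`special_of_limCoeff_eq_zero`). For these values, and when `c` is unbounded or eventually negative,
one passes to the recurrence linking `f n`, `f (n + k)`, `f (n + 2k)` with `k ≤ 6`. At a suitable
`k` either `f (n + k)` is eventually a multiple of `f n` alone, or the new coefficient tends to `1`,
lies eventually in `(0, 1]`, or tends to a non-special limit above `1` (`exists_jumpBehaviour`).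

Parabolic case, `L = 1`. Kneser's threshold `1 + 1 / (4 n²)` decides (`IsRatSeq.kneser_dichotomy`).
Above it solutions keep changing sign, but with runs of unbounded length, so no pattern repeats
(`no_period_of_oscillation`). Below it, and also when the coefficient lies in `(0, 1]`, the ratios
`h (m + 1) / h m` are compared with the explicit `supRatio`. Once above, they stay above, and a
nontrivial solution is minimal exactly when its ratios never get above (`minimalSol_of_not_exceeds`,
`not_exceeds_of_minimalSol`). Either way the sign becomes constant along each progression of step
`2k`. No bound on the moment of crossing is at hand, and this is the only place where the oracle is
needed: for each residue class either the oracle confirms minimality or waiting long enough exhibits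
a crossing.

The algorithm searches through all certificates, which are finite data fixing the case, a threshold
index and the sign word. Checking one is primitive recursive given six oracle answers, because the
sign of an integer polynomial is settled beyond an explicit bound. An accepted certificate gives a
right answer (`Check.sound`) and every valid instance has an accepted one (`exists_check`), so the
search halts. -/

/-- `h` solves the normalized recurrence `h (n + 2) = 2 h (n + 1) - c n * h n`. -/
def NormSol (c h : ℕ → ℝ) : Prop := ∀ n, h (n + 2) = 2 * h (n + 1) - c n * h n

/-- The explicit supersolution of the Riccati recurrence. -/
noncomputable def supRatio (x : ℝ) (m : ℕ) : ℝ := 1 + 1 / (2 * (m + x))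

/-- The ratio `h (m + 1) / h m` exceeds the supersolution. -/
def ExceedsAt (x : ℝ) (h : ℕ → ℝ) (m : ℕ) : Prop :=
  supRatio x m * h m ^ 2 < h m * h (m + 1)

/-- The non-oscillation condition on the coefficient of a normalized recurrence. -/
def SubKneser (x : ℝ) (c : ℕ → ℝ) : Prop :=
  ∀ n : ℕ, 0 < c n ∧ c n ≤ 1 + 1 / (4 * (n + x) * (n + 1 + x))

/-- The harmonic series diverges. Every "cannot stay positive" argument below ends here, after a
suitable quantity has been shown to lose at least `δ / (m + x)` per step. -/
theorem not_bddBelow_of_harmonic_decrease {z : ℕ → ℝ} {δ x K : ℝ} (hδ : 0 < δ) (hx : 0 < x)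
    (hK : ∀ m, K ≤ z m) (h : ∀ m : ℕ, z (m + 1) ≤ z m - δ / (m + x)) : False := by
  have key : ∀ m : ℕ, z m ≤ z 0 - δ / (1 + x) * ∑ i ∈ Finset.range m, 1 / ((i : ℝ) + 1) := by
    intro m
    induction m with
    | zero => simp
    | succ m ih =>
      rw [Finset.sum_range_succ]
      have h1 : δ / (1 + x) * (1 / ((m : ℝ) + 1)) ≤ δ / (m + x) := by
        rw [div_mul_div_comm, mul_one]
        apply div_le_div_of_nonneg_left hδ.le (by positivity)
        have : (0 : ℝ) ≤ m := by positivity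
        nlinarith
      have := h m
      linarith [mul_add (δ / (1 + x)) (∑ i ∈ Finset.range m, 1 / ((i : ℝ) + 1))
        (1 / ((m : ℝ) + 1))]
  have hd : 0 < δ / (1 + x) := by positivity
  obtain ⟨m, hm⟩ := (Real.tendsto_sum_range_one_div_nat_succ_atTop.eventually_gt_atTop
    ((z 0 - K) / (δ / (1 + x)))).exists
  rw [div_lt_iff₀ hd] at hm
  linarith [key m, hK m]

theorem supRatio_pos {x : ℝ} (hx : 1 ≤ x) (m : ℕ) : 1 < supRatio x m ∧ supRatio x m < 2 := by
  have hm : (0 : ℝ) ≤ m := by positivity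
  unfold supRatio
  constructor
  · have : 0 < 1 / (2 * ((m : ℝ) + x)) := by positivity
    linarith
  · have : 1 / (2 * ((m : ℝ) + x)) < 1 := by
      rw [div_lt_one (by positivity)]; linarith
    linarith

/-- The upper bound in `SubKneser` is exactly the coefficient for which `supRatio` solves the
Riccati recurrence `r (m + 1) = 2 - c m / r m`. -/
theorem supRatio_mul {x : ℝ} (hx : 1 ≤ x) (m : ℕ) :
    supRatio x m * (2 - supRatio x (m + 1)) = 1 + 1 / (4 * (m + x) * (m + 1 + x)) := by
  have hm : (0 : ℝ) ≤ m := by positivity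
  have h1 : (m : ℝ) + x ≠ 0 := by positivity
  have h2 : (m : ℝ) + 1 + x ≠ 0 := by positivity
  unfold supRatio
  push_cast
  field_simp
  ring

/-- Both sides equal `m + x + 1/2`. This supplies the weight `1 / (m + x)` that telescopes in
`riccati_unique`. -/
theorem supRatio_div {x : ℝ} (hx : 1 ≤ x) (m : ℕ) :
    supRatio x m * (m + x) = (2 - supRatio x (m + 1)) * (m + x + 1) := by
  have hm : (0 : ℝ) ≤ m := by positivity
  have h1 : (m : ℝ) + x ≠ 0 := by positivity
  have h2 : (m : ℝ) + 1 + x ≠ 0 := by positivity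
  unfold supRatio
  push_cast
  field_simp
  ring

theorem SubKneser.le_mul {x : ℝ} {c : ℕ → ℝ} (hc : SubKneser x c) (hx : 1 ≤ x) (m : ℕ) :
    c m ≤ supRatio x m * (2 - supRatio x (m + 1)) := by
  rw [supRatio_mul hx]; exact (hc m).2

theorem ExceedsAt.pos {x : ℝ} {h : ℕ → ℝ} {m : ℕ} (hx : 1 ≤ x) (hm : ExceedsAt x h m) :
    0 < h m * h (m + 1) :=
  lt_of_le_of_lt (mul_nonneg (by linarith [(supRatio_pos hx m).1]) (sq_nonneg _)) hm

/-- The map `r ↦ 2 - c / r` increases on positive `r` and, by the bound on `c`, sends `supRatio x m`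
to at least `supRatio x (m + 1)`. The multiplied-out form of `ExceedsAt` stays meaningful when a
term vanishes. -/
theorem ExceedsAt.succ {x : ℝ} {c h : ℕ → ℝ} {m : ℕ} (hx : 1 ≤ x) (hc : SubKneser x c)
    (hh : NormSol c h) (hm : ExceedsAt x h m) : ExceedsAt x h (m + 1) := by
  have hpos := hm.pos hx
  unfold ExceedsAt at *
  rw [hh m]
  have h1 := hc.le_mul hx m
  obtain ⟨hr1, hr2⟩ := supRatio_pos hx (m + 1)
  obtain ⟨hs1, hs2⟩ := supRatio_pos hx m
  have h2 : supRatio x m * (h m * h (m + 1)) < h (m + 1) ^ 2 := by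
    have h3 : 0 < h m ^ 2 := by
      have : h m ≠ 0 := by rintro h0; simp [h0] at hpos
      positivity
    have h4 := mul_lt_mul_of_pos_right hm hpos
    have h5 : h m ^ 2 * (supRatio x m * (h m * h (m + 1))) < h m ^ 2 * h (m + 1) ^ 2 := by
      nlinarith
    exact lt_of_mul_lt_mul_left h5 h3.le
  have h6 : c m * (h m * h (m + 1)) ≤
      supRatio x m * (2 - supRatio x (m + 1)) * (h m * h (m + 1)) :=
    mul_le_mul_of_nonneg_right h1 hpos.le
  nlinarith [mul_lt_mul_of_pos_left h2 (by linarith : 0 < 2 - supRatio x (m + 1))]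

theorem ExceedsAt.of_le {x : ℝ} {c h : ℕ → ℝ} {m n : ℕ} (hx : 1 ≤ x) (hc : SubKneser x c)
    (hh : NormSol c h) (hm : ExceedsAt x h m) (hmn : m ≤ n) : ExceedsAt x h n :=
  Nat.le_induction hm (fun _ _ h => h.succ hx hc hh) n hmn

theorem NormSol.eq_zero {c h : ℕ → ℝ} (hc : ∀ n, c n ≠ 0) (hh : NormSol c h) {m : ℕ}
    (h0 : h m = 0) (h1 : h (m + 1) = 0) : h 0 = 0 ∧ h 1 = 0 := by
  induction m with
  | zero => exact ⟨h0, h1⟩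
  | succ m ih =>
    have := hh m
    rw [h1, h0] at this
    have h2 : h m = 0 := by
      have : c m * h m = 0 := by linarith
      exact (mul_eq_zero.1 this).resolve_left (hc m)
    exact ih h2 h0

/-- A zero or a sign change makes the next ratio at least `2`, because `c > 0`, and `2` is above
`supRatio`. -/
theorem ratio_pos_of_not_exceedsAt {x : ℝ} {c h : ℕ → ℝ} (hx : 1 ≤ x) (hc : SubKneser x c)
    (hh : NormSol c h) (hne : ¬ (h 0 = 0 ∧ h 1 = 0)) (hnot : ∀ m, ¬ ExceedsAt x h m) (m : ℕ) :
    0 < h m * h (m + 1) := by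
  have hr := supRatio_pos hx
  have hne' : ∀ n, ¬ (h n = 0 ∧ h (n + 1) = 0) := fun n hn =>
    hne (hh.eq_zero (fun n => (hc n).1.ne') hn.1 hn.2)
  have hpos : ∀ n, h n ≠ 0 := by
    intro n hn
    have h1 : h (n + 1) ≠ 0 := fun h1 => hne' n ⟨hn, h1⟩
    apply hnot (n + 1)
    unfold ExceedsAt
    rw [hh n, hn]
    have : 0 < h (n + 1) ^ 2 := by positivity
    nlinarith [hr (n + 1)]
  by_contra hcon
  have h2 : h m * h (m + 1) ≤ 0 := not_lt.1 hcon
  apply hnot (m + 1)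
  unfold ExceedsAt
  rw [hh m]
  have : 0 < h (m + 1) ^ 2 := by have := hpos (m + 1); positivity
  nlinarith [hr (m + 1), (hc m).1, mul_nonneg (hc m).1.le (by linarith : 0 ≤ -(h m * h (m + 1)))]

theorem NormSol.ratio_succ {c h : ℕ → ℝ} (hh : NormSol c h) {m : ℕ}
    (h1 : h (m + 1) ≠ 0) :
    h (m + 2) / h (m + 1) = 2 - c m / (h (m + 1) / h m) := by
  rw [hh m]; field_simp

/-- Two positive solutions of the Riccati recurrence that stay below the supersolution agree. -/
theorem riccati_unique {x : ℝ} {c r s : ℕ → ℝ} (hx : 1 ≤ x)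
    (hr : ∀ m, r (m + 1) = 2 - c m / r m) (hs : ∀ m, s (m + 1) = 2 - c m / s m)
    (hs0 : ∀ m, 0 < s m) (hc : ∀ m, 0 < c m) (hlt : ∀ m, s m < r m)
    (hle : ∀ m, r m ≤ supRatio x m) : False := by
  have hr0 : ∀ m, 0 < r m := fun m => (hs0 m).trans (hlt m)
  -- With `E = 1 / (r - s)` the Riccati recurrence becomes affine: `E' = (r E - 1) / (2 - r')`. The
  -- bound on `r` gives `r / (2 - r') ≤ (m + x + 1) / (m + x)`, and `0 < r'` gives `1 / (2 - r') ≥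
  -- 1/2`, so `E / (m + x)` drops by at least `(1/2) / (m + 1 + x)`.
  apply not_bddBelow_of_harmonic_decrease (z := fun m => 1 / (r m - s m) / (m + x)) (δ := 1 / 2)
    (x := x + 1) (K := 0) (by norm_num) (by linarith)
  · intro m
    have := hlt m
    have h1 : 0 < r m - s m := by linarith
    positivity
  · intro m
    have hm : (0 : ℝ) ≤ m := by positivity
    have e0 : 0 < r m - s m := by linarith [hlt m]
    have e1 : 0 < r (m + 1) - s (m + 1) := by linarith [hlt (m + 1)]
    have hcm : c m = r m * (2 - r (m + 1)) := by
      rw [hr m]; have := (hr0 m).ne'; field_simp; ring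
    have h2 : 0 < 2 - r (m + 1) := by
      rw [hr m]
      have := div_pos (hc m) (hr0 m)
      linarith
    have e2 : r (m + 1) - s (m + 1) = (2 - r (m + 1)) * (r m - s m) / s m := by
      have := (hs0 m).ne'
      have h3 : s (m + 1) = 2 - c m / s m := hs m
      rw [h3, hcm]; field_simp; ring
    have e3 : 1 / (r (m + 1) - s (m + 1)) = (r m * (1 / (r m - s m)) - 1) / (2 - r (m + 1)) := by
      rw [e2]; have := (hs0 m).ne'; field_simp; ring
    set E := 1 / (r m - s m) with hE
    have hE0 : 0 < E := by positivity
    have hrho := supRatio_div hx m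
    have hp := supRatio_pos hx (m + 1)
    -- `r / (2 - r') ≤ (m + x + 1) / (m + x)`
    have k1 : r m * (m + x) ≤ (2 - r (m + 1)) * (m + x + 1) := by
      have a1 : r m * (m + x) ≤ supRatio x m * (m + x) :=
        mul_le_mul_of_nonneg_right (hle m) (by positivity)
      have a2 : (2 - supRatio x (m + 1)) * (m + x + 1) ≤ (2 - r (m + 1)) * (m + x + 1) :=
        mul_le_mul_of_nonneg_right (by linarith [hle (m + 1)]) (by positivity)
      linarith
    have hmx : 0 < (m : ℝ) + x := by positivity
    have k2 : (r m * E - 1) / (2 - r (m + 1)) ≤ (m + x + 1) / (m + x) * E - 1 / 2 := by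
      rw [div_le_iff₀ h2]
      have a1 : r m * E ≤ (m + x + 1) / (m + x) * E * (2 - r (m + 1)) := by
        have : r m ≤ (m + x + 1) / (m + x) * (2 - r (m + 1)) := by
          rw [div_mul_eq_mul_div, le_div_iff₀ hmx]; linarith
        calc r m * E ≤ ((m + x + 1) / (m + x) * (2 - r (m + 1))) * E :=
              mul_le_mul_of_nonneg_right this hE0.le
          _ = _ := by ring
      nlinarith [hr0 (m + 1)]
    have k3 : (m + x + 1) / (m + x) * E / (m + 1 + x) = E / (m + x) := by
      have : (m : ℝ) + 1 + x ≠ 0 := by positivity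
      field_simp; ring
    push_cast
    rw [e3]
    have hmx1 : 0 < (m : ℝ) + 1 + x := by positivity
    have k4 := div_le_div_of_nonneg_right k2 hmx1.le
    rw [sub_div _ (1 / 2), k3] at k4
    calc _ ≤ _ := k4
      _ = _ := by rw [show (m : ℝ) + 1 + x = m + (x + 1) by ring]

end HolonomicSign

namespace HolonomicSign

open Filter Topology Polynomial

/-! ### Minimality for normalized recurrences -/

theorem NormSol.shift {c h : ℕ → ℝ} (hh : NormSol c h) (M : ℕ) :
    NormSol (fun n => c (n + M)) (fun n => h (n + M)) := by
  intro n
  have := hh (n + M)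
  simp only
  rw [show n + 2 + M = n + M + 2 by ring, show n + 1 + M = n + M + 1 by ring, this]

theorem supRatio_shift (x : ℝ) (m M : ℕ) : supRatio x (m + M) = supRatio (x + M) m := by
  unfold supRatio; push_cast; ring_nf

theorem SubKneser.shift {x : ℝ} {c : ℕ → ℝ} (hc : SubKneser x c) (M : ℕ) :
    SubKneser (x + M) (fun n => c (n + M)) := by
  intro n
  refine ⟨(hc (n + M)).1, (hc (n + M)).2.trans (le_of_eq ?_)⟩
  push_cast; ring_nf

theorem ratio_le_of_not_exceedsAt {x : ℝ} {h : ℕ → ℝ} {m : ℕ} (hpos : 0 < h m * h (m + 1))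
    (hm : ¬ ExceedsAt x h m) : h (m + 1) / h m ≤ supRatio x m := by
  have h0 : h m ≠ 0 := by rintro h0; simp [h0] at hpos
  have h2 : 0 < h m ^ 2 := by positivity
  have h3 : h (m + 1) / h m = h m * h (m + 1) / h m ^ 2 := by field_simp
  rw [h3, div_le_iff₀ h2]
  exact not_lt.1 hm

theorem lt_ratio_of_exceedsAt {x : ℝ} {h : ℕ → ℝ} {m : ℕ} (hx : 1 ≤ x)
    (hm : ExceedsAt x h m) : supRatio x m < h (m + 1) / h m := by
  have hpos := hm.pos hx
  have h0 : h m ≠ 0 := by rintro h0; simp [h0] at hpos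
  have h2 : 0 < h m ^ 2 := by positivity
  have h3 : h (m + 1) / h m = h m * h (m + 1) / h m ^ 2 := by field_simp
  rw [h3, lt_div_iff₀ h2]
  exact hm

theorem ratio_pos_iff_mul_pos {a b : ℝ} (h : 0 < a * b) : 0 < b / a := by
  have h0 : a ≠ 0 := by rintro h0; simp [h0] at h
  have : b / a = a * b / a ^ 2 := by field_simp
  rw [this]; positivity

/-- Two solutions that never exceed the supersolution are proportional. -/
theorem proportional_of_not_exceedsAt {x : ℝ} {c h k : ℕ → ℝ} (hx : 1 ≤ x) (hc : SubKneser x c)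
    (hh : NormSol c h) (hk : NormSol c k) (hhn : ¬ (h 0 = 0 ∧ h 1 = 0))
    (hkn : ¬ (k 0 = 0 ∧ k 1 = 0)) (hhe : ∀ m, ¬ ExceedsAt x h m) (hke : ∀ m, ¬ ExceedsAt x k m) :
    h 0 * k 1 = h 1 * k 0 := by
  have hhp := ratio_pos_of_not_exceedsAt hx hc hh hhn hhe
  have hkp := ratio_pos_of_not_exceedsAt hx hc hk hkn hke
  have key : ∀ h k : ℕ → ℝ, NormSol c h → NormSol c k → (∀ m, 0 < h m * h (m + 1)) →
      (∀ m, 0 < k m * k (m + 1)) → (∀ m, ¬ ExceedsAt x h m) →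
      ¬ (k 1 / k 0 < h 1 / h 0) := by
    intro h k hh hk hhp hkp hhe hlt
    have nz : ∀ {u : ℕ → ℝ}, (∀ m, 0 < u m * u (m + 1)) → ∀ m, u m ≠ 0 := by
      intro u hu m h0; have := hu m; simp [h0] at this
    have hr : ∀ m, h (m + 2) / h (m + 1) = 2 - c m / (h (m + 1) / h m) :=
      fun m => hh.ratio_succ (nz hhp _)
    have hs : ∀ m, k (m + 2) / k (m + 1) = 2 - c m / (k (m + 1) / k m) :=
      fun m => hk.ratio_succ (nz hkp _)
    have hs0 : ∀ m, 0 < k (m + 1) / k m := fun m => ratio_pos_iff_mul_pos (hkp m)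
    have hlt' : ∀ m, k (m + 1) / k m < h (m + 1) / h m := by
      intro m
      induction m with
      | zero => exact hlt
      | succ m ih =>
        rw [hr, hs]
        have := div_lt_div_of_pos_left (hc m).1 (hs0 m) ih
        linarith
    exact riccati_unique (r := fun m => h (m + 1) / h m) (s := fun m => k (m + 1) / k m) hx
      hr hs hs0 (fun m => (hc m).1) hlt' (fun m => ratio_le_of_not_exceedsAt (hhp m) (hhe m))
  have h1 := key h k hh hk hhp hkp hhe
  have h2 := key k h hk hh hkp hhp hke
  have h0 : h 0 ≠ 0 := by intro h0; have := hhp 0; simp [h0] at this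
  have k0 : k 0 ≠ 0 := by intro h0; have := hkp 0; simp [h0] at this
  have h3 : k 1 / k 0 = h 1 / h 0 := le_antisymm (not_lt.1 h2) (not_lt.1 h1)
  rw [div_eq_div_iff k0 h0] at h3
  linarith

theorem NormSol.sub_smul {c h k : ℕ → ℝ} (hh : NormSol c h) (hk : NormSol c k) (l : ℝ) :
    NormSol c (fun n => h n - l * k n) := by
  intro n; simp only; rw [hh n, hk n]; ring

/-- If `h` has positive ratios below the supersolution and those of `k` lie above it, then
`h / k → 0`. -/
theorem tendsto_div_of_ratio {x : ℝ} {c h k : ℕ → ℝ} (hx : 1 ≤ x) (hc : SubKneser x c)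
    (hh : NormSol c h) (hk : NormSol c k) (hhp : ∀ m, 0 < h m * h (m + 1))
    (hhe : ∀ m, ¬ ExceedsAt x h m) (hke : ∀ m, ExceedsAt x k m) :
    Tendsto (fun n => h n / k n) atTop (𝓝 0) := by
  have nzh : ∀ m, h m ≠ 0 := by intro m h0; have := hhp m; simp [h0] at this
  have hkp : ∀ m, 0 < k m * k (m + 1) := fun m => (hke m).pos hx
  have nzk : ∀ m, k m ≠ 0 := by intro m h0; have := hkp m; simp [h0] at this
  -- `q n = |h n / k n|` decreases
  set q : ℕ → ℝ := fun n => (h n / k n) / (h 0 / k 0) with hq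
  have hstep : ∀ n, q (n + 1) = q n * ((h (n + 1) / h n) / (k (n + 1) / k n)) := by
    intro n
    have := nzh n; have := nzh 0; have := nzk 0; have := nzk n; have := nzk (n + 1)
    simp only [hq]; field_simp
  have hfac : ∀ n, 0 < (h (n + 1) / h n) / (k (n + 1) / k n) ∧
      (h (n + 1) / h n) / (k (n + 1) / k n) < 1 := by
    intro n
    have a := ratio_pos_iff_mul_pos (hhp n)
    have b := ratio_pos_iff_mul_pos (hkp n)
    refine ⟨div_pos a b, ?_⟩
    rw [div_lt_one b]
    exact (ratio_le_of_not_exceedsAt (hhp n) (hhe n)).trans_lt (lt_ratio_of_exceedsAt hx (hke n))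
  have hq0 : q 0 = 1 := div_self (div_ne_zero (nzh 0) (nzk 0))
  have hqpos : ∀ n, 0 < q n := by
    intro n
    induction n with
    | zero => rw [hq0]; norm_num
    | succ n ih => rw [hstep]; exact mul_pos ih (hfac n).1
  have hanti : StrictAnti q := by
    apply strictAnti_nat_of_succ_lt
    intro n; rw [hstep]
    nlinarith [hqpos n, hfac n]
  have hlim := tendsto_atTop_ciInf hanti.antitone ⟨0, by rintro _ ⟨n, rfl⟩; exact (hqpos n).le⟩
  set l := ⨅ n, q n with hl
  have hll : ∀ n, l < q n := fun n =>
    lt_of_le_of_lt (hanti.antitone.le_of_tendsto hlim (n + 1)) (hanti (Nat.lt_succ_self n))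
  have hl0 : 0 ≤ l := ge_of_tendsto' hlim fun n => (hqpos n).le
  have hl00 : l = 0 := by
    by_contra hne
    have hlpos : 0 < l := lt_of_le_of_ne hl0 (Ne.symm hne)
    -- the solution `z = h - l' k`
    set l' := l * (h 0 / k 0) with hl'
    have hz := hh.sub_smul hk l'
    have hzh : ∀ n, h n - l' * k n = h n * (1 - l / q n) := by
      intro n
      have := nzh n; have := nzh 0; have := nzk 0; have := nzk n
      simp only [hq, hl']; field_simp
    have h1 : ∀ n, 0 < 1 - l / q n := by
      intro n
      have : l / q n < 1 := by rw [div_lt_one (hqpos n)]; exact hll n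
      linarith
    have h2 : ∀ n, 1 - l / q (n + 1) < 1 - l / q n := by
      intro n
      have := div_lt_div_of_pos_left hlpos (hqpos (n + 1)) (hanti (Nat.lt_succ_self n))
      linarith
    have hzr : ∀ n, (h (n + 1) - l' * k (n + 1)) / (h n - l' * k n) =
        h (n + 1) / h n * ((1 - l / q (n + 1)) / (1 - l / q n)) := by
      intro n
      rw [hzh, hzh, mul_div_mul_comm]
    have hznz : ∀ n, h n - l' * k n ≠ 0 := fun n => by
      rw [hzh]; exact mul_ne_zero (nzh n) (h1 n).ne'
    -- The factor `1 - l / q` is positive and decreasing, so `h - l' k` has positive ratios strictly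
    -- below those of `h`. Two such solutions under the supersolution cannot coexist.
    refine riccati_unique (r := fun m => h (m + 1) / h m)
      (s := fun m => (h (m + 1) - l' * k (m + 1)) / (h m - l' * k m)) hx
      (fun m => hh.ratio_succ (nzh _)) (fun m => hz.ratio_succ (hznz _)) ?_
      (fun m => (hc m).1) ?_ (fun m => ratio_le_of_not_exceedsAt (hhp m) (hhe m))
    · intro m
      rw [hzr]
      exact mul_pos (ratio_pos_iff_mul_pos (hhp m)) (div_pos (h1 _) (h1 _))
    · intro m
      rw [hzr]
      have a := ratio_pos_iff_mul_pos (hhp m)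
      have b : (1 - l / q (m + 1)) / (1 - l / q m) < 1 := by
        rw [div_lt_one (h1 m)]; exact h2 m
      nlinarith
  rw [hl00] at hlim
  have := hlim.mul_const (h 0 / k 0)
  rw [zero_mul] at this
  refine this.congr fun n => ?_
  exact div_mul_cancel₀ _ (div_ne_zero (nzh 0) (nzk 0))

/-- An independent `k` must exceed the supersolution somewhere, since otherwise it would be
proportional to `h`. From that index on, the comparison of ratios applies to the shifted recurrence.
-/
theorem minimal_of_not_exceedsAt {x : ℝ} {c h k : ℕ → ℝ} (hx : 1 ≤ x) (hc : SubKneser x c)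
    (hh : NormSol c h) (hk : NormSol c k) (hhn : ¬ (h 0 = 0 ∧ h 1 = 0))
    (hhe : ∀ m, ¬ ExceedsAt x h m) (hne : h 0 * k 1 ≠ h 1 * k 0) :
    (∀ᶠ n in atTop, k n ≠ 0) ∧ Tendsto (fun n => h n / k n) atTop (𝓝 0) := by
  have hkn : ¬ (k 0 = 0 ∧ k 1 = 0) := fun ⟨a, b⟩ => hne (by rw [a, b]; ring)
  have : ∃ M, ExceedsAt x k M := by
    by_contra hcon
    push Not at hcon
    exact hne (proportional_of_not_exceedsAt hx hc hh hk hhn hkn hhe hcon)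
  obtain ⟨M, hM⟩ := this
  have hMall : ∀ m, M ≤ m → ExceedsAt x k m := fun m hm => hM.of_le hx hc hk hm
  refine ⟨eventually_atTop.2 ⟨M, fun m hm h0 => ?_⟩, ?_⟩
  · have := (hMall m hm).pos hx; simp [h0] at this
  have hconv : ∀ (u : ℕ → ℝ) (m : ℕ),
      ExceedsAt (x + M) (fun n => u (n + M)) m ↔ ExceedsAt x u (m + M) := by
    intro u m
    unfold ExceedsAt
    beta_reduce
    rw [supRatio_shift, show m + 1 + M = m + M + 1 by ring]
  have := tendsto_div_of_ratio (x := x + M) (h := fun n => h (n + M)) (k := fun n => k (n + M))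
    (by have : (0 : ℝ) ≤ M := by positivity
        linarith) (hc.shift M) (hh.shift M) (hk.shift M)
    (fun m => by
      have := ratio_pos_of_not_exceedsAt hx hc hh hhn hhe (m + M)
      rwa [show m + 1 + M = m + M + 1 by ring])
    (fun m => by rw [hconv]; exact hhe _)
    (fun m => by rw [hconv]; exact hMall _ (by omega))
  exact (tendsto_add_atTop_iff_nat M).1 this

theorem NormSol.exists_of_values {c : ℕ → ℝ} (hc : ∀ n, c n ≠ 0) (m : ℕ) :
    ∀ a b : ℝ, ∃ k, NormSol c k ∧ k m = a ∧ k (m + 1) = b := by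
  induction m with
  | zero =>
    intro a b
    let s : ℕ → ℝ × ℝ := fun n => Nat.rec (a, b) (fun i p => (p.2, 2 * p.2 - c i * p.1)) n
    exact ⟨fun n => (s n).1, fun n => rfl, rfl, rfl⟩
  | succ m ih =>
    intro a b
    obtain ⟨k, hk, h1, h2⟩ := ih ((2 * a - b) / c m) a
    refine ⟨k, hk, h2, ?_⟩
    rw [hk m, h1, h2]
    have := hc m
    field_simp; ring

/-- The witness `k` agrees with `h` at `m` but leaves with ratio exactly `supRatio x m`. Its ratios
remain between the supersolution and those of `h`, so `h / k` starts at `1` and never falls below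
it. -/
theorem exists_not_tendsto_of_exceedsAt {x : ℝ} {c h : ℕ → ℝ} (hx : 1 ≤ x) (hc : SubKneser x c)
    (hh : NormSol c h) {m : ℕ} (hm : ExceedsAt x h m) :
    ∃ k, NormSol c k ∧ h 0 * k 1 ≠ h 1 * k 0 ∧ ¬ Tendsto (fun n => h n / k n) atTop (𝓝 0) := by
  have hcn : ∀ n, c n ≠ 0 := fun n => (hc n).1.ne'
  obtain ⟨k, hk, hk0, hk1⟩ := NormSol.exists_of_values hcn m (h m) (supRatio x m * h m)
  have hpos := hm.pos hx
  have h0 : h m ≠ 0 := by rintro h0; simp [h0] at hpos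
  have hhp : ∀ n, m ≤ n → 0 < h n * h (n + 1) := fun n hn => (hm.of_le hx hc hh hn).pos hx
  -- the ratios of `k` stay above the supersolution and below those of `h`
  have main : ∀ n, m ≤ n → k n ≠ 0 ∧ supRatio x n ≤ k (n + 1) / k n ∧
      k (n + 1) / k n < h (n + 1) / h n ∧ 1 ≤ h n / k n := by
    intro n hn
    induction n, hn using Nat.le_induction with
    | base =>
      rw [hk0, hk1]
      refine ⟨h0, by rw [mul_div_cancel_right₀ _ h0], ?_, by rw [div_self h0]⟩
      rw [mul_div_cancel_right₀ _ h0]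
      exact lt_ratio_of_exceedsAt hx hm
    | succ n hn ih =>
      obtain ⟨i1, i2, i3, i4⟩ := ih
      have hr := supRatio_pos hx n
      have kp : 0 < k (n + 1) / k n := by linarith
      have k1 : k (n + 1) ≠ 0 := by rintro h0; simp [h0] at kp
      have hn0 : h n ≠ 0 := by rintro h0; have := hhp n hn; simp [h0] at this
      have hn1 : h (n + 1) ≠ 0 := by rintro h0; have := hhp n hn; simp [h0] at this
      refine ⟨k1, ?_, ?_, ?_⟩
      · rw [hk.ratio_succ k1]
        have h1 := hc.le_mul hx n
        have hr' := supRatio_pos hx (n + 1)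
        have : c n / (k (n + 1) / k n) ≤ 2 - supRatio x (n + 1) := by
          rw [div_le_iff₀ kp]
          nlinarith
        linarith
      · rw [hk.ratio_succ k1, hh.ratio_succ hn1]
        have := div_lt_div_of_pos_left (hc n).1 kp i3
        linarith
      · have : h (n + 1) / k (n + 1) = h n / k n * ((h (n + 1) / h n) / (k (n + 1) / k n)) := by
          field_simp
        rw [this]
        have h2 : 1 ≤ (h (n + 1) / h n) / (k (n + 1) / k n) := by
          rw [one_le_div kp]; exact i3.le
        nlinarith
  refine ⟨k, hk, ?_, ?_⟩
  · intro heq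
    -- the Casoratian
    have cas : ∀ n, h n * k (n + 1) = h (n + 1) * k n := by
      intro n
      induction n with
      | zero => exact heq
      | succ n ih => rw [hk n, hh n]; linear_combination c n * ih
    have h1 := (main m le_rfl).2.2.1
    have kn := (main m le_rfl).1
    have h2 : k (m + 1) / k m = h (m + 1) / h m := by
      rw [div_eq_div_iff kn h0]; linarith [cas m]
    exact h1.ne h2
  · intro ht
    have := ge_of_tendsto ht (eventually_atTop.2 ⟨m, fun n hn => (main n hn).2.2.2⟩)
    linarith

end HolonomicSign

namespace HolonomicSign

open Filter Topology Polynomial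

/-! ### Recurrences with arbitrary real coefficient sequences -/

/-- `f` solves `f (n + 2) = P n * f (n + 1) + Q n * f n`. -/
def Solves (P Q f : ℕ → ℝ) : Prop := ∀ n, f (n + 2) = P n * f (n + 1) + Q n * f n

/-- Minimality of a solution of a recurrence with real coefficient sequences. -/
def MinimalSol (P Q f : ℕ → ℝ) : Prop :=
  ∀ g : ℕ → ℝ, Solves P Q g → LinearIndependent ℝ ![f, g] →
    (∀ᶠ n in atTop, g n ≠ 0) ∧ Tendsto (fun n => f n / g n) atTop (𝓝 0)

/-- The gauge factor that normalizes a recurrence. -/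
noncomputable def gauge (P : ℕ → ℝ) : ℕ → ℝ
  | 0 => 1
  | n + 1 => gauge P n * (P n / 2)

/-- The coefficient of the normalized recurrence. -/
noncomputable def normCoeff (P Q : ℕ → ℝ) (n : ℕ) : ℝ := -(4 * Q (n + 1)) / (P (n + 1) * P n)

/-- The normalization of a sequence. -/
noncomputable def normSeq (P y : ℕ → ℝ) (n : ℕ) : ℝ := y (n + 1) / gauge P n

/-- `ExceedsAt` in terms of the original sequence. -/
def SolExceedsAt (x : ℝ) (P y : ℕ → ℝ) (m : ℕ) : Prop :=
  supRatio x m * y (m + 1) ^ 2 < 2 * (y (m + 1) * y (m + 2)) / P m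

variable {P Q y : ℕ → ℝ}

theorem gauge_ne_zero (hP : ∀ n, P n ≠ 0) (n : ℕ) : gauge P n ≠ 0 := by
  induction n with
  | zero => simp [gauge]
  | succ n ih => simp only [gauge]; have := hP n; positivity

theorem Solves.normSol (hy : Solves P Q y) (hP : ∀ n, P n ≠ 0) :
    NormSol (normCoeff P Q) (normSeq P y) := by
  intro n
  unfold normSeq normCoeff
  rw [show n + 2 + 1 = (n + 1) + 2 by ring, hy (n + 1)]
  have h1 := hP n
  have h2 := hP (n + 1)
  have h3 := gauge_ne_zero hP n
  simp only [gauge]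
  field_simp; ring

theorem exceedsAt_normSeq (hP : ∀ n, P n ≠ 0) (x : ℝ) (m : ℕ) :
    ExceedsAt x (normSeq P y) m ↔ SolExceedsAt x P y m := by
  unfold ExceedsAt SolExceedsAt normSeq
  have h1 := hP m
  have h3 := gauge_ne_zero hP m
  have e1 : supRatio x m * (y (m + 1) / gauge P m) ^ 2 =
      (supRatio x m * y (m + 1) ^ 2) / gauge P m ^ 2 := by field_simp
  have e2 : y (m + 1) / gauge P m * (y (m + 1 + 1) / gauge P (m + 1)) =
      (2 * (y (m + 1) * y (m + 2)) / P m) / gauge P m ^ 2 := by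
    simp only [gauge]; field_simp
  rw [e1, e2]
  exact div_lt_div_iff_of_pos_right (by positivity)

theorem Solves.eq_zero (hy : Solves P Q y) {n m : ℕ} (hQ : ∀ i, n ≤ i → Q i ≠ 0)
    (hnm : n ≤ m) (h0 : y m = 0) (h1 : y (m + 1) = 0) : y n = 0 ∧ y (n + 1) = 0 := by
  induction m, hnm using Nat.le_induction with
  | base => exact ⟨h0, h1⟩
  | succ m hm ih =>
    have := hy m
    rw [h1, h0] at this
    have h2 : y m = 0 := by
      have : Q m * y m = 0 := by linarith
      exact (mul_eq_zero.1 this).resolve_left (hQ m hm)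
    exact ih h2 h0

theorem Solves.eq_zero_forward (hy : Solves P Q y) {n m : ℕ}
    (hnm : n ≤ m) (h0 : y n = 0) (h1 : y (n + 1) = 0) : y m = 0 ∧ y (m + 1) = 0 := by
  induction m, hnm using Nat.le_induction with
  | base => exact ⟨h0, h1⟩
  | succ m hm ih => exact ⟨ih.2, by rw [hy m, ih.1, ih.2]; ring⟩

theorem normSeq_nontrivial (hy : Solves P Q y) (hP : ∀ n, P n ≠ 0) (hQ : ∀ n, Q n ≠ 0)
    (hne : ¬ (y 0 = 0 ∧ y 1 = 0)) : ¬ (normSeq P y 0 = 0 ∧ normSeq P y 1 = 0) := by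
  rintro ⟨h0, h1⟩
  unfold normSeq at h0 h1
  rw [div_eq_zero_iff] at h0 h1
  exact hne (hy.eq_zero (n := 0) (m := 1) (fun i _ => hQ i) (by omega)
    (h0.resolve_right (gauge_ne_zero hP _)) (h1.resolve_right (gauge_ne_zero hP _)))

/-- `normSeq` forgets the term of index `0`. It is recovered by running the recurrence backwards
once, using `Q 0 ≠ 0`. -/
theorem exists_solves_normSeq {c k : ℕ → ℝ} (hP : ∀ n, P n ≠ 0) (hQ : ∀ n, Q n ≠ 0)
    (hc : c = normCoeff P Q) (hk : NormSol c k) :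
    ∃ g, Solves P Q g ∧ normSeq P g = k := by
  let G : ℕ → ℝ := fun n => k n * gauge P n
  let g : ℕ → ℝ := fun n => Nat.casesOn n ((G 1 - P 0 * G 0) / Q 0) G
  refine ⟨g, ?_, ?_⟩
  · intro n
    cases n with
    | zero =>
      show G 1 = P 0 * G 0 + Q 0 * ((G 1 - P 0 * G 0) / Q 0)
      have := hQ 0
      field_simp; ring
    | succ n =>
      show G (n + 2) = P (n + 1) * G (n + 1) + Q (n + 1) * G n
      simp only [G, gauge]
      rw [hk n, hc]
      unfold normCoeff
      have h1 := hP n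
      have h2 := hP (n + 1)
      field_simp; ring
  · funext n
    show G n / gauge P n = k n
    exact mul_div_cancel_right₀ _ (gauge_ne_zero hP n)

/-- Independence is nonvanishing of the Casoratian. Moving it from index `0` to index `1`, where
`normSeq` starts, costs a factor `-Q 0`. -/
theorem Solves.independent_iff {f g : ℕ → ℝ} (hf : Solves P Q f) (hg : Solves P Q g)
    (hP : ∀ n, P n ≠ 0) (hQ : ∀ n, Q n ≠ 0) :
    LinearIndependent ℝ ![f, g] ↔
      normSeq P f 0 * normSeq P g 1 ≠ normSeq P f 1 * normSeq P g 0 := by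
  have e : normSeq P f 0 * normSeq P g 1 ≠ normSeq P f 1 * normSeq P g 0 ↔
      f 0 * g 1 ≠ f 1 * g 0 := by
    apply not_congr
    have h0 := gauge_ne_zero hP 0
    have h1 := gauge_ne_zero hP 1
    unfold normSeq
    rw [div_mul_div_comm, div_mul_div_comm, mul_comm (gauge P 1),
      div_left_inj' (mul_ne_zero h0 h1)]
    show f 1 * g 2 = f 2 * g 1 ↔ _
    rw [hf 0, hg 0]
    constructor
    · intro h
      have : Q 0 * (f 0 * g 1 - f 1 * g 0) = 0 := by
        simp only [zero_add] at h; linear_combination -h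
      have := (mul_eq_zero.1 this).resolve_left (hQ 0)
      linarith
    · intro h
      simp only [zero_add]; linear_combination -(Q 0) * h
  rw [e, LinearIndependent.pair_iff]
  constructor
  · intro h heq
    have comb : ∀ s t : ℝ, s * f 0 + t * g 0 = 0 → s * f 1 + t * g 1 = 0 →
        s = 0 ∧ t = 0 := by
      intro s t a b
      apply h s t
      funext n
      have hs : Solves P Q (fun n => s * f n + t * g n) := by
        intro n; simp only; rw [hf n, hg n]; ring
      exact (hs.eq_zero_forward (Nat.zero_le n) a b).1
    have a := comb (g 0) (-f 0) (by ring) (by linarith)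
    have b := comb (g 1) (-f 1) (by linarith) (by ring)
    have := comb 1 1 (by rw [a.1, neg_eq_zero.1 a.2]; ring) (by rw [b.1, neg_eq_zero.1 b.2]; ring)
    exact one_ne_zero this.1
  · intro h s t hst
    have h0 : s * f 0 + t * g 0 = 0 := congrFun hst 0
    have h1 : s * f 1 + t * g 1 = 0 := congrFun hst 1
    have hd : f 0 * g 1 - f 1 * g 0 ≠ 0 := sub_ne_zero.2 h
    constructor
    · exact (mul_eq_zero.1 (by linear_combination g 1 * h0 - g 0 * h1 :
        s * (f 0 * g 1 - f 1 * g 0) = 0)).resolve_right hd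
    · exact (mul_eq_zero.1 (by linear_combination f 0 * h1 - f 1 * h0 :
        t * (f 0 * g 1 - f 1 * g 0) = 0)).resolve_right hd

theorem normSeq_div_normSeq {f g : ℕ → ℝ} (hP : ∀ n, P n ≠ 0) (n : ℕ) :
    normSeq P f n / normSeq P g n = f (n + 1) / g (n + 1) :=
  div_div_div_cancel_right₀ (gauge_ne_zero hP n) _ _

/-- With `not_exceeds_of_minimalSol` this makes minimality of a nontrivial solution equivalent to
never crossing the supersolution. Non-minimality thereby becomes semidecidable. -/
theorem minimalSol_of_not_exceeds {x : ℝ} (hx : 1 ≤ x) (hP : ∀ n, P n ≠ 0) (hQ : ∀ n, Q n ≠ 0)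
    (hc : SubKneser x (normCoeff P Q)) (hy : Solves P Q y) (hne : ¬ (y 0 = 0 ∧ y 1 = 0))
    (hnot : ∀ m, ¬ SolExceedsAt x P y m) : MinimalSol P Q y := by
  intro g hg hind
  obtain ⟨h1, h2⟩ := minimal_of_not_exceedsAt hx hc (hy.normSol hP) (hg.normSol hP)
    (normSeq_nontrivial hy hP hQ hne) (fun m => by rw [exceedsAt_normSeq hP]; exact hnot m)
    ((hy.independent_iff hg hP hQ).1 hind)
  constructor
  · obtain ⟨M, hM⟩ := eventually_atTop.1 h1
    refine eventually_atTop.2 ⟨M + 1, fun n hn h0 => ?_⟩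
    obtain ⟨m, rfl⟩ := Nat.exists_eq_add_of_le hn
    apply hM (M + m) (by omega)
    unfold normSeq
    rw [show M + m + 1 = M + 1 + m by ring, h0, zero_div]
  · simp only [normSeq_div_normSeq hP] at h2
    exact (tendsto_add_atTop_iff_nat 1).1 h2

theorem not_exceeds_of_minimalSol {x : ℝ} (hx : 1 ≤ x) (hP : ∀ n, P n ≠ 0) (hQ : ∀ n, Q n ≠ 0)
    (hc : SubKneser x (normCoeff P Q)) (hy : Solves P Q y) (hmin : MinimalSol P Q y) (m : ℕ) :
    ¬ SolExceedsAt x P y m := by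
  intro hm
  rw [← exceedsAt_normSeq hP] at hm
  obtain ⟨k, hk, h1, h2⟩ := exists_not_tendsto_of_exceedsAt hx hc (hy.normSol hP) hm
  obtain ⟨g, hg, rfl⟩ := exists_solves_normSeq hP hQ rfl hk
  apply h2
  simp only [normSeq_div_normSeq hP]
  exact (tendsto_add_atTop_iff_nat 1).2 (hmin g hg ((hy.independent_iff hg hP hQ).2 h1)).2

theorem SolExceedsAt.of_le {x : ℝ} (hx : 1 ≤ x) (hP : ∀ n, P n ≠ 0)
    (hc : SubKneser x (normCoeff P Q)) (hy : Solves P Q y) {m n : ℕ}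
    (hm : SolExceedsAt x P y m) (hmn : m ≤ n) : SolExceedsAt x P y n := by
  rw [← exceedsAt_normSeq hP] at hm ⊢
  exact hm.of_le hx hc (hy.normSol hP) hmn

/-- In both alternatives consecutive normalized terms have equal sign. The gauge factors at `m` and
`m + 2` differ by `P m * P (m + 1) / 4 > 0`, so the sign of `y` itself repeats after two steps,
though not necessarily after one. -/
theorem mul_pos_of_minimal_or_exceeds {x : ℝ} (hx : 1 ≤ x) (hP : ∀ n, 0 < P n * P (n + 1))
    (hQ : ∀ n, Q n ≠ 0) (hc : SubKneser x (normCoeff P Q)) (hy : Solves P Q y)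
    (hne : ¬ (y 0 = 0 ∧ y 1 = 0)) (h : MinimalSol P Q y ∨ SolExceedsAt x P y 0) (m : ℕ) :
    0 < y (m + 1) * y (m + 3) := by
  have hP0 : ∀ n, P n ≠ 0 := by intro n h0; have := hP n; simp [h0] at this
  have key : ∀ m, 0 < normSeq P y m * normSeq P y (m + 1) := by
    intro m
    rcases h with h | h
    · exact ratio_pos_of_not_exceedsAt hx hc (hy.normSol hP0) (normSeq_nontrivial hy hP0 hQ hne)
        (fun m => by
          rw [exceedsAt_normSeq hP0]; exact not_exceeds_of_minimalSol hx hP0 hQ hc hy h m) m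
    · rw [← exceedsAt_normSeq hP0] at h
      exact (h.of_le hx hc (hy.normSol hP0) (Nat.zero_le m)).pos hx
  have h1 := mul_pos (key m) (key (m + 1))
  unfold normSeq at h1
  have hg := gauge_ne_zero hP0 m
  have h2 : y (m + 1) / gauge P m * (y (m + 1 + 1) / gauge P (m + 1)) *
      (y (m + 1 + 1) / gauge P (m + 1) * (y (m + 1 + 1 + 1) / gauge P (m + 1 + 1))) =
      (y (m + 1) * y (m + 3)) * ((y (m + 2) / (gauge P m * gauge P (m + 1))) ^ 2 * (4 /
        (P m * P (m + 1)))) := by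
    have a := hP0 m
    have b := hP0 (m + 1)
    simp only [gauge]
    field_simp
    ring_nf
  rw [h2] at h1
  refine pos_of_mul_pos_left h1 ?_
  have := hP m
  positivity

end HolonomicSign

namespace HolonomicSign

open Filter Topology Polynomial

/-! ### Oscillation -/

/-- Kneser's oscillation criterion. -/
theorem kneser_oscillation {c h : ℕ → ℝ} {x γ : ℝ} (hx : 0 < x) (hγ : 1 / 4 < γ)
    (hh : NormSol c h) (hpos : ∀ n, 0 < h n) (hc : ∀ n : ℕ, 1 + γ / (n + x) ^ 2 ≤ c n) :
    False := by
  have hX : ∀ n : ℕ, 0 < (n : ℝ) + x := fun n => by positivity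
  have he : ∀ n, 1 < c n := fun n => by
    have := hX n
    have : 0 < γ / ((n : ℝ) + x) ^ 2 := by positivity
    linarith [hc n]
  have hd : ∀ n, h (n + 2) - h (n + 1) < h (n + 1) - h n := by
    intro n; rw [hh n]; nlinarith [he n, hpos n]
  -- Since `c > 1`, a positive solution is strictly concave. One strict descent would force a linear
  -- descent below zero.
  have hmono : ∀ n, h n ≤ h (n + 1) := by
    intro n
    by_contra hcon
    push Not at hcon
    refine not_bddBelow_of_harmonic_decrease (z := fun m => h (n + m)) (δ := h n - h (n + 1))
      (x := 1) (K := 0) (by linarith) one_pos (fun m => (hpos _).le) fun m => ?_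
    have h1 : ∀ m, h (n + m + 1) - h (n + m) ≤ h (n + 1) - h n := by
      intro m
      induction m with
      | zero => simp
      | succ m ih => exact (hd (n + m)).le.trans ih
    have h2 : (h n - h (n + 1)) / ((m : ℝ) + 1) ≤ h n - h (n + 1) :=
      div_le_self (by linarith) (by have : (0 : ℝ) ≤ m := by positivity
                                    linarith)
    have := h1 m
    simp only [← add_assoc]
    linarith
  set u : ℕ → ℝ := fun n => h (n + 1) / h n - 1 with hu
  have hu0 : ∀ n, 0 ≤ u n := fun n => by
    have : 1 ≤ h (n + 1) / h n := (one_le_div (hpos n)).2 (hmono n)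
    simp only [hu]; linarith
  have hstep : ∀ n, u (n + 1) = (u n - (c n - 1)) / (1 + u n) := by
    intro n
    have h1 := (hpos n).ne'
    have h2 := (hpos (n + 1)).ne'
    simp only [hu]
    rw [show n + 1 + 1 = n + 2 by ring, hh n, add_sub_cancel]
    field_simp; ring
  have hanti : ∀ n, u (n + 1) ≤ u n := by
    intro n
    rw [hstep, div_le_iff₀ (by linarith [hu0 n])]
    nlinarith [he n, hu0 n, mul_nonneg (hu0 n) (hu0 n)]
  have hle : ∀ n, u n ≤ u 0 := fun n => antitone_nat_of_succ_le hanti (Nat.zero_le n)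
  -- The critical scale is `u ≈ 1 / (2n)`, so the bounded-below quantity to follow is `(m + x) * u
  -- m`.
  refine not_bddBelow_of_harmonic_decrease (z := fun m => (m + x) * u m)
    (δ := (γ - 1 / 4) / (1 + u 0)) (x := x) (K := 0) (div_pos (by linarith) (by linarith [hu0 0])) hx
    (fun m => mul_nonneg (hX m).le (hu0 m)) fun m => ?_
  have hXm := hX m
  have hum := hu0 m
  have h1u : 0 < 1 + u m := by linarith
  push_cast
  rw [hstep]
  set X := (m : ℝ) + x with hXd
  have h1 : (m : ℝ) + 1 + x = X + 1 := by rw [hXd]; ring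
  rw [h1]
  have h2 : (X + 1) * ((u m - (c m - 1)) / (1 + u m)) =
      X * u m + (u m - X * u m ^ 2 - (X + 1) * (c m - 1)) / (1 + u m) := by
    field_simp; ring
  rw [h2]
  -- The maximum of `u - X u²` over `u` is `1 / (4X)`. This is where the constant `1/4` comes from.
  have h3 : u m - X * u m ^ 2 ≤ 1 / (4 * X) := by
    rw [le_div_iff₀ (by positivity)]
    nlinarith [sq_nonneg (2 * X * u m - 1)]
  have h4 : γ / X ≤ (X + 1) * (c m - 1) := by
    have h5 : γ / X ^ 2 ≤ c m - 1 := by linarith [hc m]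
    have h6 : 0 < γ / X ^ 2 := by positivity
    calc γ / X = X * (γ / X ^ 2) := by field_simp
      _ ≤ (X + 1) * (c m - 1) := by nlinarith
  have h5 : u m - X * u m ^ 2 - (X + 1) * (c m - 1) ≤ -((γ - 1 / 4) / X) := by
    have : 1 / (4 * X) - γ / X = -((γ - 1 / 4) / X) := by field_simp; ring
    linarith
  have h6 : (u m - X * u m ^ 2 - (X + 1) * (c m - 1)) / (1 + u m) ≤
      -((γ - 1 / 4) / X) / (1 + u m) := div_le_div_of_nonneg_right h5 h1u.le
  have h7 : (γ - 1 / 4) / (1 + u 0) / X ≤ (γ - 1 / 4) / X / (1 + u m) := by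
    rw [div_right_comm]
    exact div_le_div_of_nonneg_left (div_nonneg (by linarith) hXm.le) h1u (by linarith [hle m])
  rw [neg_div] at h6
  linarith

/-- After a sign change, a solution of a nearly constant recurrence with double characteristic
root keeps its sign for a long time. -/
theorem long_positive_run (T : ℕ) : ∃ ε > 0, ∀ (c g : ℕ → ℝ), NormSol c g →
    (∀ n, |1 - c n| ≤ ε) → g 0 < 0 → 0 ≤ g 1 → ∀ j, 1 ≤ j → j ≤ T → 0 < g (j + 1) := by
  -- Terms up to index `T` are at most `4 ^ T * D`, where `D = g 1 - g 0`. Each increment therefore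
  -- differs from the previous one by at most `ε * 4 ^ T * D`, and after `T` steps more than half of
  -- the initial increment `D` is left.
  refine ⟨1 / (2 * (T + 1) * 4 ^ T), by positivity, ?_⟩
  intro c g hg hc h0 h1
  set ε : ℝ := 1 / (2 * (T + 1) * 4 ^ T) with hε
  have hε0 : 0 < ε := by positivity
  have hεT : ε * 4 ^ T * (T + 1) = 1 / 2 := by
    rw [hε]; field_simp
  have hε1 : ε ≤ 1 := by
    have h1 : (1 : ℝ) ≤ 4 ^ T := one_le_pow₀ (by norm_num)
    have h2 : (0 : ℝ) ≤ T := by positivity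
    have h3 : (1 : ℝ) ≤ 4 ^ T * (T + 1) := by nlinarith
    nlinarith
  set D := g 1 - g 0 with hD
  have hD0 : 0 < D := by linarith
  have key : ∀ j, j ≤ T → |g j| ≤ 4 ^ j * D ∧ |g (j + 1)| ≤ 4 ^ (j + 1) * D ∧
      D * (1 - j * (ε * 4 ^ T)) ≤ g (j + 1) - g j ∧ 0 ≤ g (j + 1) ∧ (1 ≤ j → 0 < g (j + 1)) := by
    intro j
    induction j with
    | zero =>
      intro _
      refine ⟨?_, ?_, ?_, h1, by omega⟩
      · rw [abs_of_neg h0]; simp; linarith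
      · rw [abs_of_nonneg h1]; simp; linarith
      · simp [hD]
    | succ j ih =>
      intro hj
      obtain ⟨a1, a2, a3, a4, a5⟩ := ih (by omega)
      have hcj := hc j
      have hgj := hg j
      have hb1 : |(1 - c j) * g j| ≤ ε * (4 ^ T * D) := by
        rw [abs_mul]
        have : (4 : ℝ) ^ j ≤ 4 ^ T := pow_le_pow_right₀ (by norm_num) (by omega)
        calc |1 - c j| * |g j| ≤ ε * (4 ^ j * D) :=
              mul_le_mul hcj a1 (abs_nonneg _) hε0.le
          _ ≤ ε * (4 ^ T * D) := by gcongr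
      have hdiff : g (j + 2) - g (j + 1) = g (j + 1) - g j + (1 - c j) * g j := by
        rw [hgj]; ring
      have hd1 : D * (1 - (j + 1 : ℕ) * (ε * 4 ^ T)) ≤ g (j + 2) - g (j + 1) := by
        rw [hdiff]; push_cast
        have := neg_abs_le ((1 - c j) * g j)
        nlinarith
      have hpos : 0 < D * (1 - (j + 1 : ℕ) * (ε * 4 ^ T)) := by
        apply mul_pos hD0
        have h2 : ((j + 1 : ℕ) : ℝ) ≤ T := by exact_mod_cast hj
        have h3 : 0 < ε * 4 ^ T := by positivity
        nlinarith
      refine ⟨a2, ?_, hd1, by linarith, fun _ => by linarith⟩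
      have : g (j + 2) = 2 * g (j + 1) - g j + (1 - c j) * g j := by rw [hgj]; ring
      have hb2 : |(1 - c j) * g j| ≤ 4 ^ j * D := by
        rw [abs_mul]
        calc |1 - c j| * |g j| ≤ 1 * (4 ^ j * D) :=
              mul_le_mul (hcj.trans hε1) a1 (abs_nonneg _) zero_le_one
          _ = _ := one_mul _
      rw [show j + 1 + 1 = j + 2 by ring, this]
      calc |2 * g (j + 1) - g j + (1 - c j) * g j|
          ≤ |2 * g (j + 1) - g j| + |(1 - c j) * g j| := abs_add_le _ _
        _ ≤ |2 * g (j + 1)| + |g j| + |(1 - c j) * g j| := by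
            gcongr; exact abs_sub _ _
        _ ≤ 2 * (4 ^ (j + 1) * D) + 4 ^ j * D + 4 ^ j * D := by
            gcongr; rw [abs_mul]; norm_num; exact a2
        _ ≤ 4 ^ (j + 2) * D := by
            have : 0 < (4 : ℝ) ^ j * D := by positivity
            rw [pow_add, pow_add]; nlinarith
  intro j hj1 hjT
  exact (key j hjT).2.2.2.2 hj1

theorem NormSol.neg {c h : ℕ → ℝ} (hh : NormSol c h) : NormSol c (fun n => -h n) := by
  intro n; simp only; rw [hh n]; ring

/-- No sign pattern repeats for a nontrivial solution of a slowly oscillating recurrence. -/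
theorem no_period_of_oscillation {c h : ℕ → ℝ} {x γ : ℝ} {T N : ℕ} (hx : 0 < x) (hγ : 1 / 4 < γ)
    (hh : NormSol c h) (hlim : Tendsto c atTop (𝓝 1))
    (hc : ∀ n : ℕ, 1 + γ / (n + x) ^ 2 ≤ c n) (hne : ∀ n, ¬ (h n = 0 ∧ h (n + 1) = 0))
    (hT : 0 < T) (hper : ∀ n, N ≤ n → SignType.sign (h (n + T)) = SignType.sign (h n)) :
    False := by
  obtain ⟨ε, hε, hrun⟩ := long_positive_run T
  obtain ⟨M, hM⟩ := eventually_atTop.1 ((tendsto_order.1 (tendsto_iff_dist_tendsto_zero.1 hlim)).2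
    ε hε)
  have hM' : ∀ n, max M N ≤ n → |1 - c n| ≤ ε := by
    intro n hn
    have := hM n (le_of_max_le_left hn)
    rw [Real.dist_eq, abs_sub_comm] at this
    exact this.le
  -- no sign changes from `max M N` on
  have noch : ∀ (g : ℕ → ℝ), NormSol c g →
      (∀ n, N ≤ n → SignType.sign (g (n + T)) = SignType.sign (g n)) →
      ∀ n, max M N ≤ n → g n < 0 → g (n + 1) < 0 := by
    intro g hg hgp n hn h0
    by_contra h1
    push Not at h1
    have hs := hg.shift n
    have := hrun (fun i => c (i + n)) (fun i => g (i + n)) hs (fun i => hM' _ (by omega))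
      (by simpa using h0) (by simpa [add_comm] using h1)
    have hN := le_of_max_le_right hn
    -- After the sign change the term at distance `T` is positive, whereas periodicity makes it
    -- negative. The run lemma starts at `j = 1`, hence the separate treatment of `T = 1`.
    rcases Nat.lt_or_ge T 2 with hT2 | hT2
    · have : T = 1 := by omega
      subst this
      have h2 := hgp n hN
      rw [sign_neg h0, sign_eq_neg_one_iff] at h2
      linarith
    · have h3 := this (T - 1) (by omega) (by omega)
      have h2 := hgp n hN
      rw [sign_neg h0, sign_eq_neg_one_iff] at h2
      have : T - 1 + 1 + n = n + T := by omega
      simp only [this] at h3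
      linarith
  have fin : ∀ (g : ℕ → ℝ), NormSol c g →
      (∀ n, N ≤ n → SignType.sign (g (n + T)) = SignType.sign (g n)) →
      ∀ n, max M N ≤ n → ¬ g n < 0 := by
    intro g hg hgp n hn h0
    have hall : ∀ m, g (m + n) < 0 := by
      intro m
      induction m with
      | zero => simpa using h0
      | succ m ih =>
        have := noch g hg hgp (m + n) (by omega) ih
        rwa [show m + 1 + n = m + n + 1 by ring]
    refine kneser_oscillation (c := fun m => c (m + n)) (h := fun m => -g (m + n)) (x := x + n)
      (γ := γ) (by positivity) hγ (hg.shift n).neg (fun m => by linarith [hall m]) fun m => ?_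
    have := hc (m + n)
    push_cast at this
    rw [show (m : ℝ) + (x + n) = m + n + x by ring]
    exact this
  -- Neither `h` nor `-h` is ever negative late on, so two consecutive terms vanish.
  have a1 := fin h hh hper
  have a2 := fin (fun n => -h n) hh.neg (fun n hn => by
    simp only [Left.sign_neg]; rw [hper n hn])
  refine hne (max M N) ⟨?_, ?_⟩
  · have b1 := a1 _ le_rfl
    have b2 := a2 _ le_rfl
    linarith
  · have b1 := a1 (max M N + 1) (by omega)
    have b2 := a2 (max M N + 1) (by omega)
    linarith

end HolonomicSign

namespace HolonomicSign

open Filter Topology Polynomial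

/-! ### Recurrences between terms at distance `k` -/

/-- The coefficients `(A, B)` with `f (n + k) = A n * f (n + 1) + B n * f n`. -/
noncomputable def stepCoeff (P Q : ℕ → ℝ) : ℕ → (ℕ → ℝ) × (ℕ → ℝ)
  | 0 => (fun _ => 0, fun _ => 1)
  | k + 1 => (fun n => (stepCoeff P Q k).1 (n + 1) * P n + (stepCoeff P Q k).2 (n + 1),
      fun n => (stepCoeff P Q k).1 (n + 1) * Q n)

noncomputable def stepA (P Q : ℕ → ℝ) (k : ℕ) : ℕ → ℝ := (stepCoeff P Q k).1

noncomputable def stepB (P Q : ℕ → ℝ) (k : ℕ) : ℕ → ℝ := (stepCoeff P Q k).2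

variable {P Q f : ℕ → ℝ}

@[simp] theorem stepA_zero (n : ℕ) : stepA P Q 0 n = 0 := rfl
@[simp] theorem stepB_zero (n : ℕ) : stepB P Q 0 n = 1 := rfl
theorem stepA_succ (k n : ℕ) :
    stepA P Q (k + 1) n = stepA P Q k (n + 1) * P n + stepB P Q k (n + 1) := rfl
theorem stepB_succ (k n : ℕ) : stepB P Q (k + 1) n = stepA P Q k (n + 1) * Q n := rfl

theorem Solves.step (hf : Solves P Q f) (k : ℕ) :
    ∀ n, f (n + k) = stepA P Q k n * f (n + 1) + stepB P Q k n * f n := by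
  induction k with
  | zero => intro n; simp
  | succ k ih =>
    intro n
    rw [show n + (k + 1) = n + 1 + k by ring, ih (n + 1), stepA_succ, stepB_succ,
      show n + 1 + 1 = n + 2 by ring, hf n]
    ring

/-- The cocycle identity for products of companion matrices. It is needed to rewrite the step `2k`
through the step `k`. -/
theorem step_add (j k : ℕ) : ∀ n,
    stepA P Q (j + k) n =
      stepA P Q j (n + k) * stepA P Q (k + 1) n + stepB P Q j (n + k) * stepA P Q k n ∧
    stepB P Q (j + k) n =
      stepA P Q j (n + k) * stepB P Q (k + 1) n + stepB P Q j (n + k) * stepB P Q k n := by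
  induction k with
  | zero => intro n; simp [stepA_succ, stepB_succ]
  | succ k ih =>
    intro n
    have h := ih (n + 1)
    rw [show n + 1 + k = n + (k + 1) by ring] at h
    rw [← add_assoc]
    constructor
    · rw [stepA_succ (j + k), stepA_succ (k + 1), h.1, h.2, stepA_succ k n]; ring
    · rw [stepB_succ (j + k), stepB_succ (k + 1), h.1, stepB_succ k n]; ring

/-- The first coefficient of the recurrence between `f n`, `f (n + k)` and `f (n + 2 * k)`. -/
noncomputable def jumpP (P Q : ℕ → ℝ) (k n : ℕ) : ℝ := stepA P Q (2 * k) n / stepA P Q k n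

/-- The second coefficient of the recurrence between `f n`, `f (n + k)` and `f (n + 2 * k)`. -/
noncomputable def jumpQ (P Q : ℕ → ℝ) (k n : ℕ) : ℝ :=
  (stepB P Q (2 * k) n * stepA P Q k n - stepA P Q (2 * k) n * stepB P Q k n) / stepA P Q k n

theorem Solves.jump (hf : Solves P Q f) {k n : ℕ} (hA : stepA P Q k n ≠ 0) :
    f (n + 2 * k) = jumpP P Q k n * f (n + k) + jumpQ P Q k n * f n := by
  rw [hf.step (2 * k), hf.step k]
  unfold jumpP jumpQ
  field_simp; ring

theorem Solves.jump_solves (hf : Solves P Q f) {k N : ℕ} (hA : ∀ n, N ≤ n → stepA P Q k n ≠ 0) :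
    Solves (fun m => jumpP P Q k (N + k * m)) (fun m => jumpQ P Q k (N + k * m))
      (fun m => f (N + k * m)) := by
  intro m
  simp only
  rw [show N + k * (m + 2) = N + k * m + 2 * k by ring, hf.jump (hA _ (by omega)),
    show N + k * (m + 1) = N + k * m + k by ring]

/-! ### Elliptic limits -/

/-- The limits of `stepA`, `stepB` for a recurrence with convergent coefficients. -/
def limCoeff {R : Type*} [CommRing R] (p q : R) : ℕ → R × R
  | 0 => (0, 1)
  | k + 1 => ((limCoeff p q k).1 * p + (limCoeff p q k).2, (limCoeff p q k).1 * q)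

theorem tendsto_step {p q : ℝ} (hP : Tendsto P atTop (𝓝 p)) (hQ : Tendsto Q atTop (𝓝 q)) (k : ℕ) :
    Tendsto (stepA P Q k) atTop (𝓝 (limCoeff p q k).1) ∧
      Tendsto (stepB P Q k) atTop (𝓝 (limCoeff p q k).2) := by
  induction k with
  | zero => exact ⟨tendsto_const_nhds, tendsto_const_nhds⟩
  | succ k ih =>
    have h1 := (tendsto_add_atTop_iff_nat 1).2 ih.1
    have h2 := (tendsto_add_atTop_iff_nat 1).2 ih.2
    exact ⟨(h1.mul hP).add h2, h1.mul hQ⟩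

theorem limCoeff_add {R : Type*} [CommRing R] (p q : R) (j k : ℕ) :
    (limCoeff p q (j + k)).1 = (limCoeff p q j).1 * (limCoeff p q (k + 1)).1 +
      (limCoeff p q j).2 * (limCoeff p q k).1 ∧
    (limCoeff p q (j + k)).2 = (limCoeff p q j).1 * (limCoeff p q (k + 1)).2 +
      (limCoeff p q j).2 * (limCoeff p q k).2 := by
  induction k with
  | zero => simp [limCoeff]
  | succ k ih =>
    rw [← add_assoc]
    simp only [limCoeff] at ih ⊢
    rw [ih.1, ih.2]
    constructor <;> ring

/-- Completing the square in `r (m + 1) - r m = (R r + S - r²) / r` bounds the increment by `-η / r`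
for large `m`. Thus `r` decreases, then by at least a fixed amount each time, and cannot remain
positive. -/
theorem no_positive_of_elliptic {R S r : ℕ → ℝ} {p q : ℝ} (hR : Tendsto R atTop (𝓝 p))
    (hS : Tendsto S atTop (𝓝 q)) (hpq : p ^ 2 + 4 * q < 0) (hr : ∀ m, 0 < r m)
    (hrec : ∀ m, r (m + 1) = R m + S m / r m) : False := by
  have hl : Tendsto (fun m => S m + R m ^ 2 / 4) atTop (𝓝 (q + p ^ 2 / 4)) :=
    hS.add ((hR.pow 2).div_const 4)
  set η := -(q + p ^ 2 / 4) / 2 with hη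
  have hη0 : 0 < η := by rw [hη]; linarith
  obtain ⟨M, hM⟩ := eventually_atTop.1 ((tendsto_order.1 hl).2 (-η) (by rw [hη]; linarith))
  have hstep : ∀ m, M ≤ m → r (m + 1) ≤ r m - η / r m := by
    intro m hm
    have h1 := hr m
    have h2 : r (m + 1) - r m = (R m * r m + S m - r m ^ 2) / r m := by
      rw [hrec]; field_simp
    have h3 : (R m * r m + S m - r m ^ 2) / r m ≤ (-η) / r m := by
      apply div_le_div_of_nonneg_right _ h1.le
      nlinarith [hM m hm, sq_nonneg (r m - R m / 2)]
    rw [neg_div] at h3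
    linarith
  have hle : ∀ m, r (M + m) ≤ r M := by
    intro m
    induction m with
    | zero => exact le_rfl
    | succ m ih =>
      have := hstep (M + m) (by omega)
      have h2 : 0 < η / r (M + m) := div_pos hη0 (hr _)
      rw [← add_assoc]; linarith
  refine not_bddBelow_of_harmonic_decrease (z := fun m => r (M + m)) (δ := η / r M) (x := 1)
    (K := 0) (div_pos hη0 (hr M)) one_pos (fun m => (hr _).le) fun m => ?_
  have h1 := hstep (M + m) (by omega)
  have h2 : η / r M ≤ η / r (M + m) := div_le_div_of_nonneg_left hη0.le (hr _) (hle m)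
  have h3 : η / r M / ((m : ℝ) + 1) ≤ η / r M :=
    div_le_self (div_pos hη0 (hr M)).le (by have : (0 : ℝ) ≤ m := by positivity
                                            linarith)
  simp only [← add_assoc]
  linarith

/-- Along a progression of step `T` the signs are constant, so the ratios are positive. They solve
the Riccati recurrence of the `T`-step relation, which is elliptic in the limit unless its
off-diagonal coefficient, a multiple of `sin (Tθ)`, tends to zero. -/
theorem limCoeff_eq_zero_of_period {c h : ℕ → ℝ} {L : ℝ} {T N : ℕ}
    (hh : NormSol c h) (hlim : Tendsto c atTop (𝓝 L)) (hL : 1 < L)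
    (hne : ∀ n, ¬ (h n = 0 ∧ h (n + 1) = 0))
    (hper : ∀ n, N ≤ n → SignType.sign (h (n + T)) = SignType.sign (h n)) :
    (limCoeff 2 (-L) T).1 = 0 := by
  by_contra ha
  have hs : Solves (fun _ => 2) (fun n => -c n) h := by
    intro n; rw [hh n]; ring
  have hA := fun k => (tendsto_step (P := fun _ => (2 : ℝ)) tendsto_const_nhds hlim.neg k).1
  have hB := fun k => (tendsto_step (P := fun _ => (2 : ℝ)) tendsto_const_nhds hlim.neg k).2
  obtain ⟨M, hM⟩ := eventually_atTop.1 ((hA T).eventually_ne ha)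
  obtain ⟨n0, hn0, hhn⟩ : ∃ n0, max M N ≤ n0 ∧ h n0 ≠ 0 := by
    by_contra hcon
    push Not at hcon
    exact hne _ ⟨hcon _ le_rfl, hcon (max M N + 1) (by omega)⟩
  have hj := hs.jump_solves (k := T) (N := n0) (fun n hn => hM n (by omega))
  have hT : 0 < T := by
    rcases Nat.eq_zero_or_pos T with h0 | h0
    · subst h0; exact absurd rfl ha
    · exact h0
  have hsgn : ∀ m, SignType.sign (h (n0 + T * m)) = SignType.sign (h n0) := by
    intro m
    induction m with
    | zero => simp
    | succ m ih =>
      rw [show n0 + T * (m + 1) = n0 + T * m + T by ring, hper _ (by omega), ih]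
  have hr : ∀ m, 0 < h (n0 + T * (m + 1)) / h (n0 + T * m) := by
    intro m
    rcases lt_or_gt_of_ne hhn with hlt | hgt
    · have a := hsgn m
      have b := hsgn (m + 1)
      rw [sign_neg hlt, sign_eq_neg_one_iff] at a b
      exact div_pos_of_neg_of_neg b a
    · have a := hsgn m
      have b := hsgn (m + 1)
      rw [sign_pos hgt, sign_eq_one_iff] at a b
      exact div_pos b a
  have hsub : Tendsto (fun m => n0 + T * m) atTop atTop :=
    tendsto_atTop_mono
      (fun m => (Nat.le_mul_of_pos_left m hT).trans (Nat.le_add_left _ _)) tendsto_id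
  have hP := ((hA (2 * T)).div (hA T) ha).comp hsub
  have hQ := ((((hB (2 * T)).mul (hA T)).sub ((hA (2 * T)).mul (hB T))).div (hA T) ha).comp hsub
  refine no_positive_of_elliptic (r := fun m => h (n0 + T * (m + 1)) / h (n0 + T * m))
    hP hQ ?_ hr ?_
  · obtain ⟨e1, e2⟩ := limCoeff_add (2 : ℝ) (-L) T T
    rw [two_mul, e1, e2]
    have e3 : (limCoeff (2 : ℝ) (-L) (T + 1)).1 =
        (limCoeff (2 : ℝ) (-L) T).1 * 2 + (limCoeff (2 : ℝ) (-L) T).2 := rfl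
    have e4 : (limCoeff (2 : ℝ) (-L) (T + 1)).2 = (limCoeff (2 : ℝ) (-L) T).1 * -L := rfl
    rw [e3, e4]
    set a := (limCoeff (2 : ℝ) (-L) T).1
    set b := (limCoeff (2 : ℝ) (-L) T).2
    -- The discriminant of the `T`-step relation is `a²` times the discriminant `4 - 4L` of the
    -- one-step relation.
    have : ((a * (a * 2 + b) + b * a) / a) ^ 2 +
        4 * (((a * (a * -L) + b * b) * a - (a * (a * 2 + b) + b * a) * b) / a) =
        -(4 * (L - 1) * a ^ 2) := by
      field_simp; ring
    rw [this]
    have : 0 < a ^ 2 := by positivity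
    nlinarith
  · intro m
    have h0 : h (n0 + T * m) ≠ 0 := by intro h0; have := hr m; simp [h0] at this
    have h1 : h (n0 + T * (m + 1)) ≠ 0 := by intro h0; have := hr m; simp [h0] at this
    have h2 := hj m
    simp only at h2
    rw [show m + 1 + 1 = m + 2 by ring, h2]
    simp only [Function.comp, Pi.div_apply]
    unfold jumpP jumpQ
    field_simp

/-! ### Rational limits -/

/-- The integral monic polynomials `S` with `S (2 cos θ) = sin (n θ) / sin θ`. -/
noncomputable def sinPoly : ℕ → ℤ[X]
  | 0 => 0
  | 1 => 1
  | n + 2 => X * sinPoly (n + 1) - sinPoly n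

theorem sinPoly_monic (n : ℕ) : (sinPoly (n + 1)).Monic ∧ (sinPoly (n + 1)).natDegree = n ∧
    (sinPoly n).degree < (n : WithBot ℕ) + 1 := by
  induction n with
  | zero => simp [sinPoly]
  | succ n ih =>
    obtain ⟨h1, h2, h3⟩ := ih
    have hm : (X * sinPoly (n + 1)).Monic := monic_X.mul h1
    have hd : (X * sinPoly (n + 1)).natDegree = n + 1 := by
      rw [monic_X.natDegree_mul h1, h2, natDegree_X]; ring
    have hlt : (sinPoly n).degree < (X * sinPoly (n + 1)).degree := by
      rw [degree_eq_natDegree hm.ne_zero, hd]; exact_mod_cast h3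
    refine ⟨?_, ?_, ?_⟩
    · exact hm.sub_of_left hlt
    · rw [sinPoly, natDegree_eq_of_degree_eq (degree_sub_eq_left_of_degree_lt hlt), hd]
    · rw [degree_eq_natDegree h1.ne_zero, h2]; exact_mod_cast (by omega : n < n + 1 + 1)

/-- For `L > 1` this is `L^{(2j-1)/2} sin (2jθ) / sin θ` with `cos² θ = 1 / L`, rewritten through `2
cos 2θ = 4 / L - 2`. Even steps are used because only they give an expression rational in `L`. -/
theorem limCoeff_even (L : ℚ) (hL : L ≠ 0) (j : ℕ) :
    (limCoeff 2 (-L) (2 * j)).1 = 2 * L ^ j / L * aeval (4 / L - 2) (sinPoly j) := by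
  induction j using Nat.twoStepInduction with
  | zero => simp [limCoeff, sinPoly]
  | one => simp [limCoeff, sinPoly]; field_simp
  | more j h1 h2 =>
    have e : (limCoeff 2 (-L) (2 * (j + 2))).1 =
        (4 - 2 * L) * (limCoeff 2 (-L) (2 * (j + 1))).1 - L ^ 2 * (limCoeff 2 (-L) (2 * j)).1 := by
      rw [show 2 * (j + 2) = 2 * j + 1 + 1 + 1 + 1 by ring,
        show 2 * (j + 1) = 2 * j + 1 + 1 by ring]
      simp only [limCoeff]; ring
    rw [e, h1, h2, sinPoly]
    simp only [map_sub, map_mul, aeval_X]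
    field_simp; ring

/-- Niven's argument: `4 / L - 2` is a rational root of a monic integral polynomial, hence an
integer, and `L > 1` places it in `(-2, 2)`. The values `-1, 0, 1` correspond to `θ = π/3, π/4,
π/6`. -/
theorem special_of_limCoeff_eq_zero {L : ℚ} (hL : 1 < L) {T : ℕ} (hT : 0 < T)
    (h : (limCoeff 2 (-L) (2 * T)).1 = 0) : L = 4 ∨ L = 2 ∨ 3 * L = 4 := by
  have hL0 : L ≠ 0 := by positivity
  rw [limCoeff_even L hL0] at h
  obtain ⟨j, rfl⟩ : ∃ j, T = j + 1 := ⟨T - 1, by omega⟩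
  have h1 : aeval (4 / L - 2) (sinPoly (j + 1)) = 0 :=
    (mul_eq_zero.1 h).resolve_left (by positivity)
  have hint : IsIntegral ℤ (4 / L - 2) := ⟨_, (sinPoly_monic j).1, h1⟩
  obtain ⟨z, hz⟩ := IsIntegrallyClosed.isIntegral_iff.1 hint
  have hz' : (z : ℚ) = 4 / L - 2 := hz
  have hL' : (z + 2 : ℚ) * L = 4 := by rw [hz']; field_simp; ring
  have a1 : -2 < z := by
    have : (-2 : ℚ) < z := by rw [hz']; have : 0 < 4 / L := by positivity
                              linarith
    exact_mod_cast this
  have a2 : z < 2 := by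
    have : (z : ℚ) < 2 := by
      rw [hz']
      have : 4 / L < 4 := by rw [div_lt_iff₀ (by positivity)]; linarith
      linarith
    exact_mod_cast this
  have : z = -1 ∨ z = 0 ∨ z = 1 := by omega
  rcases this with rfl | rfl | rfl <;> norm_num at hL'
  · left; linarith
  · right; left; linarith
  · right; right; linarith

theorem limCoeff_cast (p q : ℚ) (k : ℕ) :
    (limCoeff (p : ℝ) (q : ℝ) k).1 = ((limCoeff p q k).1 : ℚ) ∧
    (limCoeff (p : ℝ) (q : ℝ) k).2 = ((limCoeff p q k).2 : ℚ) := by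
  induction k with
  | zero => simp [limCoeff]
  | succ k ih => simp [limCoeff, ih.1, ih.2]

end HolonomicSign

namespace HolonomicSign

open Filter Topology Polynomial

variable {P Q y : ℕ → ℝ}

/-! ### Solutions without repeating sign pattern -/

theorem gauge_mul_pos (hP : ∀ n, 0 < P n * P (n + 1)) (n : ℕ) (m : ℕ) :
    0 < gauge P n * gauge P (n + 2 * m) := by
  have hP0 : ∀ n, P n ≠ 0 := by intro n h0; have := hP n; simp [h0] at this
  induction m with
  | zero =>
    have := gauge_ne_zero hP0 n
    rw [mul_zero, add_zero, ← pow_two]; positivity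
  | succ m ih =>
    rw [show n + 2 * (m + 1) = n + 2 * m + 1 + 1 by ring]
    simp only [gauge]
    have := mul_pos ih (hP (n + 2 * m))
    nlinarith

/-- The sign of the gauge factor may alternate, so a period `T` of the signs of `y` only yields the
period `2 * T` after normalization. -/
theorem sign_normSeq_period (hP : ∀ n, 0 < P n * P (n + 1)) {T N : ℕ}
    (hper : ∀ n, N ≤ n → SignType.sign (y (n + T)) = SignType.sign (y n)) (n : ℕ) (hn : N ≤ n) :
    SignType.sign (normSeq P y (n + 2 * T)) = SignType.sign (normSeq P y n) := by
  unfold normSeq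
  have h1 := gauge_mul_pos hP n T
  have hs : SignType.sign (gauge P (n + 2 * T)) = SignType.sign (gauge P n) := by
    rcases pos_and_pos_or_neg_and_neg_of_mul_pos h1 with h | h
    · rw [sign_pos h.1, sign_pos h.2]
    · rw [sign_neg h.1, sign_neg h.2]
  have hinv : ∀ z : ℝ, SignType.sign z⁻¹ = SignType.sign z := by
    intro z
    rcases lt_trichotomy z 0 with h | h | h
    · rw [sign_neg h, sign_neg (inv_lt_zero.2 h)]
    · simp [h]
    · rw [sign_pos h, sign_pos (inv_pos.2 h)]
  rw [div_eq_mul_inv, div_eq_mul_inv, sign_mul, sign_mul, hinv, hinv, hs,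
    show n + 2 * T + 1 = n + 1 + T + T by ring, hper _ (by omega), hper _ (by omega)]

theorem normSeq_nontrivial_at (hy : Solves P Q y) (hP : ∀ n, P n ≠ 0) (hQ : ∀ n, Q n ≠ 0)
    (hne : ¬ (y 0 = 0 ∧ y 1 = 0)) (n : ℕ) : ¬ (normSeq P y n = 0 ∧ normSeq P y (n + 1) = 0) := by
  rintro ⟨h0, h1⟩
  refine normSeq_nontrivial hy hP hQ hne ((hy.normSol hP).eq_zero (fun n => ?_) h0 h1)
  unfold normCoeff
  have := hP n; have := hP (n + 1); have := hQ (n + 1)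
  simp [*]

theorem no_period_of_slow_oscillation (hP : ∀ n, 0 < P n * P (n + 1)) (hQ : ∀ n, Q n ≠ 0)
    (hy : Solves P Q y) (hne : ¬ (y 0 = 0 ∧ y 1 = 0)) {x γ : ℝ} (hx : 0 < x) (hγ : 1 / 4 < γ)
    (hlim : Tendsto (normCoeff P Q) atTop (𝓝 1))
    (hc : ∀ n : ℕ, 1 + γ / (n + x) ^ 2 ≤ normCoeff P Q n) {T N : ℕ} (hT : 0 < T)
    (hper : ∀ n, N ≤ n → SignType.sign (y (n + T)) = SignType.sign (y n)) : False := by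
  have hP0 : ∀ n, P n ≠ 0 := by intro n h0; have := hP n; simp [h0] at this
  exact no_period_of_oscillation (T := 2 * T) hx hγ (hy.normSol hP0) hlim hc
    (normSeq_nontrivial_at hy hP0 hQ hne) (by omega) (sign_normSeq_period hP hper)

theorem no_period_of_elliptic (hP : ∀ n, 0 < P n * P (n + 1)) (hQ : ∀ n, Q n ≠ 0)
    (hy : Solves P Q y) (hne : ¬ (y 0 = 0 ∧ y 1 = 0)) {L : ℚ} (hL : 1 < L)
    (hL1 : L ≠ 4) (hL2 : L ≠ 2) (hL3 : 3 * L ≠ 4)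
    (hlim : Tendsto (normCoeff P Q) atTop (𝓝 L)) {T N : ℕ} (hT : 0 < T)
    (hper : ∀ n, N ≤ n → SignType.sign (y (n + T)) = SignType.sign (y n)) : False := by
  have hP0 : ∀ n, P n ≠ 0 := by intro n h0; have := hP n; simp [h0] at this
  have h1 := limCoeff_eq_zero_of_period (T := 2 * T) (hy.normSol hP0) hlim (by exact_mod_cast hL)
    (normSeq_nontrivial_at hy hP0 hQ hne) (sign_normSeq_period hP hper)
  have h2 := (limCoeff_cast 2 (-L) (2 * T)).1
  push_cast at h2
  rw [h2] at h1
  rcases special_of_limCoeff_eq_zero hL hT (by exact_mod_cast h1) with h | h | h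
  · exact hL1 h
  · exact hL2 h
  · exact hL3 h

/-! ### Sequences of values of rational functions -/

/-- `g` is eventually the sequence of values of a rational function over `ℚ`. -/
def IsRatSeq (g : ℕ → ℝ) : Prop :=
  ∃ p q : ℚ[X], q ≠ 0 ∧ ∀ᶠ n : ℕ in atTop, g n = aeval (n : ℝ) p / aeval (n : ℝ) q

theorem eventually_aeval_ne_zero {q : ℚ[X]} (hq : q ≠ 0) :
    ∀ᶠ n : ℕ in atTop, aeval (n : ℝ) q ≠ 0 := by
  have h1 : q.map (algebraMap ℚ ℝ) ≠ 0 := Polynomial.map_ne_zero hq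
  have := tendsto_natCast_atTop_atTop (R := ℝ) |>.eventually
    (Polynomial.eventually_atTop_not_isRoot _ h1)
  filter_upwards [this] with n hn h0
  apply hn
  rw [IsRoot, eval_map_algebraMap, h0]

namespace IsRatSeq

variable {g h : ℕ → ℝ}

theorem congr (hg : IsRatSeq g) (e : ∀ᶠ n in atTop, h n = g n) : IsRatSeq h := by
  obtain ⟨p, q, hq, hpq⟩ := hg
  exact ⟨p, q, hq, by filter_upwards [e, hpq] with n a b; rw [a, b]⟩

theorem const (a : ℚ) : IsRatSeq (fun _ => (a : ℝ)) :=
  ⟨C a, 1, one_ne_zero, Eventually.of_forall fun n => by simp⟩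

theorem natCast : IsRatSeq (fun n => (n : ℝ)) :=
  ⟨X, 1, one_ne_zero, Eventually.of_forall fun n => by simp⟩

theorem add (hg : IsRatSeq g) (hh : IsRatSeq h) : IsRatSeq (fun n => g n + h n) := by
  obtain ⟨p, q, hq, hpq⟩ := hg
  obtain ⟨p', q', hq', hpq'⟩ := hh
  refine ⟨p * q' + p' * q, q * q', mul_ne_zero hq hq', ?_⟩
  filter_upwards [hpq, hpq', eventually_aeval_ne_zero hq, eventually_aeval_ne_zero hq']
    with n a b c d
  simp only [a, b, map_add, map_mul]; field_simp

theorem mul (hg : IsRatSeq g) (hh : IsRatSeq h) : IsRatSeq (fun n => g n * h n) := by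
  obtain ⟨p, q, hq, hpq⟩ := hg
  obtain ⟨p', q', hq', hpq'⟩ := hh
  refine ⟨p * p', q * q', mul_ne_zero hq hq', ?_⟩
  filter_upwards [hpq, hpq'] with n a b
  simp only [a, b, map_mul]; rw [div_mul_div_comm]

theorem inv (hg : IsRatSeq g) : IsRatSeq (fun n => (g n)⁻¹) := by
  obtain ⟨p, q, hq, hpq⟩ := hg
  by_cases hp : p = 0
  · refine (const 0).congr ?_
    filter_upwards [hpq] with n a
    simp [a, hp]
  · exact ⟨q, p, hp, by filter_upwards [hpq] with n a; rw [a, inv_div]⟩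

theorem div (hg : IsRatSeq g) (hh : IsRatSeq h) : IsRatSeq (fun n => g n / h n) := by
  simpa only [div_eq_mul_inv] using hg.mul hh.inv

theorem neg (hg : IsRatSeq g) : IsRatSeq (fun n => -g n) := by
  simpa using (const (-1)).mul hg

theorem sub (hg : IsRatSeq g) (hh : IsRatSeq h) : IsRatSeq (fun n => g n - h n) := by
  simpa only [sub_eq_add_neg] using hg.add hh.neg

theorem shift (hg : IsRatSeq g) (k : ℕ) : IsRatSeq (fun n => g (n + k)) := by
  obtain ⟨p, q, hq, hpq⟩ := hg
  refine ⟨p.comp (X + C (k : ℚ)), q.comp (X + C (k : ℚ)), ?_, ?_⟩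
  · intro h0
    rw [comp_eq_zero_iff] at h0
    rcases h0 with h0 | ⟨_, h0⟩
    · exact hq h0
    · have := congrArg (fun r => coeff r 1) h0
      simp at this
  · filter_upwards [(tendsto_add_atTop_nat k).eventually hpq] with n a
    rw [a]
    simp [aeval_comp]

theorem trichotomy (hg : IsRatSeq g) :
    (∃ L : ℚ, Tendsto g atTop (𝓝 L)) ∨ Tendsto g atTop atTop ∨ Tendsto g atTop atBot := by
  obtain ⟨p, q, hq, hpq⟩ := hg
  set p' := p.map (algebraMap ℚ ℝ) with hp'
  set q' := q.map (algebraMap ℚ ℝ) with hq'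
  have hq0 : q' ≠ 0 := Polynomial.map_ne_zero hq
  have e : ∀ᶠ n : ℕ in atTop, p'.eval (n : ℝ) / q'.eval (n : ℝ) = g n := by
    filter_upwards [hpq] with n a
    rw [a, hp', hq', eval_map_algebraMap, eval_map_algebraMap]
  have hcast := tendsto_natCast_atTop_atTop (R := ℝ)
  rcases lt_trichotomy p'.degree q'.degree with h | h | h
  · left
    refine ⟨0, ?_⟩
    have := (div_tendsto_atTop_zero_of_degree_lt p' q' h).comp hcast
    simpa using this.congr' e
  · left
    refine ⟨p.leadingCoeff / q.leadingCoeff, ?_⟩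
    have := (div_tendsto_atTop_leadingCoeff_div_of_degree_eq p' q' h).comp hcast
    rw [hp', hq', leadingCoeff_map, leadingCoeff_map] at this
    have := this.congr' e
    simpa using this
  · right
    rcases le_total 0 (p'.leadingCoeff / q'.leadingCoeff) with h1 | h1
    · left
      exact ((div_tendsto_atTop_of_degree_gt p' q' h hq0 h1).comp hcast).congr' e
    · right
      exact ((div_tendsto_atBot_of_degree_gt p' q' h hq0 h1).comp hcast).congr' e

theorem eventually_sign (hg : IsRatSeq g) :
    (∀ᶠ n in atTop, g n = 0) ∨ (∀ᶠ n in atTop, 0 < g n) ∨ (∀ᶠ n in atTop, g n < 0) := by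
  by_cases hz : ∀ᶠ n in atTop, g n = 0
  · exact Or.inl hz
  have hne : ∀ᶠ n in atTop, g n ≠ 0 := by
    obtain ⟨p, q, hq, hpq⟩ := hg
    have hp : p ≠ 0 := by
      rintro rfl
      exact hz (by filter_upwards [hpq] with n a; simp [a])
    filter_upwards [hpq, eventually_aeval_ne_zero hq, eventually_aeval_ne_zero hp] with n a b c
    rw [a]; exact div_ne_zero c b
  right
  rcases hg.trichotomy with ⟨L, hL⟩ | h | h
  · rcases lt_trichotomy L 0 with h0 | h0 | h0
    · right; exact hL.eventually_lt_const (by exact_mod_cast h0)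
    · subst h0
      -- A limit `0` hides the sign, but the inverse is again rational. It cannot converge, as the
      -- product with `g` is `1`, and the infinity to which it tends carries the sign of `g`.
      rcases hg.inv.trichotomy with ⟨L', hL'⟩ | h | h
      · exfalso
        have := hL.mul hL'
        have h1 : Tendsto (fun n => g n * (g n)⁻¹) atTop (𝓝 1) := by
          refine tendsto_const_nhds.congr' ?_
          filter_upwards [hne] with n a
          rw [mul_inv_cancel₀ a]
        have := tendsto_nhds_unique this h1
        norm_num at this
      · left; filter_upwards [h.eventually_gt_atTop 0] with n a
        exact inv_pos.1 a
      · right; filter_upwards [h.eventually_lt_atBot 0] with n a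
        exact inv_lt_zero.1 a
    · left; exact hL.eventually_const_lt (by exact_mod_cast h0)
  · left; exact h.eventually_gt_atTop 0
  · right; exact h.eventually_lt_atBot 0

theorem eventually_eq_zero_or_ne_zero (hg : IsRatSeq g) :
    (∀ᶠ n in atTop, g n = 0) ∨ (∀ᶠ n in atTop, g n ≠ 0) := by
  rcases hg.eventually_sign with h | h | h
  · exact Or.inl h
  · right; filter_upwards [h] with n a using a.ne'
  · right; filter_upwards [h] with n a using a.ne

/-- A convergent sequence of values of a rational function converges at the rate `1 / n`. -/
theorem rate (hg : IsRatSeq g) {L : ℚ} (hL : Tendsto g atTop (𝓝 L)) :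
    ∃ M : ℕ, ∀ᶠ n : ℕ in atTop, |g n - L| * n ≤ M := by
  obtain ⟨p, q, hq, hpq⟩ := hg.sub (const L)
  set p' := p.map (algebraMap ℚ ℝ) with hp'
  set q' := q.map (algebraMap ℚ ℝ) with hq'
  have hq0 : q' ≠ 0 := Polynomial.map_ne_zero hq
  have e : ∀ n : ℕ, aeval (n : ℝ) p / aeval (n : ℝ) q = p'.eval (n : ℝ) / q'.eval (n : ℝ) := by
    intro n; rw [hp', hq', eval_map_algebraMap, eval_map_algebraMap]
  have hcast := tendsto_natCast_atTop_atTop (R := ℝ)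
  have h0 : Tendsto (fun n : ℕ => p'.eval (n : ℝ) / q'.eval (n : ℝ)) atTop (𝓝 0) := by
    have := hL.sub_const (L : ℝ)
    rw [sub_self] at this
    refine this.congr' ?_
    filter_upwards [hpq] with n a
    rw [← e, a]
  -- A rational function tending to `0` has numerator degree below denominator degree. The gap of at
  -- least one is the rate `1 / n`.
  have hdeg : p'.degree < q'.degree := by
    rcases lt_trichotomy p'.degree q'.degree with h | h | h
    · exact h
    · have := (div_tendsto_atTop_leadingCoeff_div_of_degree_eq p' q' h).comp hcast
      have := tendsto_nhds_unique this h0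
      have hp0 : p' ≠ 0 := by rintro h0; rw [h0, degree_zero] at h; exact hq0 (degree_eq_bot.1 h.symm)
      exact absurd this (div_ne_zero (leadingCoeff_ne_zero.2 hp0) (leadingCoeff_ne_zero.2 hq0))
    · have := (abs_div_tendsto_atTop_atTop_of_degree_gt p' q' h hq0).comp hcast
      exact absurd h0.abs (not_tendsto_nhds_of_tendsto_atTop this _)
  have hdeg' : (p' * X).degree ≤ q'.degree := by
    rw [degree_mul, degree_X]; exact Nat.WithBot.add_one_le_of_lt hdeg
  obtain ⟨K, hK⟩ := (isBigO_atTop_of_degree_le _ _ hdeg').bound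
  obtain ⟨M, hM⟩ := exists_nat_ge K
  refine ⟨M, ?_⟩
  filter_upwards [hpq, hcast.eventually hK, eventually_aeval_ne_zero hq] with n a b c
  rw [a, e]
  have c' : 0 < |q'.eval (n : ℝ)| := by
    rw [abs_pos, hq', eval_map_algebraMap]; exact c
  rw [eval_mul, eval_X, norm_mul, Real.norm_eq_abs, Real.norm_eq_abs, Real.norm_eq_abs,
    abs_of_nonneg (Nat.cast_nonneg n : (0 : ℝ) ≤ n)] at b
  rw [abs_div, div_mul_eq_mul_div, div_le_iff₀ c']
  exact b.trans (mul_le_mul_of_nonneg_right hM c'.le)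

/-- A translate of a polynomial has the same degree and leading coefficient. This controls quotients
`g (n + k) / g n` even when `g` itself tends to zero or to infinity. -/
theorem tendsto_shift_div (hg : IsRatSeq g) (hne : ∀ᶠ n in atTop, g n ≠ 0) (k : ℕ) :
    Tendsto (fun n => g (n + k) / g n) atTop (𝓝 1) := by
  have poly : ∀ p : ℚ[X], p ≠ 0 →
      Tendsto (fun n : ℕ => aeval ((n + k : ℕ) : ℝ) p / aeval (n : ℝ) p) atTop (𝓝 1) := by
    intro p hp
    set p' := p.map (algebraMap ℚ ℝ) with hp'
    have hp0 : p' ≠ 0 := Polynomial.map_ne_zero hp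
    have hdeg : (p'.comp (X + C (k : ℝ))).degree = p'.degree := by
      rw [← taylor_apply, degree_taylor]
    have := (div_tendsto_atTop_leadingCoeff_div_of_degree_eq _ p' hdeg).comp
      (tendsto_natCast_atTop_atTop (R := ℝ))
    rw [← taylor_apply, leadingCoeff_taylor, div_self (leadingCoeff_ne_zero.2 hp0)] at this
    refine this.congr fun n => ?_
    simp only [Function.comp, taylor_eval, hp', eval_map_algebraMap]
    push_cast
    rw [add_comm]
  obtain ⟨p, q, hq, hpq⟩ := hg
  have hp : p ≠ 0 := by
    rintro rfl
    obtain ⟨n, a, b⟩ := (hpq.and hne).exists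
    simp at a; exact b a
  have := (poly p hp).div (poly q hq) one_ne_zero
  rw [div_one] at this
  refine this.congr' ?_
  filter_upwards [hpq, (tendsto_add_atTop_nat k).eventually hpq] with n a b
  rw [a, b]
  simp only [Pi.div_apply]
  rw [div_div_div_comm]

end IsRatSeq

end HolonomicSign

namespace HolonomicSign

open Filter Topology Polynomial

variable {P Q c : ℕ → ℝ}

/-! ### The normalized coefficient of the recurrence between terms at distance `k` -/

/-- The normalized coefficient of the recurrence between terms at distance `k`. -/
noncomputable def jumpCoeff (P Q : ℕ → ℝ) (k n : ℕ) : ℝ :=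
  -(4 * jumpQ P Q k (n + k)) / (jumpP P Q k (n + k) * jumpP P Q k n)

theorem stepCoeff_shift (N k : ℕ) : ∀ n,
    stepA (fun i => P (i + N)) (fun i => Q (i + N)) k n = stepA P Q k (n + N) ∧
    stepB (fun i => P (i + N)) (fun i => Q (i + N)) k n = stepB P Q k (n + N) := by
  induction k with
  | zero => intro n; simp
  | succ k ih =>
    intro n
    simp only [stepA_succ, stepB_succ, (ih (n + 1)).1, (ih (n + 1)).2,
      show n + 1 + N = n + N + 1 by ring, and_self]

theorem jumpCoeff_shift (N k n : ℕ) :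
    jumpCoeff (fun i => P (i + N)) (fun i => Q (i + N)) k n = jumpCoeff P Q k (n + N) := by
  unfold jumpCoeff jumpP jumpQ
  simp only [(stepCoeff_shift N _ _).1, (stepCoeff_shift N _ _).2,
    show n + k + N = n + N + k by ring]

theorem step_gauge (hP : ∀ n, P n ≠ 0) (k : ℕ) : ∀ n,
    stepA P Q k (n + 1) * gauge P (n + 1) =
      gauge P (n + k) * stepA (fun _ => 2) (fun n => -normCoeff P Q n) k n ∧
    stepB P Q k (n + 1) * gauge P n =
      gauge P (n + k) * stepB (fun _ => 2) (fun n => -normCoeff P Q n) k n := by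
  induction k with
  | zero => intro n; simp
  | succ k ih =>
    intro n
    obtain ⟨h1, h2⟩ := ih (n + 1)
    rw [show n + 1 + k = n + (k + 1) by ring] at h1 h2
    have e1 : gauge P (n + 1 + 1) = gauge P (n + 1) * (P (n + 1) / 2) := rfl
    have e0 : gauge P (n + 1) = gauge P n * (P n / 2) := rfl
    constructor
    · rw [stepA_succ, stepA_succ, mul_add, ← h2, ← mul_assoc, ← h1, e1]; ring
    · rw [stepB_succ, stepB_succ, ← mul_assoc, ← h1, e1, e0]
      unfold normCoeff
      have := hP n
      have := hP (n + 1)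
      field_simp
      ring

/-- The normalized coefficient is invariant under rescaling of solutions, so the limit analysis may
assume that the first coefficient is `2`. The index shift comes from `normSeq` starting at index
`1`. -/
theorem jumpCoeff_gauge (hP : ∀ n, P n ≠ 0) (k n : ℕ) :
    jumpCoeff P Q k (n + 1) = jumpCoeff (fun _ => 2) (fun n => -normCoeff P Q n) k n := by
  have hg := gauge_ne_zero hP
  have eA : ∀ j m, stepA P Q j (m + 1) = gauge P (m + j) / gauge P (m + 1) *
      stepA (fun _ => 2) (fun n => -normCoeff P Q n) j m := by
    intro j m
    rw [div_mul_eq_mul_div, eq_div_iff (hg _)]; exact (step_gauge hP j m).1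
  have eB : ∀ j m, stepB P Q j (m + 1) = gauge P (m + j) / gauge P m *
      stepB (fun _ => 2) (fun n => -normCoeff P Q n) j m := by
    intro j m
    rw [div_mul_eq_mul_div, eq_div_iff (hg _)]; exact (step_gauge hP j m).2
  have eP : ∀ m, jumpP P Q k (m + 1) = gauge P (m + 2 * k) / gauge P (m + k) *
      jumpP (fun _ => 2) (fun n => -normCoeff P Q n) k m := by
    intro m
    unfold jumpP
    rw [eA, eA, mul_div_mul_comm, div_div_div_cancel_right₀ (hg _)]
  have eQ : ∀ m, jumpQ P Q k (m + 1) = gauge P (m + 2 * k) / gauge P m *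
      jumpQ (fun _ => 2) (fun n => -normCoeff P Q n) k m := by
    intro m
    unfold jumpQ
    rw [eA, eA, eB, eB]
    have h0 := hg m; have h1 := hg (m + 1); have h2 := hg (m + k); have h3 := hg (m + 2 * k)
    by_cases hz : stepA (fun _ => (2 : ℝ)) (fun n => -normCoeff P Q n) k m = 0
    · simp [hz]
    · field_simp
  unfold jumpCoeff
  rw [show n + 1 + k = n + k + 1 by ring, eP, eP, eQ, show n + k + k = n + 2 * k by ring]
  have h2 := hg (n + k); have h3 := hg (n + 2 * k); have h4 := hg (n + k + 2 * k)
  rw [show -(4 * (gauge P (n + k + 2 * k) / gauge P (n + k) *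
      jumpQ (fun _ => 2) (fun n => -normCoeff P Q n) k (n + k))) =
      gauge P (n + k + 2 * k) / gauge P (n + k) *
      -(4 * jumpQ (fun _ => 2) (fun n => -normCoeff P Q n) k (n + k)) by ring,
    show gauge P (n + k + 2 * k) / gauge P (n + 2 * k) *
      jumpP (fun _ => 2) (fun n => -normCoeff P Q n) k (n + k) *
      (gauge P (n + 2 * k) / gauge P (n + k) *
      jumpP (fun _ => 2) (fun n => -normCoeff P Q n) k n) =
      gauge P (n + k + 2 * k) / gauge P (n + k) *
      (jumpP (fun _ => 2) (fun n => -normCoeff P Q n) k (n + k) *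
      jumpP (fun _ => 2) (fun n => -normCoeff P Q n) k n) by field_simp]
  exact mul_div_mul_left _ _ (div_ne_zero h4 h2)

theorem IsRatSeq.step (hP : IsRatSeq P) (hQ : IsRatSeq Q) (k : ℕ) :
    IsRatSeq (stepA P Q k) ∧ IsRatSeq (stepB P Q k) := by
  induction k with
  | zero => exact ⟨(IsRatSeq.const 0).congr (by simp), (IsRatSeq.const 1).congr (by simp)⟩
  | succ k ih => exact ⟨((ih.1.shift 1).mul hP).add (ih.2.shift 1), (ih.1.shift 1).mul hQ⟩

theorem IsRatSeq.jumpP (hP : IsRatSeq P) (hQ : IsRatSeq Q) (k : ℕ) :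
    IsRatSeq (HolonomicSign.jumpP P Q k) := (hP.step hQ _).1.div (hP.step hQ _).1

theorem IsRatSeq.jumpQ (hP : IsRatSeq P) (hQ : IsRatSeq Q) (k : ℕ) :
    IsRatSeq (HolonomicSign.jumpQ P Q k) :=
  (((hP.step hQ _).2.mul (hP.step hQ _).1).sub ((hP.step hQ _).1.mul (hP.step hQ _).2)).div
    (hP.step hQ _).1

theorem IsRatSeq.jumpCoeff (hP : IsRatSeq P) (hQ : IsRatSeq Q) (k : ℕ) :
    IsRatSeq (HolonomicSign.jumpCoeff P Q k) :=
  ((IsRatSeq.const 4).mul ((hP.jumpQ hQ k).shift k)).neg.div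
    (((hP.jumpP hQ k).shift k).mul (hP.jumpP hQ k)) |>.congr
    (Eventually.of_forall fun n => by simp [HolonomicSign.jumpCoeff])

/-- The possible limit behaviours of the recurrence between terms at distance `k`. -/
def JumpBehaviour (P Q : ℕ → ℝ) (k : ℕ) : Prop :=
  (∀ᶠ n in atTop, stepA P Q k n = 0) ∨ (∀ᶠ n in atTop, stepA P Q k n ≠ 0) ∧
    (Tendsto (jumpCoeff P Q k) atTop (𝓝 1) ∨
      (∀ᶠ n in atTop, 0 < jumpCoeff P Q k n) ∧ (∀ᶠ n in atTop, jumpCoeff P Q k n ≤ 1) ∨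
      ∃ L : ℚ, 1 < L ∧ L ≠ 4 ∧ L ≠ 2 ∧ 3 * L ≠ 4 ∧ Tendsto (jumpCoeff P Q k) atTop (𝓝 L))

theorem JumpBehaviour.of_shift {P' Q' : ℕ → ℝ} {k N : ℕ}
    (h1 : ∀ n, stepA P Q k (n + N) = 0 ↔ stepA P' Q' k n = 0)
    (h2 : ∀ n, jumpCoeff P Q k (n + N) = jumpCoeff P' Q' k n) (h : JumpBehaviour P' Q' k) :
    JumpBehaviour P Q k := by
  have ev : ∀ p : ℕ → Prop, (∀ᶠ n in atTop, p n) ↔ ∀ᶠ n in atTop, p (n + N) := by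
    intro p
    refine ⟨fun h => (tendsto_add_atTop_nat N).eventually h, fun h => ?_⟩
    obtain ⟨M, hM⟩ := eventually_atTop.1 h
    refine eventually_atTop.2 ⟨M + N, fun n hn => ?_⟩
    have := hM (n - N) (by omega)
    rwa [Nat.sub_add_cancel (by omega)] at this
  unfold JumpBehaviour at *
  rw [ev (fun n => stepA P Q k n = 0), ev (fun n => stepA P Q k n ≠ 0),
    ev (fun n => 0 < jumpCoeff P Q k n), ev (fun n => jumpCoeff P Q k n ≤ 1)]
  simp only [h2, h1, ne_eq, ← tendsto_add_atTop_iff_nat (f := jumpCoeff P Q k) N]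
  exact h

theorem jumpCoeff_one (n : ℕ) : jumpCoeff (fun _ => 2) (fun n => -c n) 1 n = c (n + 1) := by
  simp [jumpCoeff, jumpP, jumpQ, stepA_succ, stepB_succ]
  ring

theorem jumpCoeff_two (n : ℕ) : jumpCoeff (fun _ => 2) (fun n => -c n) 2 n =
    4 * (c (n + 2) * c (n + 3)) /
      ((4 - c (n + 3) - c (n + 4)) * (4 - c (n + 1) - c (n + 2))) := by
  have e1 : ∀ n, jumpP (fun _ => 2) (fun n => -c n) 2 n = 4 - c (n + 1) - c (n + 2) := by
    intro n
    simp [jumpP, stepA_succ, stepB_succ]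
    ring
  have e2 : ∀ n, jumpQ (fun _ => 2) (fun n => -c n) 2 n = -(c n * c (n + 1)) := by
    intro n
    simp [jumpQ, stepA_succ, stepB_succ]
    ring
  unfold jumpCoeff
  rw [e1, e1, e2, show n + 2 + 1 = n + 3 by ring, show n + 2 + 2 = n + 4 by ring]
  ring

/-- For the special angles `stepA` at distance `k` tends to `0`, so `jumpP` and `jumpQ` are `0 / 0`
in the limit. `step_add` isolates the quotient of `stepA` at `n + k` and at `n`, which tends to `1`.
The hypothesis `hq` says that the resulting limit recurrence has a double root. -/
theorem jumpBehaviour_of_tendsto (hc : IsRatSeq c) {L : ℝ} (hL : Tendsto c atTop (𝓝 L)) (k : ℕ)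
    (hV : (limCoeff 2 (-L) (k + 1)).1 + (limCoeff 2 (-L) k).2 ≠ 0)
    (hq : -(4 * ((limCoeff 2 (-L) (k + 1)).2 * (limCoeff 2 (-L) k).1 -
      (limCoeff 2 (-L) (k + 1)).1 * (limCoeff 2 (-L) k).2)) =
      ((limCoeff 2 (-L) (k + 1)).1 + (limCoeff 2 (-L) k).2) ^ 2) :
    JumpBehaviour (fun _ => 2) (fun n => -c n) k := by
  have h2 : IsRatSeq (fun _ => (2 : ℝ)) := by simpa using IsRatSeq.const 2
  have hA := fun k => (tendsto_step (P := fun _ => (2 : ℝ)) tendsto_const_nhds hL.neg k).1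
  have hB := fun k => (tendsto_step (P := fun _ => (2 : ℝ)) tendsto_const_nhds hL.neg k).2
  rcases (h2.step hc.neg k).1.eventually_eq_zero_or_ne_zero with h | h
  · exact Or.inl h
  refine Or.inr ⟨h, Or.inl ?_⟩
  have hw := (h2.step hc.neg k).1.tendsto_shift_div h k
  have hshift : ∀ {g : ℕ → ℝ} {l : ℝ}, Tendsto g atTop (𝓝 l) →
      Tendsto (fun n => g (n + k)) atTop (𝓝 l) := fun h => (tendsto_add_atTop_iff_nat k).2 h
  have tP : Tendsto (jumpP (fun _ => 2) (fun n => -c n) k) atTop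
      (𝓝 (1 * (limCoeff 2 (-L) (k + 1)).1 + (limCoeff 2 (-L) k).2)) := by
    refine ((hw.mul (hA (k + 1))).add (hshift (hB k))).congr' ?_
    filter_upwards [h] with n a
    simp only [jumpP]
    rw [two_mul, (step_add k k n).1]
    field_simp
  have tQ : Tendsto (jumpQ (fun _ => 2) (fun n => -c n) k) atTop
      (𝓝 (1 * ((limCoeff 2 (-L) (k + 1)).2 * (limCoeff 2 (-L) k).1 -
      (limCoeff 2 (-L) (k + 1)).1 * (limCoeff 2 (-L) k).2))) := by
    refine (hw.mul (((hB (k + 1)).mul (hA k)).sub ((hA (k + 1)).mul (hB k)))).congr' ?_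
    filter_upwards [h] with n a
    simp only [jumpQ]
    rw [two_mul, (step_add k k n).1, (step_add k k n).2]
    field_simp
    ring
  rw [one_mul] at tP tQ
  have := ((hshift tQ).const_mul 4).neg.div ((hshift tP).mul tP) (mul_ne_zero hV hV)
  rw [hq, ← pow_two, div_self (pow_ne_zero 2 hV)] at this
  exact this

/-- When `c` is unbounded the middle term is negligible and the roots are nearly opposite. At
distance `2` they nearly coincide, giving the limit `4 / ((-2) * (-2)) = 1`. -/
theorem jumpBehaviour_two_of_unbounded (hc : IsRatSeq c) (h : Tendsto (fun n => |c n|) atTop atTop) :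
    JumpBehaviour (fun _ => 2) (fun n => -c n) 2 := by
  have hne : ∀ᶠ n in atTop, c n ≠ 0 := by
    filter_upwards [h.eventually_gt_atTop 0] with n a
    exact abs_pos.1 a
  have hinv : Tendsto (fun n => 4 / c n) atTop (𝓝 0) := by
    rw [tendsto_zero_iff_abs_tendsto_zero]
    have := h.const_div_atTop 4
    refine this.congr fun n => ?_
    simp [abs_div]
  have hsh := hc.tendsto_shift_div hne 1
  refine Or.inr ⟨Eventually.of_forall fun n => by simp [stepA_succ, stepB_succ], Or.inl ?_⟩
  have sh : ∀ {g : ℕ → ℝ} {l : ℝ} (k : ℕ), Tendsto g atTop (𝓝 l) →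
      Tendsto (fun n => g (n + k)) atTop (𝓝 l) := fun k h => (tendsto_add_atTop_iff_nat k).2 h
  have hd1 := ((sh 3 hinv).sub_const 1).sub (sh 3 hsh)
  have hinv' : Tendsto (fun n => c n / c (n + 1)) atTop (𝓝 1) := by
    have := hsh.inv₀ one_ne_zero
    rw [inv_one] at this
    exact this.congr fun n => by rw [inv_div]
  have hd2 := ((sh 2 hinv).sub (sh 1 hinv')).sub_const 1
  have := (tendsto_const_nhds (x := (4 : ℝ))).div (hd1.mul hd2) (by norm_num)
  norm_num at this
  refine this.congr' ?_
  have shn : ∀ k, ∀ᶠ n in atTop, c (n + k) ≠ 0 := fun k => (tendsto_add_atTop_nat k).eventually hne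
  filter_upwards [shn 2, shn 3] with n a b
  rw [jumpCoeff_two]
  have e1 : 4 / c (n + 3) - 1 - c (n + 3 + 1) / c (n + 3) =
      (4 - c (n + 3) - c (n + 4)) / c (n + 3) := by
    rw [sub_div, sub_div, div_self b]
  have e2 : 4 / c (n + 2) - c (n + 1) / c (n + 1 + 1) - 1 =
      (4 - c (n + 1) - c (n + 2)) / c (n + 2) := by
    rw [sub_div, sub_div, div_self a]
  simp only [Pi.div_apply]
  rw [e1, e2, div_mul_div_comm, div_div_eq_mul_div, mul_comm (c (n + 2))]

/-- A normalized recurrence with rational coefficient has one of the limit behaviours at some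
distance `k ≤ 6`. -/
theorem exists_jumpBehaviour_normalized (hc : IsRatSeq c) (hne : ∀ n, c n ≠ 0) :
    ∃ k, 1 ≤ k ∧ k ≤ 6 ∧ JumpBehaviour (fun _ => 2) (fun n => -c n) k := by
  have one : (Tendsto c atTop (𝓝 1) ∨
      (∀ᶠ n in atTop, 0 < c n) ∧ (∀ᶠ n in atTop, c n ≤ 1) ∨
      ∃ L : ℚ, 1 < L ∧ L ≠ 4 ∧ L ≠ 2 ∧ 3 * L ≠ 4 ∧ Tendsto c atTop (𝓝 L)) →
      JumpBehaviour (fun _ => 2) (fun n => -c n) 1 := by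
    intro h
    refine Or.inr ⟨Eventually.of_forall fun n => by simp [stepA_succ], ?_⟩
    have e : jumpCoeff (fun _ => 2) (fun n => -c n) 1 = fun n => c (n + 1) :=
      funext jumpCoeff_one
    rw [e]
    rcases h with h | ⟨h1, h2⟩ | ⟨L, a1, a2, a3, a4, h⟩
    · exact Or.inl ((tendsto_add_atTop_iff_nat 1).2 h)
    · exact Or.inr (Or.inl ⟨(tendsto_add_atTop_nat 1).eventually h1,
        (tendsto_add_atTop_nat 1).eventually h2⟩)
    · exact Or.inr (Or.inr ⟨L, a1, a2, a3, a4, (tendsto_add_atTop_iff_nat 1).2 h⟩)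
  rcases hc.trichotomy with ⟨L, hL⟩ | h | h
  · rcases lt_trichotomy L 1 with h1 | h1 | h1
    · have hle : ∀ᶠ n in atTop, c n < 1 := hL.eventually_lt_const (by exact_mod_cast h1)
      rcases hc.eventually_sign with h2 | h2 | h2
      · obtain ⟨n, hn⟩ := h2.exists
        exact absurd hn (hne n)
      · exact ⟨1, le_rfl, by norm_num,
          one (Or.inr (Or.inl ⟨h2, by filter_upwards [hle] with n a using a.le⟩))⟩
      -- For eventually negative `c` the distance-two coefficient is positive and tends to `(L / (2
      -- - L))²`, which is below `1` because `L ≤ 0`.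
      · refine ⟨2, by norm_num, by norm_num, Or.inr ⟨Eventually.of_forall fun n => by
          simp [stepA_succ, stepB_succ], Or.inr (Or.inl ?_)⟩⟩
        have hL0 : (L : ℝ) ≤ 0 := le_of_tendsto hL (by filter_upwards [h2] with n a using a.le)
        have sh : ∀ k, ∀ᶠ n in atTop, c (n + k) < 0 :=
          fun k => (tendsto_add_atTop_nat k).eventually h2
        constructor
        · filter_upwards [sh 1, sh 2, sh 3, sh 4] with n a1 a2 a3 a4
          rw [jumpCoeff_two]
          have := mul_pos_of_neg_of_neg a2 a3
          apply div_pos (by linarith) (mul_pos (by linarith) (by linarith))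
        · have s : ∀ k, Tendsto (fun n => c (n + k)) atTop (𝓝 L) :=
            fun k => (tendsto_add_atTop_iff_nat k).2 hL
          have := (((s 2).mul (s 3)).const_mul 4).div
            ((((s 3).const_sub 4).sub (s 4)).mul (((s 1).const_sub 4).sub (s 2)))
            (mul_ne_zero (by linarith) (by linarith))
          have hlt : 4 * ((L : ℝ) * L) / ((4 - L - L) * (4 - L - L)) < 1 := by
            rw [div_lt_one (mul_pos (by linarith) (by linarith))]
            nlinarith
          filter_upwards [this.eventually_lt_const hlt] with n a
          rw [jumpCoeff_two]; exact a.le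
    · subst h1
      exact ⟨1, le_rfl, by norm_num, one (Or.inl (by simpa using hL))⟩
    -- The limits `4`, `2`, `4/3` have `θ = π/3, π/4, π/6`. The distances `3`, `4`, `6` turn the
    -- rotation by `θ` into a rotation by `π`.
    · by_cases h4 : L = 4
      · subst h4
        refine ⟨3, by norm_num, by norm_num, jumpBehaviour_of_tendsto hc hL 3 ?_ ?_⟩ <;>
          norm_num [limCoeff]
      by_cases h2 : L = 2
      · subst h2
        refine ⟨4, by norm_num, by norm_num, jumpBehaviour_of_tendsto hc hL 4 ?_ ?_⟩ <;>
          norm_num [limCoeff]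
      by_cases h3 : 3 * L = 4
      · have : L = 4 / 3 := by linarith
        subst this
        refine ⟨6, by norm_num, by norm_num, jumpBehaviour_of_tendsto hc hL 6 ?_ ?_⟩ <;>
          norm_num [limCoeff]
      exact ⟨1, le_rfl, by norm_num, one (Or.inr (Or.inr ⟨L, h1, h4, h2, h3, hL⟩))⟩
  · exact ⟨2, by norm_num, by norm_num,
      jumpBehaviour_two_of_unbounded hc (tendsto_abs_atTop_atTop.comp h)⟩
  · exact ⟨2, by norm_num, by norm_num,
      jumpBehaviour_two_of_unbounded hc (tendsto_abs_atBot_atTop.comp h)⟩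

theorem exists_jumpBehaviour (hP : IsRatSeq P) (hQ : IsRatSeq Q) (hP0 : ∀ᶠ n in atTop, P n ≠ 0)
    (hQ0 : ∀ᶠ n in atTop, Q n ≠ 0) : ∃ k, 1 ≤ k ∧ k ≤ 6 ∧ JumpBehaviour P Q k := by
  obtain ⟨N, hN⟩ := eventually_atTop.1 (hP0.and hQ0)
  set P' := fun n => P (n + N) with hP'
  set Q' := fun n => Q (n + N) with hQ'
  have p0 : ∀ n, P' n ≠ 0 := fun n => (hN _ (by omega)).1
  have q0 : ∀ n, Q' n ≠ 0 := fun n => (hN _ (by omega)).2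
  have hc : IsRatSeq (normCoeff P' Q') :=
    ((IsRatSeq.const 4).mul ((hQ.shift N).shift 1)).neg.div
      (((hP.shift N).shift 1).mul (hP.shift N)) |>.congr
      (Eventually.of_forall fun n => by simp [normCoeff, hP', hQ'])
  obtain ⟨k, h1, h2, h3⟩ := exists_jumpBehaviour_normalized hc fun n => by
    unfold normCoeff
    exact div_ne_zero (neg_ne_zero.2 (mul_ne_zero four_ne_zero (q0 _))) (mul_ne_zero (p0 _) (p0 _))
  refine ⟨k, h1, h2, JumpBehaviour.of_shift (N := N) (P' := P') (Q' := Q') ?_ ?_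
    (JumpBehaviour.of_shift (N := 1) ?_ ?_ h3)⟩
  · intro n; rw [hP', hQ', (stepCoeff_shift N k n).1]
  · intro n; rw [hP', hQ', jumpCoeff_shift]
  · intro n
    have h4 := (step_gauge (Q := Q') p0 k n).1
    have g1 := gauge_ne_zero p0 (n + 1)
    have g2 := gauge_ne_zero p0 (n + k)
    constructor
    · intro h; rw [h, zero_mul] at h4
      exact (mul_eq_zero.1 h4.symm).resolve_left g2
    · intro h; rw [h, mul_zero] at h4
      exact (mul_eq_zero.1 h4).resolve_right g1
  · exact jumpCoeff_gauge p0 k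

/-- Kneser's dichotomy for rational coefficients. -/
theorem IsRatSeq.kneser_dichotomy (hc : IsRatSeq c) {k : ℕ} (hk : 1 ≤ k) :
    (∃ b : ℕ, ∀ᶠ n : ℕ in atTop,
      c n ≤ 1 + (k : ℝ) ^ 2 / (4 * ((n : ℝ) - b) * ((n : ℝ) + k - b))) ∨
    ∃ M : ℕ, 1 ≤ M ∧ ∀ᶠ n : ℕ in atTop, 1 + (1 / 4 + 1 / (M : ℝ)) * k ^ 2 / (n : ℝ) ^ 2 ≤ c n := by
  have hk0 : (0 : ℝ) < k := by exact_mod_cast hk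
  -- The excess of `c` over `1` in units of `k² / n²`. Its limit is compared with Kneser's constant
  -- `1/4`.
  set E : ℕ → ℝ := fun n => (n : ℝ) * n * (c n - 1) / k ^ 2 with hE
  have hEr : IsRatSeq E := by
    refine ((natCast.mul natCast).mul (hc.sub (IsRatSeq.const 1))).div
      (IsRatSeq.const ((k : ℚ) ^ 2)) |>.congr (Eventually.of_forall fun n => by simp [hE])
  have hcE : ∀ᶠ n : ℕ in atTop, c n = 1 + E n * k ^ 2 / (n : ℝ) ^ 2 := by
    filter_upwards [eventually_gt_atTop 0] with n hn
    have : (0 : ℝ) < n := by exact_mod_cast hn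
    simp only [hE]; field_simp; ring
  have osc : ∀ l : ℝ, 1 / 4 < l → (∀ᶠ n in atTop, l ≤ E n) → ∃ M : ℕ, 1 ≤ M ∧
      ∀ᶠ n : ℕ in atTop, 1 + (1 / 4 + 1 / (M : ℝ)) * k ^ 2 / (n : ℝ) ^ 2 ≤ c n := by
    intro l hl h
    obtain ⟨M, hM⟩ := exists_nat_one_div_lt (sub_pos.2 hl)
    refine ⟨M + 1, by omega, ?_⟩
    filter_upwards [hcE, h] with n a b
    rw [a]
    push_cast
    gcongr
    linarith
  have non : ∀ M : ℕ, (∀ᶠ n : ℕ in atTop, (E n - 1 / 4) * n ≤ M) →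
      ∃ b : ℕ, ∀ᶠ n : ℕ in atTop,
        c n ≤ 1 + (k : ℝ) ^ 2 / (4 * ((n : ℝ) - b) * ((n : ℝ) + k - b)) := by
    intro M hM
    -- In the borderline case the excess may be as large as `1/4 + M / n`. Shifting `n` by `b`
    -- enlarges the bound by a relative amount about `(2b - k) / n`. With `b = k + 2M` this is `(k +
    -- 4M) / n`, which beats `4M / n` and leaves the margin `k / n` for lower order terms.
    refine ⟨k + 2 * M, ?_⟩
    have hbig : ∀ᶠ n : ℕ in atTop, (k + 2 * M) * (2 * M) * 4 * M + (k + 2 * M) * (2 * M) +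
        k + 2 * M < n := eventually_gt_atTop _
    filter_upwards [hcE, hM, hbig] with n a b hn
    have hn' : ((k : ℝ) + 2 * M) * (2 * M) * 4 * M + (k + 2 * M) * (2 * M) + k + 2 * M < n := by
      exact_mod_cast hn
    have hM0 : (0 : ℝ) ≤ M := by positivity
    have hk1 : (1 : ℝ) ≤ k := by exact_mod_cast hk
    have t0 : 0 ≤ ((k : ℝ) + 2 * M) * (2 * M) * 4 * M := by positivity
    have t1 : 0 ≤ ((k : ℝ) + 2 * M) * (2 * M) := by positivity
    have hn0 : (0 : ℝ) < n := by linarith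
    rw [a]
    push_cast
    have p1 : (0 : ℝ) < n - (k + 2 * M) := by linarith
    have p2 : (0 : ℝ) < n + k - (k + 2 * M) := by linarith
    have b' : E n ≤ 1 / 4 + M / n := by
      have : E n - 1 / 4 ≤ M / n := by rw [le_div_iff₀ hn0]; exact b
      linarith
    have e1 : E n * k ^ 2 / (n : ℝ) ^ 2 ≤ (1 / 4 + M / n) * k ^ 2 / (n : ℝ) ^ 2 := by gcongr
    refine (add_le_add_right e1 1).trans ((add_le_add_iff_left 1).2 ?_)
    rw [div_le_div_iff₀ (by positivity) (by positivity)]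
    have e2 : (1 / 4 + (M : ℝ) / n) = (n + 4 * M) / (4 * n) := by field_simp
    rw [e2, div_mul_eq_mul_div, div_mul_eq_mul_div, div_le_iff₀ (by positivity)]
    have e3 : ((n : ℝ) + 4 * M) * ((n - (k + 2 * M)) * (n + k - (k + 2 * M))) ≤ n ^ 3 := by
      have : ((n : ℝ) + 4 * M) * ((n - (k + 2 * M)) * (n + k - (k + 2 * M))) =
        n ^ 3 - k * n ^ 2 + ((k + 2 * M) * (2 * M) - 4 * M * (k + 4 * M)) * n
          + (k + 2 * M) * (2 * M) * 4 * M := by ring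
      rw [this]
      have f1 : (k + 2 * M) * (2 * M) * (n : ℝ) + (k + 2 * M) * (2 * M) * 4 * M ≤ k * n ^ 2 := by
        have g1 : (1 : ℝ) ≤ n := by linarith
        have g2 : (k + 2 * M) * (2 * M) * 4 * M ≤ (k + 2 * M) * (2 * M) * 4 * M * (n : ℝ) :=
          le_mul_of_one_le_right t0 g1
        have g3 : ((k + 2 * M) * (2 * M) * 4 * M + (k + 2 * M) * (2 * M)) * (n : ℝ) ≤ n * n := by
          gcongr; linarith
        nlinarith
      have f2 : 0 ≤ 4 * (M : ℝ) * (k + 4 * M) * n := by positivity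
      nlinarith
    have e4 : 0 ≤ 4 * (k : ℝ) ^ 2 := by positivity
    nlinarith [mul_le_mul_of_nonneg_left e3 e4]
  rcases hEr.trichotomy with ⟨L, hL⟩ | h | h
  · by_cases hl : (1 / 4 : ℝ) < L
    · right
      have hmid : ((1 / 4 : ℝ) + L) / 2 < L := by linarith
      exact osc _ (by linarith) ((hL.eventually_const_lt hmid).mono fun n hn => hn.le)
    · left
      obtain ⟨M, hM⟩ := hEr.rate hL
      refine non M ?_
      filter_upwards [hM] with n a
      refine le_trans (mul_le_mul_of_nonneg_right ?_ (Nat.cast_nonneg n)) a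
      have := le_abs_self (E n - L)
      linarith [not_lt.1 hl]
  · right
    exact osc 1 (by norm_num) (h.eventually_ge_atTop 1)
  · left
    refine non 0 ?_
    filter_upwards [h.eventually_le_atBot 0] with n a
    have : (0 : ℝ) ≤ n := Nat.cast_nonneg n
    simp only [Nat.cast_zero]
    nlinarith

end HolonomicSign

namespace HolonomicSign

open Filter Topology Polynomial

/-! ### Arithmetic of integer polynomials given by lists of coefficients -/

def evalZ (l : List ℤ) (n : ℤ) : ℤ := l.foldr (fun a s => a + n * s) 0

def addL (a b : List ℤ) : List ℤ :=
  (List.range (max a.length b.length)).map fun i => a.getD i 0 + b.getD i 0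

def scaleL (c : ℤ) (a : List ℤ) : List ℤ := a.map fun x => c * x

def mulL (a b : List ℤ) : List ℤ := a.foldr (fun x s => addL (scaleL x b) (0 :: s)) []

def subL (a b : List ℤ) : List ℤ := addL a (scaleL (-1) b)

/-- The coefficients of `l (c + k * X)`. -/
def affL (l : List ℤ) (c k : ℤ) : List ℤ := l.foldr (fun x s => addL [x] (mulL [c, k] s)) []

/-- The sign of the leading coefficient. -/
def leadSign (l : List ℤ) : ℤ := l.foldr (fun a s => if s = 0 then a.sign else s) 0

/-- The sum of the absolute values of the coefficients. It is crude, but beyond it the sign of the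
polynomial is settled, so an eventual sign condition becomes a finite check. -/
def boundL (l : List ℤ) : ℕ := l.foldr (fun a s => a.natAbs + s) 0

theorem coeff_toPoly (l : List ℤ) (i : ℕ) : (toPoly l).coeff i = (l.getD i 0 : ℤ) := by
  induction l generalizing i with
  | nil => simp [toPoly]
  | cons a l ih =>
    cases i with
    | zero => simp [toPoly]
    | succ i => rw [toPoly, coeff_add, coeff_C_succ, coeff_X_mul, ih]; simp

theorem toPoly_addL (a b : List ℤ) : toPoly (addL a b) = toPoly a + toPoly b := by
  ext i
  rw [coeff_add, coeff_toPoly, coeff_toPoly, coeff_toPoly]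
  unfold addL
  by_cases h : i < max a.length b.length
  · rw [List.getD_eq_getElem _ _ (by simpa using h)]
    simp
  · rw [List.getD_eq_default _ _ (by simpa using h)]
    push Not at h
    rw [List.getD_eq_default a _ (by omega), List.getD_eq_default b _ (by omega)]
    simp

theorem toPoly_scaleL (c : ℤ) (a : List ℤ) : toPoly (scaleL c a) = C (c : ℚ) * toPoly a := by
  induction a with
  | nil => simp [scaleL, toPoly]
  | cons x a ih =>
    have : scaleL c (x :: a) = (c * x) :: scaleL c a := rfl
    rw [this, toPoly, ih, toPoly]
    simp only [Int.cast_mul, C_mul]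
    ring

theorem toPoly_mulL (a b : List ℤ) : toPoly (mulL a b) = toPoly a * toPoly b := by
  induction a with
  | nil => simp [mulL, toPoly]
  | cons x a ih =>
    have : mulL (x :: a) b = addL (scaleL x b) (0 :: mulL a b) := rfl
    rw [this, toPoly_addL, toPoly_scaleL, toPoly, ih, toPoly]
    simp only [Int.cast_zero, C_0]
    ring

theorem toPoly_subL (a b : List ℤ) : toPoly (subL a b) = toPoly a - toPoly b := by
  rw [subL, toPoly_addL, toPoly_scaleL]
  simp; ring

theorem eval_toPoly (l : List ℤ) (n : ℤ) : (toPoly l).eval (n : ℚ) = (evalZ l n : ℤ) := by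
  induction l with
  | nil => simp [toPoly, evalZ]
  | cons a l ih =>
    have : evalZ (a :: l) n = a + n * evalZ l n := rfl
    rw [this, toPoly]; simp [ih]

theorem evalZ_eq_of {l : List ℤ} {n v : ℤ} (h : (toPoly l).eval (n : ℚ) = v) : evalZ l n = v := by
  rw [eval_toPoly] at h; exact_mod_cast h

@[simp] theorem evalZ_addL (a b : List ℤ) (n : ℤ) :
    evalZ (addL a b) n = evalZ a n + evalZ b n :=
  evalZ_eq_of (by rw [toPoly_addL, eval_add, eval_toPoly, eval_toPoly]; push_cast; rfl)

@[simp] theorem evalZ_subL (a b : List ℤ) (n : ℤ) :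
    evalZ (subL a b) n = evalZ a n - evalZ b n :=
  evalZ_eq_of (by rw [toPoly_subL, eval_sub, eval_toPoly, eval_toPoly]; push_cast; rfl)

@[simp] theorem evalZ_mulL (a b : List ℤ) (n : ℤ) :
    evalZ (mulL a b) n = evalZ a n * evalZ b n :=
  evalZ_eq_of (by rw [toPoly_mulL, eval_mul, eval_toPoly, eval_toPoly]; push_cast; rfl)

@[simp] theorem evalZ_nil (n : ℤ) : evalZ [] n = 0 := rfl

@[simp] theorem evalZ_cons (a : ℤ) (l : List ℤ) (n : ℤ) :
    evalZ (a :: l) n = a + n * evalZ l n := rfl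

@[simp] theorem evalZ_affL (l : List ℤ) (c k n : ℤ) :
    evalZ (affL l c k) n = evalZ l (c + k * n) := by
  induction l with
  | nil => rfl
  | cons a l ih =>
    have : affL (a :: l) c k = addL [a] (mulL [c, k] (affL l c k)) := rfl
    rw [this, evalZ_addL, evalZ_mulL, ih]
    simp only [evalZ_cons, evalZ_nil]; ring

theorem leadSign_eq_zero_iff (l : List ℤ) : leadSign l = 0 ↔ toPoly l = 0 := by
  have key : ∀ l : List ℤ, leadSign l = 0 ↔ ∀ a ∈ l, a = 0 := by
    intro l
    induction l with
    | nil => simp [leadSign]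
    | cons a l ih =>
      have : leadSign (a :: l) = if leadSign l = 0 then a.sign else leadSign l := rfl
      rw [this]
      split_ifs with h
      · rw [Int.sign_eq_zero_iff_zero]
        simpa using fun _ => ih.1 h
      · simp only [h, false_iff]
        intro hall
        exact h (ih.2 fun b hb => hall b (List.mem_cons_of_mem _ hb))
  rw [key]
  constructor
  · intro h
    induction l with
    | nil => rfl
    | cons a l ih =>
      rw [toPoly, ih fun b hb => h b (List.mem_cons_of_mem _ hb), h a List.mem_cons_self]
      simp
  · intro h a ha
    obtain ⟨i, hi, rfl⟩ := List.mem_iff_getElem.1 ha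
    have := coeff_toPoly l i
    rw [h, coeff_zero, List.getD_eq_getElem _ _ hi] at this
    exact_mod_cast this.symm

theorem evalZ_eq_zero_of_leadSign {l : List ℤ} (h : leadSign l = 0) (n : ℤ) : evalZ l n = 0 :=
  evalZ_eq_of (by rw [(leadSign_eq_zero_iff l).1 h]; simp)

/-- Horner's scheme: if the tail does not vanish at `n`, its contribution has absolute value at
least `n`, which exceeds the constant coefficient. -/
theorem sign_evalZ {l : List ℤ} {n : ℕ} (hn : boundL l < n) :
    (evalZ l n).sign = leadSign l := by
  induction l with
  | nil => rfl
  | cons a l ih =>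
    have hb : boundL (a :: l) = a.natAbs + boundL l := rfl
    have hl : leadSign (a :: l) = if leadSign l = 0 then a.sign else leadSign l := rfl
    rw [hb] at hn
    rw [evalZ_cons, hl]
    split_ifs with h
    · rw [evalZ_eq_zero_of_leadSign h, mul_zero, add_zero]
    · have h1 := ih (by omega)
      rw [← h1] at h ⊢
      have hne : evalZ l n ≠ 0 := fun h0 => h (by rw [h0]; rfl)
      have ha : |a| < n := by rw [Int.abs_eq_natAbs]; omega
      obtain ⟨ha1, ha2⟩ := abs_lt.1 ha
      rcases lt_or_gt_of_ne hne with h0 | h0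
      · rw [Int.sign_eq_neg_one_of_neg h0, Int.sign_eq_neg_one_of_neg]
        nlinarith
      · rw [Int.sign_eq_one_of_pos h0, Int.sign_eq_one_of_pos]
        nlinarith

theorem evalZ_ne_zero {l : List ℤ} (h : leadSign l ≠ 0) {n : ℕ} (hn : boundL l < n) :
    evalZ l n ≠ 0 := by
  intro h0
  apply h
  rw [← sign_evalZ hn, h0]; rfl

theorem evalZ_nonneg {l : List ℤ} (h : leadSign l ≠ -1) {n : ℕ} (hn : boundL l < n) :
    0 ≤ evalZ l n := by
  by_contra hcon
  exact h (by rw [← sign_evalZ hn, Int.sign_eq_neg_one_of_neg (not_le.1 hcon)])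

theorem leadSign_ne_neg_one {l : List ℤ} (h : ∀ᶠ n : ℕ in atTop, 0 ≤ evalZ l n) :
    leadSign l ≠ -1 := by
  obtain ⟨n, h1, h2⟩ := (h.and (eventually_gt_atTop (boundL l))).exists
  rw [← sign_evalZ h2]
  intro h3
  rw [Int.sign_eq_neg_one_iff_neg] at h3
  omega

theorem leadSign_ne_zero {l : List ℤ} (h : ∃ n : ℤ, evalZ l n ≠ 0) : leadSign l ≠ 0 := by
  obtain ⟨n, hn⟩ := h
  exact fun h0 => hn (evalZ_eq_zero_of_leadSign h0 n)

theorem leadSign_mul {l m : List ℤ} {n : ℕ} (hl : boundL l < n) (hm : boundL m < n) :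
    leadSign l * leadSign m = (evalZ l n * evalZ m n).sign := by
  rw [Int.sign_mul, sign_evalZ hl, sign_evalZ hm]

/-! ### Values of the rational functions given by lists of coefficients -/

theorem eval₂_toPoly (l : List ℤ) (n : ℕ) :
    (toPoly l).eval₂ (algebraMap ℚ ℝ) (n : ℝ) = (evalZ l n : ℤ) := by
  have h : (toPoly l).eval₂ (algebraMap ℚ ℝ) (algebraMap ℚ ℝ ((n : ℤ) : ℚ)) =
      algebraMap ℚ ℝ ((toPoly l).eval ((n : ℤ) : ℚ)) := eval₂_at_apply _ _
  rw [eval_toPoly] at h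
  simpa using h

/-- `RatFunc.eval` uses the reduced fraction. The reduced denominator divides the given one, so it
does not vanish either, and multiplicativity of evaluation applies. -/
theorem valueAt_div {a b : List ℤ} {n : ℕ} (hb : evalZ b n ≠ 0) :
    valueAt (algebraMap ℚ[X] (RatFunc ℚ) (toPoly a) / algebraMap ℚ[X] (RatFunc ℚ) (toPoly b)) n =
      (evalZ a n : ℝ) / (evalZ b n : ℝ) := by
  unfold valueAt
  set r := algebraMap ℚ[X] (RatFunc ℚ) (toPoly a) / algebraMap ℚ[X] (RatFunc ℚ) (toPoly b) with hr
  have hb0 : toPoly b ≠ 0 := by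
    intro h0
    apply hb
    exact evalZ_eq_of (by rw [h0]; simp)
  have hbR : (toPoly b).eval₂ (algebraMap ℚ ℝ) (n : ℝ) ≠ 0 := by
    rw [eval₂_toPoly]; exact_mod_cast hb
  have hden : r.denom.eval₂ (algebraMap ℚ ℝ) (n : ℝ) ≠ 0 := by
    obtain ⟨t, ht⟩ := RatFunc.denom_div_dvd (toPoly a) (toPoly b)
    intro h0
    apply hbR
    rw [ht, eval₂_mul, h0, zero_mul]
  have hmul : r * algebraMap ℚ[X] (RatFunc ℚ) (toPoly b) =
      algebraMap ℚ[X] (RatFunc ℚ) (toPoly a) :=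
    div_mul_cancel₀ _ (by simpa using hb0)
  have h1 := RatFunc.eval_mul (algebraMap ℚ ℝ) (n : ℝ) (x := r)
    (y := algebraMap ℚ[X] (RatFunc ℚ) (toPoly b)) hden (by simp)
  rw [hmul, RatFunc.eval_algebraMap, RatFunc.eval_algebraMap] at h1
  simp only [Algebra.algebraMap_self, RingHom.id_apply, eval₂_toPoly] at h1
  rw [eq_div_iff (by exact_mod_cast hb)]
  exact h1.symm

theorem noPoles_div {a b : List ℤ} (hb : ∀ n : ℕ, evalZ b n ≠ 0) :
    NoPoles (RatFuncCode.toRatFunc (a, b)) := by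
  intro n h0
  obtain ⟨t, ht⟩ := RatFunc.denom_div_dvd (toPoly a) (toPoly b)
  apply hb n
  refine evalZ_eq_of ?_
  have h1 : (toPoly b).eval (n : ℚ) = 0 := by
    rw [ht, eval_mul]
    exact mul_eq_zero_of_left h0 _
  simpa using h1

theorem noZeros_div {a b : List ℤ} (ha : ∀ n : ℕ, evalZ a n ≠ 0) (hb : ∀ n : ℕ, evalZ b n ≠ 0) :
    NoZeros (RatFuncCode.toRatFunc (a, b)) := by
  have hb0 : toPoly b ≠ 0 := by
    intro h0
    exact hb 0 (evalZ_eq_of (by rw [h0]; simp))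
  intro n h0
  obtain ⟨t, ht⟩ := RatFunc.num_div_dvd (toPoly a) hb0
  apply ha n
  refine evalZ_eq_of ?_
  have h1 : (toPoly a).eval (n : ℚ) = 0 := by
    rw [ht, eval_mul]
    exact mul_eq_zero_of_left h0 _
  simpa using h1

/-- Rational functions without poles in `ℕ` can be written over a common denominator, with
integer coefficients, that has no zeros in `ℕ`. -/
theorem exists_common_denominator {P Q : RatFunc ℚ} (hP : NoPoles P) (hQ : NoPoles Q) :
    ∃ p q d : List ℤ, (∀ n : ℕ, evalZ d n ≠ 0) ∧
      P * algebraMap ℚ[X] (RatFunc ℚ) (toPoly d) = algebraMap ℚ[X] (RatFunc ℚ) (toPoly p) ∧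
      Q * algebraMap ℚ[X] (RatFunc ℚ) (toPoly d) = algebraMap ℚ[X] (RatFunc ℚ) (toPoly q) := by
  have lists : ∀ f : ℤ[X], ∃ l : List ℤ, toPoly l = f.map (Int.castRingHom ℚ) := by
    intro f
    refine ⟨(List.range (f.natDegree + 1)).map f.coeff, ?_⟩
    ext i
    rw [coeff_toPoly, coeff_map]
    by_cases h : i < f.natDegree + 1
    · rw [List.getD_eq_getElem _ _ (by simpa using h)]; simp
    · rw [List.getD_eq_default _ _ (by simpa using h), coeff_eq_zero_of_natDegree_lt (by omega)]
      simp
  have clear : ∀ f : ℚ[X], ∃ (m : ℤ) (l : List ℤ), m ≠ 0 ∧ toPoly l = C (m : ℚ) * f := by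
    intro f
    obtain ⟨b, hbM, hb⟩ := IsLocalization.integerNormalization_spec (nonZeroDivisors ℤ) f
    obtain ⟨l, hl⟩ := lists (IsLocalization.integerNormalization (nonZeroDivisors ℤ) f)
    refine ⟨b, l, nonZeroDivisors.ne_zero hbM, ?_⟩
    rw [hl]
    have : (Int.castRingHom ℚ) = algebraMap ℤ ℚ := rfl
    rw [this, hb]
    ext i
    simp
  obtain ⟨m1, l1, h1, e1⟩ := clear (P.num * Q.denom)
  obtain ⟨m2, l2, h2, e2⟩ := clear (Q.num * P.denom)
  obtain ⟨m3, l3, h3, e3⟩ := clear (P.denom * Q.denom)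
  have hP' : P * algebraMap ℚ[X] (RatFunc ℚ) P.denom = algebraMap ℚ[X] (RatFunc ℚ) P.num := by
    exact (div_eq_iff (by simpa using P.denom_ne_zero)).1 (RatFunc.num_div_denom P) |>.symm
  have hQ' : Q * algebraMap ℚ[X] (RatFunc ℚ) Q.denom = algebraMap ℚ[X] (RatFunc ℚ) Q.num := by
    exact (div_eq_iff (by simpa using Q.denom_ne_zero)).1 (RatFunc.num_div_denom Q) |>.symm
  -- The three polynomials are cleared of denominators by separate factors `m1`, `m2`, `m3`.
  -- Cross-multiplying gives all of them the common factor `m1 * m2 * m3`.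
  refine ⟨scaleL (m2 * m3) l1, scaleL (m1 * m3) l2, scaleL (m1 * m2) l3, ?_, ?_, ?_⟩
  · intro n h0
    have : (toPoly (scaleL (m1 * m2) l3)).eval ((n : ℤ) : ℚ) ≠ 0 := by
      rw [toPoly_scaleL, e3]
      simp only [eval_mul, eval_C]
      have a := hP n
      have b := hQ n
      simp only [Int.cast_natCast]
      refine mul_ne_zero ?_ (mul_ne_zero ?_ (mul_ne_zero a b))
      · exact_mod_cast mul_ne_zero h1 h2
      · exact_mod_cast h3
    rw [eval_toPoly, h0] at this
    simp at this
  · rw [toPoly_scaleL, toPoly_scaleL, e1, e3]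
    simp only [map_mul, Int.cast_mul]
    rw [← hP']; ring
  · rw [toPoly_scaleL, toPoly_scaleL, e2, e3]
    simp only [map_mul, Int.cast_mul]
    rw [← hQ']; ring

end HolonomicSign

namespace HolonomicSign

open Filter Topology Polynomial

/-! ### The data computed from an instance -/

/-- Integer polynomials `p`, `q`, `d` that represent the recurrence with coefficients `p / d` and
`q / d`. -/
abbrev RecCode : Type := List ℤ × List ℤ × List ℤ

/-- Numerators and common denominator of `stepA` and `stepB`. -/
def stepL (t : RecCode) : ℕ → List ℤ × List ℤ × List ℤ
  | 0 => ([], [1], [1])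
  | k + 1 =>
    (addL (mulL (affL (stepL t k).1 1 1) t.1) (mulL (affL (stepL t k).2.1 1 1) t.2.2),
      mulL (affL (stepL t k).1 1 1) t.2.1, mulL (affL (stepL t k).2.2 1 1) t.2.2)

def jumpNumP (t : RecCode) (k : ℕ) : List ℤ := mulL (stepL t (2 * k)).1 (stepL t k).2.2

def jumpDen (t : RecCode) (k : ℕ) : List ℤ := mulL (stepL t (2 * k)).2.2 (stepL t k).1

def jumpNumQ (t : RecCode) (k : ℕ) : List ℤ :=
  subL (mulL (stepL t (2 * k)).2.1 (stepL t k).1) (mulL (stepL t (2 * k)).1 (stepL t k).2.1)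

/-- Numerator of `jumpCoeff`. -/
def coeffNum (t : RecCode) (k : ℕ) : List ℤ :=
  scaleL (-4) (mulL (affL (jumpNumQ t k) k 1) (jumpDen t k))

/-- Denominator of `jumpCoeff`. -/
def coeffDen (t : RecCode) (k : ℕ) : List ℤ := mulL (affL (jumpNumP t k) k 1) (jumpNumP t k)

/-- Values of the sequence: `(x, y, e)` with `f n = x / e` and `f (n + 1) = y / e`. -/
def stateZ (t : RecCode) (v : RatCode × RatCode) : ℕ → ℤ × ℤ × ℤ
  | 0 => (v.1.1 * (v.2.2 + 1), v.2.1 * (v.1.2 + 1), (v.1.2 + 1) * (v.2.2 + 1))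
  | n + 1 =>
    ((stateZ t v n).2.1 * evalZ t.2.2 n,
      evalZ t.1 n * (stateZ t v n).2.1 + evalZ t.2.1 n * (stateZ t v n).1,
      (stateZ t v n).2.2 * evalZ t.2.2 n)

/-- The code `t` represents the recurrence of the instance `x`. -/
structure Represents (t : RecCode) (x : Instance) : Prop where
  ne_zero : ∀ n : ℕ, evalZ t.2.2 n ≠ 0
  valueP : ∀ n : ℕ, valueAt x.P n = (evalZ t.1 n : ℝ) / (evalZ t.2.2 n : ℝ)
  valueQ : ∀ n : ℕ, valueAt x.Q n = (evalZ t.2.1 n : ℝ) / (evalZ t.2.2 n : ℝ)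

theorem holonomicSeq_solves (P Q : RatFunc ℚ) (a b : ℝ) :
    Solves (valueAt P) (valueAt Q) (holonomicSeq P Q a b) := fun _ => rfl

theorem Solves.ext {P Q f g : ℕ → ℝ} (hf : Solves P Q f) (hg : Solves P Q g) (h0 : f 0 = g 0)
    (h1 : f 1 = g 1) : f = g := by
  funext n
  induction n using Nat.twoStepInduction with
  | zero => exact h0
  | one => exact h1
  | more n a b => rw [hf n, hg n, a, b]

namespace Represents

variable {t : RecCode} {x : Instance}

theorem solves (x : Instance) : Solves (valueAt x.P) (valueAt x.Q) x.seq :=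
  holonomicSeq_solves _ _ _ _

theorem stepL_spec (h : Represents t x) (k : ℕ) : ∀ n : ℕ,
    evalZ (stepL t k).2.2 n ≠ 0 ∧
    stepA (valueAt x.P) (valueAt x.Q) k n =
      (evalZ (stepL t k).1 n : ℝ) / (evalZ (stepL t k).2.2 n : ℝ) ∧
    stepB (valueAt x.P) (valueAt x.Q) k n =
      (evalZ (stepL t k).2.1 n : ℝ) / (evalZ (stepL t k).2.2 n : ℝ) := by
  induction k with
  | zero => intro n; simp [stepL]
  | succ k ih =>
    intro n
    obtain ⟨h0, h1, h2⟩ := ih (n + 1)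
    have hd := h.ne_zero n
    push_cast at h0 h1 h2
    have e : (1 : ℤ) + 1 * (n : ℤ) = n + 1 := by ring
    have h0' : (evalZ (stepL t k).2.2 ((n : ℤ) + 1) : ℝ) ≠ 0 := by exact_mod_cast h0
    have hd' : (evalZ t.2.2 (n : ℤ) : ℝ) ≠ 0 := by exact_mod_cast hd
    simp only [stepL, evalZ_addL, evalZ_mulL, evalZ_affL, e]
    refine ⟨mul_ne_zero h0 hd, ?_, ?_⟩
    · rw [stepA_succ, h1, h2, h.valueP]
      push_cast
      field_simp
    · rw [stepB_succ, h1, h.valueQ]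
      push_cast
      field_simp

theorem stepA_eq_zero_iff (h : Represents t x) (k n : ℕ) :
    stepA (valueAt x.P) (valueAt x.Q) k n = 0 ↔ evalZ (stepL t k).1 n = 0 := by
  obtain ⟨h0, h1, -⟩ := h.stepL_spec k n
  have h0' : (evalZ (stepL t k).2.2 (n : ℤ) : ℝ) ≠ 0 := by exact_mod_cast h0
  rw [h1, div_eq_zero_iff]
  simp only [h0', or_false, Int.cast_eq_zero]

theorem jumpP_eq (h : Represents t x) (k n : ℕ) :
    jumpP (valueAt x.P) (valueAt x.Q) k n =
      (evalZ (jumpNumP t k) n : ℝ) / (evalZ (jumpDen t k) n : ℝ) := by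
  obtain ⟨h0, h1, -⟩ := h.stepL_spec k n
  obtain ⟨g0, g1, -⟩ := h.stepL_spec (2 * k) n
  have h0' : (evalZ (stepL t k).2.2 (n : ℤ) : ℝ) ≠ 0 := by exact_mod_cast h0
  have g0' : (evalZ (stepL t (2 * k)).2.2 (n : ℤ) : ℝ) ≠ 0 := by exact_mod_cast g0
  simp only [jumpP, h1, g1, jumpNumP, jumpDen, evalZ_mulL]
  push_cast
  rw [div_div_div_eq]

theorem jumpQ_eq (h : Represents t x) (k n : ℕ) :
    jumpQ (valueAt x.P) (valueAt x.Q) k n =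
      (evalZ (jumpNumQ t k) n : ℝ) / (evalZ (jumpDen t k) n : ℝ) := by
  obtain ⟨h0, h1, h2⟩ := h.stepL_spec k n
  obtain ⟨g0, g1, g2⟩ := h.stepL_spec (2 * k) n
  have h0' : (evalZ (stepL t k).2.2 (n : ℤ) : ℝ) ≠ 0 := by exact_mod_cast h0
  have g0' : (evalZ (stepL t (2 * k)).2.2 (n : ℤ) : ℝ) ≠ 0 := by exact_mod_cast g0
  simp only [jumpQ, h1, h2, g1, g2, jumpNumQ, jumpDen, evalZ_mulL, evalZ_subL]
  push_cast
  by_cases hz : (evalZ (stepL t k).1 (n : ℤ) : ℝ) = 0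
  · simp [hz]
  · field_simp

theorem jumpCoeff_eq (h : Represents t x) {k n : ℕ}
    (hd : evalZ (jumpDen t k) (n + k : ℕ) ≠ 0) :
    jumpCoeff (valueAt x.P) (valueAt x.Q) k n =
      (evalZ (coeffNum t k) n : ℝ) / (evalZ (coeffDen t k) n : ℝ) := by
  have e : (k : ℤ) + 1 * (n : ℤ) = ((n + k : ℕ) : ℤ) := by push_cast; ring
  have es : ∀ l : List ℤ, evalZ (scaleL (-4) l) n = -4 * evalZ l n := fun l =>
    evalZ_eq_of (by rw [toPoly_scaleL, eval_mul, eval_toPoly, eval_C]; push_cast; rfl)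
  have hd' : (evalZ (jumpDen t k) ((n + k : ℕ) : ℤ) : ℝ) ≠ 0 := by exact_mod_cast hd
  unfold jumpCoeff
  rw [h.jumpP_eq, h.jumpP_eq, h.jumpQ_eq]
  simp only [coeffNum, coeffDen, evalZ_mulL, evalZ_affL, e, es]
  push_cast at hd' ⊢
  by_cases hz : (evalZ (jumpDen t k) (n : ℤ) : ℝ) = 0
  · simp [hz]
  by_cases hy : (evalZ (jumpNumP t k) (n : ℤ) : ℝ) = 0
  · simp [hy]
  by_cases hw : (evalZ (jumpNumP t k) ((n : ℤ) + k) : ℝ) = 0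
  · simp [hw]
  field_simp

theorem stateZ_spec (h : Represents t x) (n : ℕ) :
    (stateZ t x.2 n).2.2 ≠ 0 ∧
    x.seq n = ((stateZ t x.2 n).1 : ℝ) / ((stateZ t x.2 n).2.2 : ℝ) ∧
    x.seq (n + 1) = ((stateZ t x.2 n).2.1 : ℝ) / ((stateZ t x.2 n).2.2 : ℝ) := by
  induction n with
  | zero =>
    have h1 : ((x.2.1.2 : ℤ) + 1) ≠ 0 := by positivity
    have h2 : ((x.2.2.2 : ℤ) + 1) ≠ 0 := by positivity
    have h1' : ((x.2.1.2 : ℝ) + 1) ≠ 0 := by positivity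
    have h2' : ((x.2.2.2 : ℝ) + 1) ≠ 0 := by positivity
    refine ⟨mul_ne_zero h1 h2, ?_, ?_⟩
    · show ((RatCode.toRat x.2.1 : ℚ) : ℝ) = _
      simp only [RatCode.toRat, stateZ]
      push_cast
      field_simp
    · show ((RatCode.toRat x.2.2 : ℚ) : ℝ) = _
      simp only [RatCode.toRat, stateZ]
      push_cast
      field_simp
  | succ n ih =>
    obtain ⟨h0, h1, h2⟩ := ih
    have hd := h.ne_zero n
    have h0' : ((stateZ t x.2 n).2.2 : ℝ) ≠ 0 := by exact_mod_cast h0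
    have hd' : (evalZ t.2.2 (n : ℤ) : ℝ) ≠ 0 := by exact_mod_cast hd
    refine ⟨mul_ne_zero h0 hd, ?_, ?_⟩
    · rw [h2]; simp only [stateZ]; push_cast; field_simp
    · rw [solves x n, h1, h2, h.valueP, h.valueQ]
      simp only [stateZ]; push_cast; field_simp

end Represents

/-! ### Certificates -/

/-- A certificate: a code of the recurrence, numbers `k`, `N`, `b`, `M`, then the numerator and
the denominator of a limit, a mode, and a word of signs. -/
abbrev Cert : Type := RecCode × (ℕ × ℕ × ℕ × ℕ) × (ℕ × ℕ × ℕ) × List SignType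

namespace Cert

def t (w : Cert) : RecCode := w.1
def k (w : Cert) : ℕ := w.2.1.1
def N (w : Cert) : ℕ := w.2.1.2.1
def b (w : Cert) : ℕ := w.2.1.2.2.1
def M (w : Cert) : ℕ := w.2.1.2.2.2
def limNum (w : Cert) : ℕ := w.2.2.1.1
def limDen (w : Cert) : ℕ := w.2.2.1.2.1
def mode (w : Cert) : ℕ := w.2.2.1.2.2
def word (w : Cert) : List SignType := w.2.2.2

/-- Nonnegative values express the non-oscillation condition. -/
def nonoscPoly (w : Cert) : List ℤ :=
  subL (scaleL ((w.k : ℤ) * w.k) (mulL (coeffDen w.t w.k) (coeffDen w.t w.k)))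
    (scaleL 4 (mulL (mulL [-(w.b : ℤ), 1] [(w.k : ℤ) - w.b, 1])
      (mulL (subL (coeffNum w.t w.k) (coeffDen w.t w.k)) (coeffDen w.t w.k))))

/-- Nonnegative values express the oscillation condition. -/
def oscPoly (w : Cert) : List ℤ :=
  subL (scaleL (4 * w.M) (mulL [0, 0, 1]
      (mulL (subL (coeffNum w.t w.k) (coeffDen w.t w.k)) (coeffDen w.t w.k))))
    (scaleL ((w.M + 4) * ((w.k : ℤ) * w.k)) (mulL (coeffDen w.t w.k) (coeffDen w.t w.k)))

def limDiff (w : Cert) : List ℤ :=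
  subL (scaleL w.limDen (coeffNum w.t w.k)) (scaleL w.limNum (coeffDen w.t w.k))

/-- Nonnegative values express that `jumpCoeff` is close to the limit. -/
def limPoly (w : Cert) : List ℤ :=
  subL (scaleL ((w.M : ℤ) * w.M * ((w.limDen : ℤ) * w.limDen))
      (mulL (coeffDen w.t w.k) (coeffDen w.t w.k)))
    (mulL [0, 0, 1] (mulL w.limDiff w.limDiff))

/-- All the polynomials whose signs have to be settled. -/
def polys (w : Cert) : List (List ℤ) :=
  [w.t.1, w.t.2.1, w.t.2.2, (stepL w.t w.k).1, (stepL w.t w.k).2.1, (stepL w.t w.k).2.2,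
    jumpNumP w.t w.k, jumpDen w.t w.k, jumpNumQ w.t w.k, coeffNum w.t w.k, coeffDen w.t w.k,
    w.nonoscPoly, w.oscPoly, w.limPoly]

/-- Any `N` above this settles the signs of all listed polynomials at every `n ≥ N`. -/
def bigBound (w : Cert) : ℕ := w.polys.foldr (fun l s => boundL l + s) 0

/-- The answer contained in a certificate. -/
def answer (w : Cert) : Option (List SignType × ℕ) :=
  if w.mode ≤ 3 then some (w.word, w.N + w.k) else none

end Cert

noncomputable def signAt (t : RecCode) (v : RatCode × RatCode) (n : ℕ) : SignType :=
  SignType.sign ((stateZ t v n).1 * (stateZ t v n).2.2)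

/-- A code of the rational number `s.1 / s.2.2`. -/
def stateCode (s : ℤ × ℤ × ℤ) : RatCode := (s.1 * s.2.2, (s.2.2 * s.2.2).natAbs - 1)

/-- The instance of the minimality problem for the terms of index `n, n + k, n + 2 k, …`. -/
def jumpInstance (t : RecCode) (v : RatCode × RatCode) (k n : ℕ) : Instance :=
  (((affL (jumpNumP t k) n k, affL (jumpDen t k) n k),
    (affL (jumpNumQ t k) n k, affL (jumpDen t k) n k)),
    (stateCode (stateZ t v n), stateCode (stateZ t v (n + k))))

/-- Integer form of `SolExceedsAt`. -/
def ExceedsZ (t : RecCode) (v : RatCode × RatCode) (k b n : ℕ) : Prop :=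
  (2 * ((n : ℤ) - b) + k) * ((evalZ (jumpNumP t k) n * evalZ (jumpNumP t k) n) *
      (((stateZ t v (n + k)).1 * (stateZ t v (n + k)).1) *
        ((stateZ t v (n + 2 * k)).2.2 * (stateZ t v (n + 2 * k)).2.2))) <
    4 * ((n : ℤ) - b) * ((evalZ (jumpNumP t k) n * evalZ (jumpDen t k) n) *
      (((stateZ t v (n + k)).1 * (stateZ t v (n + k)).2.2) *
        ((stateZ t v (n + 2 * k)).1 * (stateZ t v (n + 2 * k)).2.2)))

/-- The code in the certificate represents the recurrence of the instance. -/
def BaseCheck (x : Instance) (w : Cert) : Prop :=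
  leadSign (subL (mulL w.t.1 x.1.1.2) (mulL x.1.1.1 w.t.2.2)) = 0 ∧
  leadSign (subL (mulL w.t.2.1 x.1.2.2) (mulL x.1.2.1 w.t.2.2)) = 0 ∧
  leadSign w.t.2.2 ≠ 0 ∧ (∀ n < boundL w.t.2.2 + 1, evalZ w.t.2.2 n ≠ 0) ∧
  1 ≤ w.k ∧ w.k ≤ 6 ∧ w.bigBound < w.N

/-- The word of the certificate agrees with the signs of one period. -/
def WordCheck (x : Instance) (w : Cert) : Prop :=
  w.word.length = 2 * w.k ∧ ∀ i < 2 * w.k,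
    w.word[(w.N + w.k + i) % (2 * w.k)]? = some (signAt w.t x.2 (w.N + w.k + i))

def StateZero (x : Instance) (w : Cert) : Prop :=
  (stateZ w.t x.2 w.N).1 = 0 ∧ (stateZ w.t x.2 w.N).2.1 = 0

/-- Together with `bigBound < N` these conditions make the distance-`k` recurrence well defined from
`N` on, with both of its coefficients nonzero. -/
def NondegCheck (w : Cert) : Prop :=
  leadSign (stepL w.t w.k).1 ≠ 0 ∧ leadSign w.t.2.1 ≠ 0 ∧
  leadSign (coeffNum w.t w.k) ≠ 0 ∧ leadSign (coeffDen w.t w.k) ≠ 0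

/-- For each residue class modulo `k` one needs evidence of one of two kinds: the oracle says the
subsequence is minimal, or the crossing of the supersolution is visible at `N + i`. -/
def NonoscCheck (x : Instance) (w : Cert) (bits : List Bool) : Prop :=
  NondegCheck w ∧ leadSign (coeffNum w.t w.k) * leadSign (coeffDen w.t w.k) = 1 ∧
  leadSign w.nonoscPoly ≠ -1 ∧ w.b + w.k ≤ w.N ∧
  ∀ i < w.k, bits.getD i false = true ∨ ExceedsZ w.t x.2 w.k w.b (w.N + i)

/-- The limit `limNum / limDen` is certified by the rate `M / n`. When the limit is `1`, the same
`M` also measures the margin `1 / M` above Kneser's constant. -/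
def OscCheck (x : Instance) (w : Cert) : Prop :=
  NondegCheck w ∧ ¬ StateZero x w ∧ 1 ≤ w.limDen ∧ leadSign w.limPoly ≠ -1 ∧
  ((w.limNum = w.limDen ∧ 1 ≤ w.M ∧ leadSign w.oscPoly ≠ -1) ∨
    (w.limDen < w.limNum ∧ w.limNum ≠ 4 * w.limDen ∧ w.limNum ≠ 2 * w.limDen ∧
      3 * w.limNum ≠ 4 * w.limDen))

/-- The certificate is correct, given the answers `bits` of the oracle. -/
def Check (x : Instance) (w : Cert) (bits : List Bool) : Prop :=
  BaseCheck x w ∧ ((WordCheck x w ∧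
    ((w.mode = 0 ∧ StateZero x w) ∨ (w.mode = 1 ∧ leadSign w.t.1 ≠ 0 ∧ leadSign w.t.2.1 = 0) ∨
      (w.mode = 2 ∧ leadSign (stepL w.t w.k).1 = 0) ∨ (w.mode = 3 ∧ NonoscCheck x w bits))) ∨
    (w.mode = 4 ∧ OscCheck x w))

end HolonomicSign

namespace HolonomicSign

open Filter Topology Polynomial

/-! ### Correctness of certificates -/

section

variable {x : Instance} {w : Cert} {t : RecCode}

theorem evalZ_scaleL (c : ℤ) (l : List ℤ) (n : ℤ) : evalZ (scaleL c l) n = c * evalZ l n :=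
  evalZ_eq_of (by rw [toPoly_scaleL, eval_mul, eval_toPoly, eval_C]; push_cast; rfl)

theorem Represents.of_eq (hx : x.IsValid) (hP : toPoly t.1 * toPoly x.1.1.2 =
      toPoly x.1.1.1 * toPoly t.2.2) (hQ : toPoly t.2.1 * toPoly x.1.2.2 =
      toPoly x.1.2.1 * toPoly t.2.2) (hd : ∀ n : ℕ, evalZ t.2.2 n ≠ 0) : Represents t x := by
  have hd0 : toPoly t.2.2 ≠ 0 := by
    intro h0
    exact hd 0 (evalZ_eq_of (by rw [h0]; simp))
  have key : ∀ {a b p d : ℚ[X]}, b ≠ 0 → d ≠ 0 → p * b = a * d →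
      algebraMap ℚ[X] (RatFunc ℚ) a / algebraMap ℚ[X] (RatFunc ℚ) b =
        algebraMap ℚ[X] (RatFunc ℚ) p / algebraMap ℚ[X] (RatFunc ℚ) d := by
    intro a b p d hb hd h
    rw [div_eq_div_iff (by simpa using hb) (by simpa using hd), ← map_mul, ← map_mul, h]
  refine ⟨hd, fun n => ?_, fun n => ?_⟩
  · show valueAt (algebraMap ℚ[X] (RatFunc ℚ) (toPoly x.1.1.1) /
      algebraMap ℚ[X] (RatFunc ℚ) (toPoly x.1.1.2)) n = _
    rw [key hx.1 hd0 hP, valueAt_div (hd n)]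
  · show valueAt (algebraMap ℚ[X] (RatFunc ℚ) (toPoly x.1.2.1) /
      algebraMap ℚ[X] (RatFunc ℚ) (toPoly x.1.2.2)) n = _
    rw [key hx.2.1 hd0 hQ, valueAt_div (hd n)]

theorem BaseCheck.represents (hx : x.IsValid) (h : BaseCheck x w) : Represents w.t x := by
  obtain ⟨h1, h2, h3, h4, -⟩ := h
  rw [leadSign_eq_zero_iff, toPoly_subL, toPoly_mulL, toPoly_mulL, sub_eq_zero] at h1 h2
  refine Represents.of_eq hx h1 h2 fun n => ?_
  rcases Nat.lt_or_ge n (boundL w.t.2.2 + 1) with hn | hn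
  · exact h4 n hn
  · exact evalZ_ne_zero h3 (by omega)

theorem boundL_lt_of_mem {l : List ℤ} (hl : l ∈ w.polys) : boundL l ≤ w.bigBound := by
  unfold Cert.bigBound
  generalize w.polys = L at hl
  induction L with
  | nil => exact absurd hl List.not_mem_nil
  | cons a L ih =>
    simp only [List.foldr_cons]
    rcases List.mem_cons.1 hl with rfl | h
    · omega
    · have := ih h
      omega

theorem Represents.sign_seq (h : Represents t x) (n : ℕ) :
    SignType.sign (x.seq n) = signAt t x.2 n := by
  obtain ⟨h0, h1, -⟩ := h.stateZ_spec n
  unfold signAt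
  have h0' : ((stateZ t x.2 n).2.2 : ℝ) ≠ 0 := by exact_mod_cast h0
  have hsq : 0 < ((stateZ t x.2 n).2.2 : ℝ) ^ 2 := by positivity
  have e : x.seq n = (((stateZ t x.2 n).1 * (stateZ t x.2 n).2.2 : ℤ) : ℝ) /
      ((stateZ t x.2 n).2.2 : ℝ) ^ 2 := by
    rw [h1]; push_cast; field_simp
  rw [e]
  rcases lt_trichotomy ((stateZ t x.2 n).1 * (stateZ t x.2 n).2.2) 0 with hlt | heq | hgt
  · rw [sign_neg hlt, sign_neg (div_neg_of_neg_of_pos (by exact_mod_cast hlt) hsq)]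
  · rw [heq]; simp
  · rw [sign_pos hgt, sign_pos (div_pos (by exact_mod_cast hgt) hsq)]

theorem hasUltimateSignAt_of_period {f : ℕ → ℝ} {s : List SignType} {N T : ℕ} (hT : 0 < T)
    (hs : s.length = T) (hper : ∀ n, N ≤ n → SignType.sign (f (n + T)) = SignType.sign (f n))
    (hword : ∀ i < T, s[(N + i) % T]? = some (SignType.sign (f (N + i)))) :
    HasUltimateSignAt f s N := by
  refine ⟨by rintro rfl; simp at hs; omega, fun n hn => ?_⟩
  rw [hs]
  obtain ⟨i, rfl⟩ := Nat.exists_eq_add_of_le hn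
  induction i using Nat.strong_induction_on with
  | _ i ih =>
    rcases Nat.lt_or_ge i T with h | h
    · exact hword i h
    · obtain ⟨j, rfl⟩ := Nat.exists_eq_add_of_le h
      rw [show N + (T + j) = N + j + T by ring, Nat.add_mod_right, hper _ (by omega)]
      exact ih j (by omega) (by omega)

theorem period_of_hasUltimateSignAt {f : ℕ → ℝ} {s : List SignType} {N : ℕ}
    (h : HasUltimateSignAt f s N) : 0 < s.length ∧
      ∀ n, N ≤ n → ∀ j, SignType.sign (f (n + s.length * j)) = SignType.sign (f n) := by
  obtain ⟨hs, h⟩ := h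
  refine ⟨List.length_pos_iff.2 hs, fun n hn j => ?_⟩
  have h1 := h n hn
  have h2 := h (n + s.length * j) (by omega)
  rw [Nat.add_mul_mod_self_left, h1] at h2
  exact (Option.some.inj h2).symm

/-- In terms of `n = N + k * m` the threshold depends on `n` and `b` only. Crossings found from
different starting indices can therefore be compared. -/
theorem solExceedsAt_iff {f P : ℕ → ℝ} {k b N m : ℕ} (hk : 0 < k) (hN : b < N) :
    SolExceedsAt (((N : ℝ) - b) / k) (fun m => P (N + k * m)) (fun m => f (N + k * m)) m ↔
      (1 + k / (2 * (((N + k * m : ℕ) : ℝ) - b))) * f (N + k * m + k) ^ 2 <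
        2 * (f (N + k * m + k) * f (N + k * m + 2 * k)) / P (N + k * m) := by
  unfold SolExceedsAt supRatio
  have hk' : (0 : ℝ) < k := by exact_mod_cast hk
  have hN' : (b : ℝ) < N := by exact_mod_cast hN
  have h1 : (m : ℝ) + (N - b) / k = (((N + k * m : ℕ) : ℝ) - b) / k := by
    push_cast; field_simp; ring
  have h2 : (0 : ℝ) < ((N + k * m : ℕ) : ℝ) - b := by
    push_cast
    have : (0 : ℝ) ≤ k * m := by positivity
    linarith
  beta_reduce
  rw [h1, show N + k * (m + 1) = N + k * m + k by ring,
    show N + k * (m + 2) = N + k * m + 2 * k by ring]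
  have h3 : 1 / (2 * ((((N + k * m : ℕ) : ℝ) - b) / k)) =
      k / (2 * (((N + k * m : ℕ) : ℝ) - b)) := by field_simp
  rw [h3]

theorem Represents.exceedsZ_iff (h : Represents t x) {k b n : ℕ} (hn : b < n)
    (hd : evalZ (jumpDen t k) n ≠ 0) (hp : evalZ (jumpNumP t k) n ≠ 0) :
    ExceedsZ t x.2 k b n ↔
      (1 + k / (2 * ((n : ℝ) - b))) * x.seq (n + k) ^ 2 <
        2 * (x.seq (n + k) * x.seq (n + 2 * k)) / jumpP (valueAt x.P) (valueAt x.Q) k n := by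
  obtain ⟨e1, s1, -⟩ := h.stateZ_spec (n + k)
  obtain ⟨e2, s2, -⟩ := h.stateZ_spec (n + 2 * k)
  rw [h.jumpP_eq, s1, s2]
  have hd' : (evalZ (jumpDen t k) (n : ℤ) : ℝ) ≠ 0 := by exact_mod_cast hd
  have hp' : (evalZ (jumpNumP t k) (n : ℤ) : ℝ) ≠ 0 := by exact_mod_cast hp
  have e1' : ((stateZ t x.2 (n + k)).2.2 : ℝ) ≠ 0 := by exact_mod_cast e1
  have e2' : ((stateZ t x.2 (n + 2 * k)).2.2 : ℝ) ≠ 0 := by exact_mod_cast e2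
  have hn' : (0 : ℝ) < (n : ℝ) - b := by
    have : (b : ℝ) < n := by exact_mod_cast hn
    linarith
  unfold ExceedsZ
  rw [← Int.cast_lt (R := ℝ)]
  push_cast
  set A : ℝ := (evalZ (jumpNumP t k) (n : ℤ) : ℝ)
  set B : ℝ := (evalZ (jumpDen t k) (n : ℤ) : ℝ)
  set u : ℝ := ((stateZ t x.2 (n + k)).1 : ℝ)
  set e : ℝ := ((stateZ t x.2 (n + k)).2.2 : ℝ)
  set v : ℝ := ((stateZ t x.2 (n + 2 * k)).1 : ℝ)
  set g : ℝ := ((stateZ t x.2 (n + 2 * k)).2.2 : ℝ)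
  set D : ℝ := (n : ℝ) - b
  -- Squares are used to clear denominators, because `A`, `e` and `g` may be negative.
  have hpos : 0 < 2 * D * A ^ 2 * e ^ 2 * g ^ 2 := by positivity
  rw [← mul_lt_mul_iff_of_pos_left hpos
    (b := (1 + k / (2 * D)) * (u / e) ^ 2)]
  have q1 : 2 * D * A ^ 2 * e ^ 2 * g ^ 2 * ((1 + k / (2 * D)) * (u / e) ^ 2) =
      (2 * D + k) * (A * A * (u * u * (g * g))) := by field_simp
  have q2 : 2 * D * A ^ 2 * e ^ 2 * g ^ 2 * (2 * (u / e * (v / g)) / (A / B)) =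
      4 * D * (A * B * (u * e * (v * g))) := by field_simp; ring
  rw [q1, q2]

theorem stateCode_toRat {s : ℤ × ℤ × ℤ} (h : s.2.2 ≠ 0) :
    ((RatCode.toRat (stateCode s) : ℚ) : ℝ) = (s.1 : ℝ) / (s.2.2 : ℝ) := by
  have hpos : 0 < s.2.2 * s.2.2 := mul_self_pos.2 h
  have h1 : (((s.2.2 * s.2.2).natAbs - 1 : ℕ) : ℤ) + 1 = s.2.2 * s.2.2 := by omega
  have h2 : (((s.2.2 * s.2.2).natAbs - 1 : ℕ) : ℝ) + 1 = (s.2.2 : ℝ) * s.2.2 := by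
    exact_mod_cast h1
  have h' : (s.2.2 : ℝ) ≠ 0 := by exact_mod_cast h
  unfold RatCode.toRat stateCode
  push_cast
  rw [h2]
  field_simp

/-- The query is legitimate: beyond `N` the three polynomials do not vanish, so the affine
substitution `N + k * m` gives coefficients without poles or zeros in `ℕ`. The described sequence is
the subsequence of `x.seq`. -/
theorem Represents.jumpInstance_mem_iff (h : Represents t x) {k N : ℕ}
    (hA : ∀ n : ℕ, N ≤ n → evalZ (stepL t k).1 n ≠ 0)
    (hp : ∀ n : ℕ, N ≤ n → evalZ (jumpNumP t k) n ≠ 0)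
    (hq : ∀ n : ℕ, N ≤ n → evalZ (jumpNumQ t k) n ≠ 0) :
    jumpInstance t x.2 k N ∈ MinimalityProblem ↔
      MinimalSol (fun m => jumpP (valueAt x.P) (valueAt x.Q) k (N + k * m))
        (fun m => jumpQ (valueAt x.P) (valueAt x.Q) k (N + k * m))
        (fun m => x.seq (N + k * m)) := by
  have hcast : ∀ m : ℕ, (N : ℤ) + k * m = ((N + k * m : ℕ) : ℤ) := fun m => by push_cast; ring
  have hd : ∀ n : ℕ, N ≤ n → evalZ (jumpDen t k) n ≠ 0 := fun n hn => by
    simp only [jumpDen, evalZ_mulL]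
    exact mul_ne_zero (h.stepL_spec (2 * k) n).1 (hA n hn)
  have hp' : ∀ m : ℕ, evalZ (affL (jumpNumP t k) N k) m ≠ 0 := fun m => by
    rw [evalZ_affL, hcast]; exact hp _ (by omega)
  have hq' : ∀ m : ℕ, evalZ (affL (jumpNumQ t k) N k) m ≠ 0 := fun m => by
    rw [evalZ_affL, hcast]; exact hq _ (by omega)
  have hd' : ∀ m : ℕ, evalZ (affL (jumpDen t k) N k) m ≠ 0 := fun m => by
    rw [evalZ_affL, hcast]; exact hd _ (by omega)
  set z := jumpInstance t x.2 k N with hz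
  have eP : valueAt z.P = fun m => jumpP (valueAt x.P) (valueAt x.Q) k (N + k * m) := by
    funext m
    show valueAt (algebraMap ℚ[X] (RatFunc ℚ) (toPoly (affL (jumpNumP t k) N k)) /
      algebraMap ℚ[X] (RatFunc ℚ) (toPoly (affL (jumpDen t k) N k))) m = _
    rw [valueAt_div (hd' m), h.jumpP_eq, evalZ_affL, evalZ_affL, hcast]
  have eQ : valueAt z.Q = fun m => jumpQ (valueAt x.P) (valueAt x.Q) k (N + k * m) := by
    funext m
    show valueAt (algebraMap ℚ[X] (RatFunc ℚ) (toPoly (affL (jumpNumQ t k) N k)) /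
      algebraMap ℚ[X] (RatFunc ℚ) (toPoly (affL (jumpDen t k) N k))) m = _
    rw [valueAt_div (hd' m), h.jumpQ_eq, evalZ_affL, evalZ_affL, hcast]
  have hsol := (Represents.solves x).jump_solves (k := k) (N := N)
    (fun n hn => by rw [Ne, h.stepA_eq_zero_iff]; exact hA n hn)
  have eS : z.seq = fun m => x.seq (N + k * m) := by
    refine (Represents.solves z).ext (by rw [eP, eQ]; exact hsol) ?_ ?_
    · show ((RatCode.toRat (stateCode (stateZ t x.2 N)) : ℚ) : ℝ) = x.seq (N + k * 0)
      rw [stateCode_toRat (h.stateZ_spec N).1, mul_zero, add_zero, (h.stateZ_spec N).2.1]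
    · show ((RatCode.toRat (stateCode (stateZ t x.2 (N + k))) : ℚ) : ℝ) = x.seq (N + k * 1)
      rw [stateCode_toRat (h.stateZ_spec (N + k)).1, mul_one, (h.stateZ_spec (N + k)).2.1]
  have hne : ∀ l : List ℤ, (∀ m : ℕ, evalZ l m ≠ 0) → toPoly l ≠ 0 := by
    intro l hl h0
    exact hl 0 (evalZ_eq_of (by rw [h0]; simp))
  have hvalid : z.IsValid :=
    ⟨hne _ hd', hne _ hd', noPoles_div hd', noPoles_div hd'⟩
  have hmin : IsMinimal z.P z.Q z.seq ↔ MinimalSol (valueAt z.P) (valueAt z.Q) z.seq :=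
    ⟨fun hm => hm.2, fun hm => ⟨Represents.solves z, hm⟩⟩
  rw [← eP, ← eQ, ← eS, ← hmin]
  exact ⟨fun hm => hm.2.2.2, fun hm => ⟨hvalid, noZeros_div hp' hd', noZeros_div hq' hd', hm⟩⟩

end

end HolonomicSign

/-! ### Soundness: an accepted certificate gives a correct answer. -/

namespace HolonomicSign

open Filter Topology Polynomial

section

variable {x : Instance} {w : Cert}

theorem int_mul_pos_of_sign {a b : ℤ} (ha : a ≠ 0) (h : a.sign = b.sign) : 0 < a * b := by
  rcases lt_or_gt_of_ne ha with h0 | h0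
  · rw [Int.sign_eq_neg_one_of_neg h0, eq_comm, Int.sign_eq_neg_one_iff_neg] at h
    exact mul_pos_of_neg_of_neg h0 h
  · rw [Int.sign_eq_one_of_pos h0, eq_comm, Int.sign_eq_one_iff_pos] at h
    exact mul_pos h0 h

theorem Cert.evalZ_ne_zero (hN : w.bigBound < w.N) {l : List ℤ} (hl : l ∈ w.polys)
    (h : leadSign l ≠ 0) {n : ℕ} (hn : w.N ≤ n) : evalZ l n ≠ 0 :=
  HolonomicSign.evalZ_ne_zero h (by have := boundL_lt_of_mem hl; omega)

theorem Cert.sign_evalZ (hN : w.bigBound < w.N) {l : List ℤ} (hl : l ∈ w.polys)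
    {n : ℕ} (hn : w.N ≤ n) : (evalZ l n).sign = leadSign l :=
  HolonomicSign.sign_evalZ (by have := boundL_lt_of_mem hl; omega)

theorem Cert.evalZ_nonneg (hN : w.bigBound < w.N) {l : List ℤ} (hl : l ∈ w.polys)
    (h : leadSign l ≠ -1) {n : ℕ} (hn : w.N ≤ n) : 0 ≤ evalZ l n :=
  HolonomicSign.evalZ_nonneg h (by have := boundL_lt_of_mem hl; omega)

theorem NondegCheck.facts (h : NondegCheck w) (hrep : Represents w.t x)
    (hN : w.bigBound < w.N) {n : ℕ} (hn : w.N ≤ n) :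
    evalZ (stepL w.t w.k).1 n ≠ 0 ∧ evalZ (jumpNumP w.t w.k) n ≠ 0 ∧
    evalZ (jumpNumQ w.t w.k) n ≠ 0 ∧ evalZ (jumpDen w.t w.k) n ≠ 0 ∧
    evalZ (coeffNum w.t w.k) n ≠ 0 ∧ evalZ (coeffDen w.t w.k) n ≠ 0 ∧
    valueAt x.Q n ≠ 0 := by
  obtain ⟨hA, hq, hU, hV⟩ := h
  have A := Cert.evalZ_ne_zero hN (by simp [Cert.polys]) hA hn
  have q := Cert.evalZ_ne_zero hN (by simp [Cert.polys]) hq hn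
  have U := Cert.evalZ_ne_zero hN (by simp [Cert.polys]) hU hn
  have V := Cert.evalZ_ne_zero hN (by simp [Cert.polys]) hV hn
  refine ⟨A, ?_, ?_, ?_, U, V, ?_⟩
  · intro h0; apply V; rw [coeffDen, evalZ_mulL, h0, mul_zero]
  · refine Cert.evalZ_ne_zero hN (by simp [Cert.polys]) (leadSign_ne_zero
      ⟨(w.k : ℤ) + 1 * n, fun h0 => U ?_⟩) hn
    rw [coeffNum, evalZ_scaleL, evalZ_mulL, evalZ_affL, h0]; ring
  · rw [jumpDen, evalZ_mulL]
    exact mul_ne_zero (hrep.stepL_spec _ _).1 A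
  · rw [hrep.valueQ]
    exact div_ne_zero (by exact_mod_cast q) (by exact_mod_cast hrep.ne_zero n)

/-- The recurrence for the terms of index `n0, n0 + k, …`. -/
theorem NondegCheck.jump (h : NondegCheck w) (hrep : Represents w.t x) (hN : w.bigBound < w.N)
    {n0 : ℕ} (hn0 : w.N ≤ n0) :
    Solves (fun m => jumpP (valueAt x.P) (valueAt x.Q) w.k (n0 + w.k * m))
      (fun m => jumpQ (valueAt x.P) (valueAt x.Q) w.k (n0 + w.k * m))
      (fun m => x.seq (n0 + w.k * m)) ∧
    (∀ m, 0 < jumpP (valueAt x.P) (valueAt x.Q) w.k (n0 + w.k * m) *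
      jumpP (valueAt x.P) (valueAt x.Q) w.k (n0 + w.k * (m + 1))) ∧
    (∀ m, jumpQ (valueAt x.P) (valueAt x.Q) w.k (n0 + w.k * m) ≠ 0) ∧
    (∀ m, normCoeff (fun m => jumpP (valueAt x.P) (valueAt x.Q) w.k (n0 + w.k * m))
      (fun m => jumpQ (valueAt x.P) (valueAt x.Q) w.k (n0 + w.k * m)) m =
      (evalZ (coeffNum w.t w.k) ((n0 + w.k * m : ℕ) : ℤ) : ℝ) /
        (evalZ (coeffDen w.t w.k) ((n0 + w.k * m : ℕ) : ℤ) : ℝ)) := by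
  have F := fun n hn => h.facts (n := n) hrep hN hn
  refine ⟨?_, ?_, ?_, ?_⟩
  · exact (Represents.solves x).jump_solves fun n hn => by
      rw [Ne, hrep.stepA_eq_zero_iff]; exact (F n (by omega)).1
  · intro m
    have g1 := F (n0 + w.k * m) (by omega)
    have g2 := F (n0 + w.k * (m + 1)) (by omega)
    rw [hrep.jumpP_eq, hrep.jumpP_eq, div_mul_div_comm]
    have a1 := int_mul_pos_of_sign g1.2.1
      ((Cert.sign_evalZ hN (by simp [Cert.polys]) (n := n0 + w.k * m) (by omega)).trans
      (Cert.sign_evalZ hN (by simp [Cert.polys]) (n := n0 + w.k * (m + 1)) (by omega)).symm)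
    have a2 := int_mul_pos_of_sign g1.2.2.2.1
      ((Cert.sign_evalZ hN (by simp [Cert.polys]) (n := n0 + w.k * m) (by omega)).trans
      (Cert.sign_evalZ hN (by simp [Cert.polys]) (n := n0 + w.k * (m + 1)) (by omega)).symm)
    exact div_pos (by exact_mod_cast a1) (by exact_mod_cast a2)
  · intro m
    have g1 := F (n0 + w.k * m) (by omega)
    rw [hrep.jumpQ_eq]
    exact div_ne_zero (by exact_mod_cast g1.2.2.1) (by exact_mod_cast g1.2.2.2.1)
  · intro m
    rw [← hrep.jumpCoeff_eq (k := w.k) (n := n0 + w.k * m) (F _ (by omega)).2.2.2.1]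
    simp only [normCoeff, jumpCoeff]
    rw [show n0 + w.k * (m + 1) = n0 + w.k * m + w.k by ring]

/-- Since `stepA ≠ 0`, vanishing at `n0` and `n0 + k` forces vanishing at `n0 + 1`. The recurrence,
run backwards with `Q ≠ 0`, carries the two zeros down to `N`. -/
theorem Solves.jump_nontrivial (h : NondegCheck w) (hrep : Represents w.t x)
    (hN : w.bigBound < w.N) {n0 : ℕ} (hn0 : w.N ≤ n0)
    (h0 : x.seq n0 = 0) (h1 : x.seq (n0 + w.k) = 0) : x.seq w.N = 0 ∧ x.seq (w.N + 1) = 0 := by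
  have A := (h.facts hrep hN hn0).1
  rw [Ne, ← hrep.stepA_eq_zero_iff] at A
  have h2 := (Represents.solves x).step w.k n0
  rw [h1, h0, mul_zero, add_zero, eq_comm, mul_eq_zero] at h2
  exact (Represents.solves x).eq_zero (n := w.N) (fun i hi => (h.facts hrep hN hi).2.2.2.2.2.2) hn0
    h0 (h2.resolve_left A)

theorem evalZ_nonoscPoly (n : ℤ) : evalZ w.nonoscPoly n =
    (w.k : ℤ) * w.k * (evalZ (coeffDen w.t w.k) n * evalZ (coeffDen w.t w.k) n) -
    4 * ((n - w.b) * (n + w.k - w.b) *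
      ((evalZ (coeffNum w.t w.k) n - evalZ (coeffDen w.t w.k) n) * evalZ (coeffDen w.t w.k) n)) := by
  simp only [Cert.nonoscPoly, evalZ_subL, evalZ_scaleL, evalZ_mulL, evalZ_cons, evalZ_nil]
  ring

theorem evalZ_oscPoly (n : ℤ) : evalZ w.oscPoly n =
    4 * w.M * (n * n *
      ((evalZ (coeffNum w.t w.k) n - evalZ (coeffDen w.t w.k) n) * evalZ (coeffDen w.t w.k) n)) -
    (w.M + 4) * ((w.k : ℤ) * w.k) *
      (evalZ (coeffDen w.t w.k) n * evalZ (coeffDen w.t w.k) n) := by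
  simp only [Cert.oscPoly, evalZ_subL, evalZ_scaleL, evalZ_mulL, evalZ_cons, evalZ_nil]
  ring

theorem evalZ_limPoly (n : ℤ) : evalZ w.limPoly n =
    (w.M : ℤ) * w.M * ((w.limDen : ℤ) * w.limDen) *
      (evalZ (coeffDen w.t w.k) n * evalZ (coeffDen w.t w.k) n) -
    n * n * ((w.limDen * evalZ (coeffNum w.t w.k) n - w.limNum * evalZ (coeffDen w.t w.k) n) *
      (w.limDen * evalZ (coeffNum w.t w.k) n - w.limNum * evalZ (coeffDen w.t w.k) n)) := by
  simp only [Cert.limPoly, Cert.limDiff, evalZ_subL, evalZ_scaleL, evalZ_mulL, evalZ_cons,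
    evalZ_nil]
  ring

theorem nonosc_iff {n b k : ℕ} {u v : ℤ} (hv : v ≠ 0) (hn : b < n) :
    (u : ℝ) / v ≤ 1 + (k : ℝ) ^ 2 / (4 * ((n : ℝ) - b) * ((n : ℝ) + k - b)) ↔
      0 ≤ (k : ℤ) * k * (v * v) - 4 * (((n : ℤ) - b) * (n + k - b) * ((u - v) * v)) := by
  have hb : (b : ℝ) < n := by exact_mod_cast hn
  have h1 : (0 : ℝ) < (n : ℝ) - b := by linarith
  have h2 : (0 : ℝ) < (n : ℝ) + k - b := by
    have : (0 : ℝ) ≤ k := Nat.cast_nonneg k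
    linarith
  have hv' : (v : ℝ) ≠ 0 := by exact_mod_cast hv
  have e : 1 + (k : ℝ) ^ 2 / (4 * ((n : ℝ) - b) * ((n : ℝ) + k - b)) - u / v =
      (((k : ℤ) * k * (v * v) - 4 * (((n : ℤ) - b) * (n + k - b) * ((u - v) * v)) : ℤ) : ℝ) /
        (4 * ((n : ℝ) - b) * ((n : ℝ) + k - b) * v ^ 2) := by
    push_cast; field_simp; ring
  rw [← sub_nonneg, e, le_div_iff₀ (by positivity), zero_mul]
  exact_mod_cast Iff.rfl

theorem osc_iff {n M k : ℕ} {u v : ℤ} (hv : v ≠ 0) (hn : 0 < n) (hM : 1 ≤ M) :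
    1 + (1 / 4 + 1 / (M : ℝ)) * k ^ 2 / (n : ℝ) ^ 2 ≤ (u : ℝ) / v ↔
      0 ≤ 4 * (M : ℤ) * ((n : ℤ) * n * ((u - v) * v)) - (M + 4) * ((k : ℤ) * k) * (v * v) := by
  have h1 : (0 : ℝ) < (n : ℝ) := by exact_mod_cast hn
  have h2 : (0 : ℝ) < (M : ℝ) := by exact_mod_cast hM
  have hv' : (v : ℝ) ≠ 0 := by exact_mod_cast hv
  have e : (u : ℝ) / v - (1 + (1 / 4 + 1 / (M : ℝ)) * k ^ 2 / (n : ℝ) ^ 2) =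
      ((4 * (M : ℤ) * ((n : ℤ) * n * ((u - v) * v)) - (M + 4) * ((k : ℤ) * k) * (v * v) : ℤ) : ℝ) /
        (4 * M * n ^ 2 * v ^ 2) := by
    push_cast; field_simp; ring
  rw [← sub_nonneg, e, le_div_iff₀ (by positivity), zero_mul]
  exact_mod_cast Iff.rfl

theorem lim_iff {n M a d : ℕ} {u v : ℤ} (hv : v ≠ 0) (hn : 0 < n) (hd : 1 ≤ d) :
    |(u : ℝ) / v - (a : ℝ) / d| * n ≤ M ↔
      0 ≤ (M : ℤ) * M * ((d : ℤ) * d) * (v * v) -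
        (n : ℤ) * n * ((d * u - a * v) * (d * u - a * v)) := by
  have h1 : (0 : ℝ) < (n : ℝ) := by exact_mod_cast hn
  have h2 : (0 : ℝ) < (d : ℝ) := by exact_mod_cast hd
  have hv' : (v : ℝ) ≠ 0 := by exact_mod_cast hv
  have h3 : |(u : ℝ) / v - (a : ℝ) / d| * n = |((u : ℝ) / v - (a : ℝ) / d) * n| := by
    rw [abs_mul, abs_of_pos h1]
  have e : (M : ℝ) ^ 2 - (((u : ℝ) / v - (a : ℝ) / d) * n) ^ 2 =
      (((M : ℤ) * M * ((d : ℤ) * d) * (v * v) -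
        (n : ℤ) * n * ((d * u - a * v) * (d * u - a * v)) : ℤ) : ℝ) / (d ^ 2 * v ^ 2) := by
    push_cast; field_simp
  rw [h3, ← sq_le_sq₀ (abs_nonneg _) (Nat.cast_nonneg M), sq_abs, ← sub_nonneg, e,
    le_div_iff₀ (by positivity), zero_mul]
  exact_mod_cast Iff.rfl

/-- The substitution `n = n0 + k * m` turns the bound `k² / (4 (n - b) (n + k - b))` into the one of
`SubKneser` with `x = (n0 - b) / k`. The condition `b + k ≤ N` is what makes `x ≥ 1`. -/
theorem subKneser_jump (h : NondegCheck w) (hrep : Represents w.t x) (hN : w.bigBound < w.N)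
    (hk : 1 ≤ w.k) (hpos : leadSign (coeffNum w.t w.k) * leadSign (coeffDen w.t w.k) = 1)
    (hnon : leadSign w.nonoscPoly ≠ -1) (hb : w.b + w.k ≤ w.N) {n0 : ℕ} (hn0 : w.N ≤ n0) :
    1 ≤ ((n0 : ℝ) - w.b) / w.k ∧ SubKneser (((n0 : ℝ) - w.b) / w.k)
      (normCoeff (fun m => jumpP (valueAt x.P) (valueAt x.Q) w.k (n0 + w.k * m))
      (fun m => jumpQ (valueAt x.P) (valueAt x.Q) w.k (n0 + w.k * m))) := by
  have hk' : (0 : ℝ) < w.k := by exact_mod_cast hk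
  have hb' : (w.b : ℝ) + w.k ≤ n0 := by exact_mod_cast hb.trans hn0
  refine ⟨by rw [le_div_iff₀ hk']; linarith, fun m => ?_⟩
  rw [(h.jump hrep hN hn0).2.2.2 m]
  set n := n0 + w.k * m with hn
  have F := h.facts hrep hN (n := n) (by omega)
  constructor
  · have e1 := Cert.sign_evalZ hN (w := w) (l := coeffNum w.t w.k) (by simp [Cert.polys])
      (n := n) (by omega)
    have e2 := Cert.sign_evalZ hN (w := w) (l := coeffDen w.t w.k) (by simp [Cert.polys])
      (n := n) (by omega)
    have e3 : (evalZ (coeffNum w.t w.k) n).sign = (evalZ (coeffDen w.t w.k) n).sign := by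
      rw [e1, e2]
      rcases Int.mul_eq_one_iff_eq_one_or_neg_one.1 hpos with ⟨a, b⟩ | ⟨a, b⟩ <;> rw [a, b]
    have := int_mul_pos_of_sign F.2.2.2.2.1 e3
    rcases pos_and_pos_or_neg_and_neg_of_mul_pos this with ⟨a, b⟩ | ⟨a, b⟩
    · exact div_pos (by exact_mod_cast a) (by exact_mod_cast b)
    · exact div_pos_of_neg_of_neg (by exact_mod_cast a) (by exact_mod_cast b)
  · have e1 := Cert.evalZ_nonneg hN (w := w) (by simp [Cert.polys]) hnon (n := n) (by omega)
    rw [evalZ_nonoscPoly] at e1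
    have := (nonosc_iff (k := w.k) F.2.2.2.2.2.1 (by omega : w.b < n)).2 e1
    refine this.trans (le_of_eq ?_)
    have hnr : (n : ℝ) = n0 + w.k * m := by rw [hn]; push_cast; ring
    have p1 : (0 : ℝ) < (n : ℝ) - w.b := by
      rw [hnr]; have : (0 : ℝ) ≤ w.k * m := by positivity
      linarith
    have q1 : (m : ℝ) + (n0 - w.b) / w.k = (n - w.b) / w.k := by
      rw [hnr]; field_simp; ring
    have q2 : (m : ℝ) + 1 + (n0 - w.b) / w.k = (n + w.k - w.b) / w.k := by
      rw [hnr]; field_simp; ring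
    have p2 : (0 : ℝ) < (n : ℝ) + w.k - w.b := by linarith
    rw [q1, q2]
    field_simp

/-- Each residue class is either identically zero from its start or falls under
`mul_pos_of_minimal_or_exceeds`. Signs then repeat after two jumps of length `k`. -/
theorem NonoscCheck.period {bits : List Bool} (h : NonoscCheck x w bits)
    (hrep : Represents w.t x) (hN : w.bigBound < w.N) (hk : 1 ≤ w.k) (hk6 : w.k ≤ 6)
    (hbits : ∀ i < 6, bits.getD i false = true →
      jumpInstance w.t x.2 w.k (w.N + i) ∈ MinimalityProblem) (n : ℕ) (hn : w.N + w.k ≤ n) :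
    SignType.sign (x.seq (n + 2 * w.k)) = SignType.sign (x.seq n) := by
  obtain ⟨hnd, hpos, hnon, hb, hres⟩ := h
  set i := (n - w.N) % w.k with hi
  have hik : i < w.k := Nat.mod_lt _ hk
  -- The first term of each class is excluded, as normalization drops it. This is why the answer
  -- uses `N + k` rather than `N`.
  obtain ⟨m, hm⟩ : ∃ m, n = w.N + i + w.k * (m + 1) := by
    have h1 : 1 ≤ (n - w.N) / w.k := (Nat.one_le_div_iff hk).2 (by omega)
    refine ⟨(n - w.N) / w.k - 1, ?_⟩
    rw [Nat.sub_add_cancel h1]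
    have := Nat.mod_add_div (n - w.N) w.k
    omega
  set n0 := w.N + i with hn0
  have hn0N : w.N ≤ n0 := by omega
  obtain ⟨hs, hP, hQ, -⟩ := hnd.jump hrep hN hn0N
  obtain ⟨hx1, hsk⟩ := subKneser_jump hnd hrep hN hk hpos hnon hb hn0N
  have e1 : n0 + w.k * (m + 3) = n + 2 * w.k := by rw [hm]; ring
  by_cases htriv : x.seq n0 = 0 ∧ x.seq (n0 + w.k) = 0
  · have hz := hs.eq_zero_forward (n := 0) (m := m + 1) (by omega) (by simpa using htriv.1)
      (by simpa using htriv.2)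
    have hz2 := hs.eq_zero_forward (n := 0) (m := m + 3) (by omega) (by simpa using htriv.1)
      (by simpa using htriv.2)
    rw [e1] at hz2
    rw [← hm] at hz
    rw [hz.1, hz2.1]
  · have hor : MinimalSol (fun m => jumpP (valueAt x.P) (valueAt x.Q) w.k (n0 + w.k * m))
        (fun m => jumpQ (valueAt x.P) (valueAt x.Q) w.k (n0 + w.k * m))
        (fun m => x.seq (n0 + w.k * m)) ∨ SolExceedsAt (((n0 : ℝ) - w.b) / w.k)
        (fun m => jumpP (valueAt x.P) (valueAt x.Q) w.k (n0 + w.k * m))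
        (fun m => x.seq (n0 + w.k * m)) 0 := by
      rcases hres i hik with h1 | h1
      · left
        refine (hrep.jumpInstance_mem_iff ?_ ?_ ?_).1 (hbits i (by omega) h1)
        · exact fun n hn => (hnd.facts hrep hN (by omega)).1
        · exact fun n hn => (hnd.facts hrep hN (by omega)).2.1
        · exact fun n hn => (hnd.facts hrep hN (by omega)).2.2.1
      · right
        have F := hnd.facts hrep hN hn0N
        rw [solExceedsAt_iff (f := x.seq) (P := jumpP (valueAt x.P) (valueAt x.Q) w.k) hk
          (by omega : w.b < n0), mul_zero, add_zero]
        exact (hrep.exceedsZ_iff (by omega) F.2.2.2.1 F.2.1).1 h1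
    have := mul_pos_of_minimal_or_exceeds hx1 hP hQ hsk hs (by simpa using htriv) hor m
    rw [← hm, e1] at this
    rcases pos_and_pos_or_neg_and_neg_of_mul_pos this with ⟨a, b⟩ | ⟨a, b⟩
    · rw [sign_pos a, sign_pos b]
    · rw [sign_neg a, sign_neg b]

/-- An ultimate sign of `x.seq` would induce one on every progression, so it suffices to refute it
on the class of `N`. -/
theorem OscCheck.no_sign (h : OscCheck x w) (hrep : Represents w.t x) (hN : w.bigBound < w.N)
    (hk : 1 ≤ w.k) (s : List SignType) (N' : ℕ) : ¬ HasUltimateSignAt x.seq s N' := by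
  intro hsgn
  obtain ⟨hnd, hnz, hd, hlim, hcase⟩ := h
  obtain ⟨hT, hper⟩ := period_of_hasUltimateSignAt hsgn
  have hk' : (0 : ℝ) < w.k := by exact_mod_cast hk
  obtain ⟨hs, hP, hQ, hc⟩ := hnd.jump hrep hN le_rfl
  set P' := fun m => jumpP (valueAt x.P) (valueAt x.Q) w.k (w.N + w.k * m)
  set Q' := fun m => jumpQ (valueAt x.P) (valueAt x.Q) w.k (w.N + w.k * m)
  have hne : ¬ (x.seq (w.N + w.k * 0) = 0 ∧ x.seq (w.N + w.k * 1) = 0) := by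
    rintro ⟨h0, h1⟩
    rw [mul_zero, add_zero] at h0
    rw [mul_one] at h1
    obtain ⟨a, b⟩ := Solves.jump_nontrivial hnd hrep hN le_rfl h0 h1
    obtain ⟨e0, e1, e2⟩ := hrep.stateZ_spec w.N
    have e0' : ((stateZ w.t x.2 w.N).2.2 : ℝ) ≠ 0 := by exact_mod_cast e0
    rw [a, eq_comm, div_eq_zero_iff] at e1
    rw [b, eq_comm, div_eq_zero_iff] at e2
    exact hnz ⟨by exact_mod_cast e1.resolve_right e0', by exact_mod_cast e2.resolve_right e0'⟩
  have hN0 : 0 < w.N := by omega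
  have htend : Tendsto (normCoeff P' Q') atTop (𝓝 ((w.limNum : ℝ) / w.limDen)) := by
    rw [tendsto_iff_dist_tendsto_zero]
    have hz : Tendsto (fun m : ℕ => (w.M : ℝ) / m) atTop (𝓝 0) :=
      tendsto_const_div_atTop_nhds_zero_nat _
    refine squeeze_zero' (Eventually.of_forall fun _ => dist_nonneg) ?_ hz
    filter_upwards [eventually_gt_atTop 0] with m hm
    have hm' : (0 : ℝ) < m := by exact_mod_cast hm
    rw [Real.dist_eq, hc m, le_div_iff₀ hm']
    have F := hnd.facts hrep hN (n := w.N + w.k * m) (by omega)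
    have e1 := Cert.evalZ_nonneg hN (w := w) (by simp [Cert.polys]) hlim (n := w.N + w.k * m)
      (by omega)
    rw [evalZ_limPoly] at e1
    have := (lim_iff F.2.2.2.2.2.1 (by omega : 0 < w.N + w.k * m) hd).2 e1
    refine le_trans (mul_le_mul_of_nonneg_left ?_ (abs_nonneg _)) this
    have : m ≤ w.N + w.k * m := (Nat.le_mul_of_pos_left m hk).trans (Nat.le_add_left _ _)
    exact_mod_cast this
  -- The word length remains a period along the progression: `s.length` jumps of length `k` are `k`
  -- full words.
  have hper' : ∀ m, N' ≤ m → SignType.sign (x.seq (w.N + w.k * (m + s.length))) =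
      SignType.sign (x.seq (w.N + w.k * m)) := by
    intro m hm
    have h1 : m ≤ w.k * m := Nat.le_mul_of_pos_left m hk
    have := hper (w.N + w.k * m) (by omega) w.k
    rwa [show w.N + w.k * (m + s.length) = w.N + w.k * m + s.length * w.k by ring]
  have hdR : (0 : ℝ) < w.limDen := by exact_mod_cast hd
  rcases hcase with ⟨h1, hM, hosc⟩ | ⟨h1, h4, h2, h3⟩
  · have hM' : (0 : ℝ) < w.M := by exact_mod_cast hM
    rw [h1, div_self hdR.ne'] at htend
    refine no_period_of_slow_oscillation (x := (w.N : ℝ) / w.k) (γ := 1 / 4 + 1 / w.M) hP hQ hs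
      hne (div_pos (by exact_mod_cast hN0) hk') (by have := one_div_pos.2 hM'; linarith)
      htend (fun m => ?_) hT hper'
    rw [hc m]
    have F := hnd.facts hrep hN (n := w.N + w.k * m) (by omega)
    have e1 := Cert.evalZ_nonneg hN (w := w) (by simp [Cert.polys]) hosc (n := w.N + w.k * m)
      (by omega)
    rw [evalZ_oscPoly] at e1
    refine le_trans (le_of_eq ?_) ((osc_iff F.2.2.2.2.2.1 (by omega : 0 < w.N + w.k * m) hM).2 e1)
    have : (m : ℝ) + w.N / w.k = (w.N + w.k * m : ℕ) / w.k := by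
      push_cast; field_simp; ring
    rw [this, div_pow, div_div_eq_mul_div]
  · have hdQ : (0 : ℚ) < w.limDen := by exact_mod_cast hd
    refine no_period_of_elliptic (L := (w.limNum : ℚ) / w.limDen) hP hQ hs hne ?_ ?_ ?_ ?_
      (by push_cast; exact htend) hT hper'
    · rw [one_lt_div hdQ]; exact_mod_cast h1
    · rw [Ne, div_eq_iff hdQ.ne']; exact_mod_cast h4
    · rw [Ne, div_eq_iff hdQ.ne']; exact_mod_cast h2
    · rw [Ne, ← mul_div_assoc, div_eq_iff hdQ.ne']; exact_mod_cast h3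

/-- The square of a sign need not be `1`, as it may be `0`. The extra factor `a` absorbs that case.
-/
theorem signType_cube (a b : SignType) : a * (a * (a * b)) = a * b := by
  cases a <;> cases b <;> rfl

theorem Check.sound {bits : List Bool} (hx : x.IsValid) (h : Check x w bits)
    (hbits : ∀ i < 6, bits.getD i false = true →
      jumpInstance w.t x.2 w.k (w.N + i) ∈ MinimalityProblem) :
    UltimateSignProblem x w.answer := by
  obtain ⟨hbase, hrest⟩ := h
  have hrep := hbase.represents hx
  obtain ⟨-, -, -, -, hk, hk6, hN⟩ := hbase
  have hsol := Represents.solves x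
  rcases hrest with ⟨⟨hlen, hword⟩, hmode⟩ | ⟨hmode, hosc⟩
  · have hper : w.mode ≤ 3 ∧ ∀ n, w.N + w.k ≤ n →
        SignType.sign (x.seq (n + 2 * w.k)) = SignType.sign (x.seq n) := by
      rcases hmode with ⟨hm, hz⟩ | ⟨hm, hp, hq⟩ | ⟨hm, hA⟩ | ⟨hm, hnon⟩
      · refine ⟨by omega, fun n hn => ?_⟩
        obtain ⟨-, e1, e2⟩ := hrep.stateZ_spec w.N
        rw [hz.1, Int.cast_zero, zero_div] at e1
        rw [hz.2, Int.cast_zero, zero_div] at e2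
        rw [(hsol.eq_zero_forward (n := w.N) (m := n) (by omega) e1 e2).1,
          (hsol.eq_zero_forward (n := w.N) (m := n + 2 * w.k) (by omega) e1 e2).1]
      · refine ⟨by omega, fun n hn => ?_⟩
        have hstep : ∀ n, w.N ≤ n → 0 < valueAt x.P n * valueAt x.P (n + 1) := by
          intro n hn
          rw [hrep.valueP, hrep.valueP, div_mul_div_comm]
          have a1 := int_mul_pos_of_sign (Cert.evalZ_ne_zero hN (by simp [Cert.polys]) hp hn)
            ((Cert.sign_evalZ hN (by simp [Cert.polys]) hn).trans
            (Cert.sign_evalZ hN (by simp [Cert.polys]) (n := n + 1) (by omega)).symm)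
          have a2 := int_mul_pos_of_sign (hrep.ne_zero n)
            ((Cert.sign_evalZ hN (by simp [Cert.polys]) hn).trans
            (Cert.sign_evalZ hN (by simp [Cert.polys]) (n := n + 1) (by omega)).symm)
          exact div_pos (by exact_mod_cast a1) (by exact_mod_cast a2)
        have h1 : ∀ n, w.N ≤ n → x.seq (n + 2) = valueAt x.P n * x.seq (n + 1) := by
          intro n hn
          rw [hsol n, hrep.valueQ, evalZ_eq_zero_of_leadSign hq]
          simp
        have h2 : ∀ n, w.N + 1 ≤ n → SignType.sign (x.seq (n + 2)) = SignType.sign (x.seq n) := by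
          intro n hn
          obtain ⟨m, rfl⟩ := Nat.exists_eq_add_of_le hn
          rw [show w.N + 1 + m + 2 = w.N + m + 1 + 2 by ring, h1 _ (by omega),
            show w.N + m + 1 + 1 = w.N + m + 2 by ring, h1 _ (by omega),
            show w.N + 1 + m = w.N + m + 1 by ring, ← mul_assoc, sign_mul,
            mul_comm (valueAt x.P _), sign_pos (hstep (w.N + m) (by omega)), one_mul]
        have h3 : ∀ j, SignType.sign (x.seq (n + 2 * j)) = SignType.sign (x.seq n) := by
          intro j
          induction j with
          | zero => rfl
          | succ j ih => rw [show n + 2 * (j + 1) = n + 2 * j + 2 by ring, h2 _ (by omega), ih]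
        exact h3 w.k
      · refine ⟨by omega, fun n hn => ?_⟩
        -- With `stepA = 0` one jump multiplies `f n` by `stepB`, whose sign is constant from `N` on
        -- and hence read off at `N`.
        have h1 : ∀ n, w.N ≤ n → SignType.sign (x.seq (n + w.k)) =
            SignType.sign (stepB (valueAt x.P) (valueAt x.Q) w.k w.N) *
              SignType.sign (x.seq n) := by
          intro n hn
          have hA0 : stepA (valueAt x.P) (valueAt x.Q) w.k n = 0 := by
            rw [hrep.stepA_eq_zero_iff]; exact evalZ_eq_zero_of_leadSign hA _
          rw [hsol.step, hA0, zero_mul, zero_add, sign_mul]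
          congr 1
          have hb : (evalZ (stepL w.t w.k).2.1 n).sign = (evalZ (stepL w.t w.k).2.1 w.N).sign :=
            (Cert.sign_evalZ hN (by simp [Cert.polys]) hn).trans
            (Cert.sign_evalZ hN (by simp [Cert.polys]) le_rfl).symm
          have hd : (evalZ (stepL w.t w.k).2.2 n).sign = (evalZ (stepL w.t w.k).2.2 w.N).sign :=
            (Cert.sign_evalZ hN (by simp [Cert.polys]) hn).trans
            (Cert.sign_evalZ hN (by simp [Cert.polys]) le_rfl).symm
          obtain ⟨d1, -, e1⟩ := hrep.stepL_spec w.k n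
          obtain ⟨d2, -, e2⟩ := hrep.stepL_spec w.k w.N
          rw [e1, e2]
          have hdd := int_mul_pos_of_sign d1 hd
          have hdd' : (0 : ℝ) < (evalZ (stepL w.t w.k).2.2 n : ℝ) *
            (evalZ (stepL w.t w.k).2.2 w.N : ℝ) := by exact_mod_cast hdd
          by_cases hb0 : evalZ (stepL w.t w.k).2.1 n = 0
          · rw [hb0, Int.sign_zero, eq_comm, Int.sign_eq_zero_iff_zero] at hb
            rw [hb0, hb]; simp
          · have hbb := int_mul_pos_of_sign hb0 hb
            have hbb' : (0 : ℝ) < (evalZ (stepL w.t w.k).2.1 n : ℝ) *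
              (evalZ (stepL w.t w.k).2.1 w.N : ℝ) := by exact_mod_cast hbb
            have := div_pos hbb' hdd'
            rw [← div_mul_div_comm] at this
            rcases pos_and_pos_or_neg_and_neg_of_mul_pos this with ⟨a, b⟩ | ⟨a, b⟩
            · rw [sign_pos a, sign_pos b]
            · rw [sign_neg a, sign_neg b]
        -- Starting at `N + k`, one factor of the sign of `stepB` is already present, so two more
        -- change nothing even if it is `0`.
        obtain ⟨m, rfl⟩ := Nat.exists_eq_add_of_le hn
        rw [show w.N + w.k + m = w.N + m + w.k by ring,
          show w.N + m + w.k + 2 * w.k = w.N + m + w.k + w.k + w.k by ring,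
          h1 _ (by omega), h1 _ (by omega), h1 (w.N + m) (by omega), signType_cube]
      · exact ⟨by omega, hnon.period hrep hN hk hk6 hbits⟩
    unfold UltimateSignProblem Cert.answer
    rw [if_pos hper.1]
    exact hasUltimateSignAt_of_period (by omega) hlen hper.2 fun i hi => by
      rw [hword i hi, hrep.sign_seq]
  · unfold UltimateSignProblem Cert.answer
    rw [if_neg (by omega)]
    exact hosc.no_sign hrep hN hk

end

end HolonomicSign

/-! ### Completeness: every valid instance has an accepted certificate. -/

namespace HolonomicSign

open Filter Topology Polynomial

section

variable {x : Instance} {w : Cert} {t : RecCode}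

/-- The signs of one period of length `2 * k`, starting at the index `N + k`. -/
noncomputable def signWord (t : RecCode) (v : RatCode × RatCode) (k N : ℕ) : List SignType :=
  (List.range (2 * k)).map fun j =>
    signAt t v (N + k + (j + 2 * k - (N + k) % (2 * k)) % (2 * k))

/-- Entry `j` of the word is the sign at the unique index in `[N + k, N + 3k)` congruent to `j`
modulo `2k`. The definition adds `2 * k` before subtracting so that truncated subtraction does no
harm. -/
theorem getElem?_signWord (t : RecCode) (v : RatCode × RatCode) {k N i : ℕ} (hi : i < 2 * k) :
    (signWord t v k N)[(N + k + i) % (2 * k)]? = some (signAt t v (N + k + i)) := by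
  have h0 : 0 < 2 * k := by omega
  have h1 : (N + k + i) % (2 * k) < 2 * k := Nat.mod_lt _ h0
  rw [signWord, List.getElem?_map, List.getElem?_range h1, Option.map_some]
  have h2 : (N + k) % (2 * k) < 2 * k := Nat.mod_lt _ h0
  congr 3
  rw [Nat.add_mod, Nat.mod_eq_of_lt hi]
  generalize (N + k) % (2 * k) = r at h2
  rcases Nat.lt_or_ge (r + i) (2 * k) with h | h
  · rw [Nat.mod_eq_of_lt h, show r + i + 2 * k - r = i + 2 * k by omega, Nat.add_mod_right,
      Nat.mod_eq_of_lt hi]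
  · rw [Nat.mod_eq_sub_mod h, Nat.mod_eq_of_lt (by omega : r + i - 2 * k < 2 * k),
      show r + i - 2 * k + 2 * k - r = i by omega, Nat.mod_eq_of_lt hi]

noncomputable def mkCert (t : RecCode) (v : RatCode × RatCode) (k N b M ln ld mode : ℕ) : Cert :=
  (t, (k, N, b, M), (ln, ld, mode), signWord t v k N)

/-- The part of `BaseCheck` that concerns only the code of the recurrence. -/
def CodeFor (x : Instance) (t : RecCode) : Prop :=
  leadSign (subL (mulL t.1 x.1.1.2) (mulL x.1.1.1 t.2.2)) = 0 ∧
  leadSign (subL (mulL t.2.1 x.1.2.2) (mulL x.1.2.1 t.2.2)) = 0 ∧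
  leadSign t.2.2 ≠ 0 ∧ ∀ n : ℕ, evalZ t.2.2 n ≠ 0

theorem exists_codeFor (hx : x.IsValid) : ∃ t, CodeFor x t := by
  obtain ⟨h1, h2, hP, hQ⟩ := hx
  obtain ⟨p, q, d, hd, ep, eq⟩ := exists_common_denominator hP hQ
  have key : ∀ {a b p : List ℤ}, toPoly b ≠ 0 →
      RatFuncCode.toRatFunc (a, b) * algebraMap ℚ[X] (RatFunc ℚ) (toPoly d) =
        algebraMap ℚ[X] (RatFunc ℚ) (toPoly p) →
      leadSign (subL (mulL p b) (mulL a d)) = 0 := by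
    intro a b p hb h
    have hb' : algebraMap ℚ[X] (RatFunc ℚ) (toPoly b) ≠ 0 :=
      (map_ne_zero_iff _ (IsFractionRing.injective ℚ[X] (RatFunc ℚ))).2 hb
    rw [leadSign_eq_zero_iff, toPoly_subL, toPoly_mulL, toPoly_mulL, sub_eq_zero]
    apply IsFractionRing.injective ℚ[X] (RatFunc ℚ)
    rw [map_mul, map_mul, ← h, RatFuncCode.toRatFunc]
    field_simp
  exact ⟨(p, q, d), key h1 ep, key h2 eq, leadSign_ne_zero ⟨_, hd 0⟩, hd⟩

theorem CodeFor.represents (h : CodeFor x t) (hx : x.IsValid) : Represents t x := by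
  obtain ⟨h1, h2, -, h4⟩ := h
  rw [leadSign_eq_zero_iff, toPoly_subL, toPoly_mulL, toPoly_mulL, sub_eq_zero] at h1 h2
  exact Represents.of_eq hx h1 h2 h4

theorem CodeFor.baseCheck (h : CodeFor x t) {k N b M ln ld mode : ℕ} (hk : 1 ≤ k) (hk6 : k ≤ 6)
    (hN : (mkCert t x.2 k 0 b M ln ld mode).bigBound < N) :
    BaseCheck x (mkCert t x.2 k N b M ln ld mode) :=
  ⟨h.1, h.2.1, h.2.2.1, fun n _ => h.2.2.2 n, hk, hk6, hN⟩

theorem wordCheck_mkCert {k N b M ln ld mode : ℕ} :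
    WordCheck x (mkCert t x.2 k N b M ln ld mode) :=
  ⟨by simp [mkCert, Cert.word, Cert.k, signWord], fun _ hi => getElem?_signWord t x.2 hi⟩

theorem leadSign_eq_zero_of_eventually {l : List ℤ} (h : ∀ᶠ n : ℕ in atTop, evalZ l n = 0) :
    leadSign l = 0 := by
  by_contra h0
  obtain ⟨n, h1, h2⟩ := (h.and (eventually_gt_atTop (boundL l))).exists
  exact evalZ_ne_zero h0 h2 h1

theorem eventually_evalZ_ne_zero {l : List ℤ} (h : leadSign l ≠ 0) :
    ∀ᶠ n : ℕ in atTop, evalZ l n ≠ 0 :=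
  (eventually_gt_atTop (boundL l)).mono fun _ hn => evalZ_ne_zero h hn

theorem aeval_toPoly (l : List ℤ) (n : ℕ) : aeval (n : ℝ) (toPoly l) = (evalZ l n : ℝ) :=
  eval₂_toPoly l n

theorem isRatSeq_evalZ_div {a b : List ℤ} (hb : leadSign b ≠ 0) {g : ℕ → ℝ}
    (h : ∀ n : ℕ, g n = (evalZ a n : ℝ) / (evalZ b n : ℝ)) : IsRatSeq g :=
  ⟨toPoly a, toPoly b, fun h0 => hb ((leadSign_eq_zero_iff b).2 h0),
    Eventually.of_forall fun n => by rw [h, aeval_toPoly, aeval_toPoly]⟩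

theorem Represents.eventually_jumpCoeff (h : Represents t x) {k : ℕ}
    (hA : leadSign (stepL t k).1 ≠ 0) : ∀ᶠ n in atTop,
      jumpCoeff (valueAt x.P) (valueAt x.Q) k n =
        (evalZ (coeffNum t k) n : ℝ) / (evalZ (coeffDen t k) n : ℝ) := by
  filter_upwards [(tendsto_add_atTop_nat k).eventually (eventually_evalZ_ne_zero hA)] with n hn
  exact h.jumpCoeff_eq (by rw [jumpDen, evalZ_mulL]; exact mul_ne_zero (h.stepL_spec _ _).1 hn)

theorem Represents.nondegCheck (h : Represents t x) {k N b M ln ld mode : ℕ}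
    (hA : leadSign (stepL t k).1 ≠ 0) (hq : leadSign t.2.1 ≠ 0)
    (hC : ∀ᶠ n in atTop, jumpCoeff (valueAt x.P) (valueAt x.Q) k n ≠ 0) :
    NondegCheck (mkCert t x.2 k N b M ln ld mode) := by
  obtain ⟨n, h1, h2⟩ := (hC.and (h.eventually_jumpCoeff hA)).exists
  rw [h2, Ne, div_eq_zero_iff, not_or] at h1
  exact ⟨hA, hq, leadSign_ne_zero ⟨n, by exact_mod_cast h1.1⟩,
    leadSign_ne_zero ⟨n, by exact_mod_cast h1.2⟩⟩

theorem Represents.stateZero_iff (h : Represents w.t x) :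
    StateZero x w ↔ x.seq w.N = 0 ∧ x.seq (w.N + 1) = 0 := by
  obtain ⟨e0, e1, e2⟩ := h.stateZ_spec w.N
  have e0' : ((stateZ w.t x.2 w.N).2.2 : ℝ) ≠ 0 := by exact_mod_cast e0
  rw [e1, e2, div_eq_zero_iff, div_eq_zero_iff]
  simp [e0', StateZero]

theorem NondegCheck.exceeds_iff (hnd : NondegCheck w) (hrep : Represents w.t x)
    (hN : w.bigBound < w.N) (hk : 1 ≤ w.k) (hb : w.b + w.k ≤ w.N) {n0 : ℕ} (hn0 : w.N ≤ n0)
    (m : ℕ) :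
    SolExceedsAt (((n0 : ℝ) - w.b) / w.k)
      (fun m => jumpP (valueAt x.P) (valueAt x.Q) w.k (n0 + w.k * m))
      (fun m => x.seq (n0 + w.k * m)) m ↔ ExceedsZ w.t x.2 w.k w.b (n0 + w.k * m) := by
  have F := hnd.facts hrep hN (n := n0 + w.k * m) (by omega)
  rw [solExceedsAt_iff (f := x.seq) (P := jumpP (valueAt x.P) (valueAt x.Q) w.k) hk
    (by omega : w.b < n0), hrep.exceedsZ_iff (by omega) F.2.2.2.1 F.2.1]

/-- The part of `NonoscCheck` that does not depend on the oracle. -/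
def NonoscPre (w : Cert) : Prop :=
  NondegCheck w ∧ leadSign (coeffNum w.t w.k) * leadSign (coeffDen w.t w.k) = 1 ∧
  leadSign w.nonoscPoly ≠ -1 ∧ w.b + w.k ≤ w.N

/-- Persistence of a crossing along its residue class. It allows the threshold index to be moved up
until all crossings that ever occur have occurred. -/
theorem NonoscPre.exceedsZ_add (h : NonoscPre w) (hrep : Represents w.t x)
    (hN : w.bigBound < w.N) (hk : 1 ≤ w.k) {n : ℕ} (hn : w.N ≤ n)
    (he : ExceedsZ w.t x.2 w.k w.b n) (m : ℕ) : ExceedsZ w.t x.2 w.k w.b (n + w.k * m) := by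
  obtain ⟨hnd, hpos, hnon, hb⟩ := h
  obtain ⟨hx1, hsk⟩ := subKneser_jump hnd hrep hN hk hpos hnon hb hn
  obtain ⟨hs, hP, -, -⟩ := hnd.jump hrep hN hn
  rw [← hnd.exceeds_iff hrep hN hk hb hn]
  refine SolExceedsAt.of_le hx1 (fun n h0 => ?_) hsk hs (m := 0) ?_ (Nat.zero_le m)
  · have := hP n; rw [h0, zero_mul] at this; exact this.false
  · rw [hnd.exceeds_iff hrep hN hk hb hn]; simpa using he

theorem NonoscPre.minimal (h : NonoscPre w) (hrep : Represents w.t x)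
    (hN : w.bigBound < w.N) (hk : 1 ≤ w.k) {n : ℕ} (hn : w.N ≤ n)
    (hnz : ¬ (x.seq w.N = 0 ∧ x.seq (w.N + 1) = 0))
    (he : ∀ m, ¬ ExceedsZ w.t x.2 w.k w.b (n + w.k * m)) :
    jumpInstance w.t x.2 w.k n ∈ MinimalityProblem := by
  obtain ⟨hnd, hpos, hnon, hb⟩ := h
  obtain ⟨hx1, hsk⟩ := subKneser_jump hnd hrep hN hk hpos hnon hb hn
  obtain ⟨hs, hP, hQ, -⟩ := hnd.jump hrep hN hn
  refine (hrep.jumpInstance_mem_iff ?_ ?_ ?_).2 (minimalSol_of_not_exceeds hx1 (fun n h0 => ?_)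
    hQ hsk hs ?_ fun m => ?_)
  · exact fun n hn => (hnd.facts hrep hN (by omega)).1
  · exact fun n hn => (hnd.facts hrep hN (by omega)).2.1
  · exact fun n hn => (hnd.facts hrep hN (by omega)).2.2.1
  · have := hP n; rw [h0, zero_mul] at this; exact this.false
  · rintro ⟨h0, h1⟩
    exact hnz (Solves.jump_nontrivial hnd hrep hN hn (by simpa using h0) (by simpa using h1))
  · rw [hnd.exceeds_iff hrep hN hk hb hn]; exact he m

/-- In a class where a crossing ever happens, it is visible once `N` is large. In the remaining
classes the sequence is minimal and a truthful oracle says so. Only positive answers need to be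
forced here, hence the form of the hypothesis on `bits`. -/
theorem exists_nonoscCheck (ht : CodeFor x t) (hx : x.IsValid)
    (hnz : ∀ n, ¬ (x.seq n = 0 ∧ x.seq (n + 1) = 0)) {k b : ℕ} (hk : 1 ≤ k) (hk6 : k ≤ 6)
    (hA : leadSign (stepL t k).1 ≠ 0) (hq : leadSign t.2.1 ≠ 0)
    (hC : ∀ᶠ n in atTop, 0 < jumpCoeff (valueAt x.P) (valueAt x.Q) k n)
    (hC1 : ∀ᶠ n in atTop, jumpCoeff (valueAt x.P) (valueAt x.Q) k n ≤
      1 + (k : ℝ) ^ 2 / (4 * ((n : ℝ) - b) * ((n : ℝ) + k - b))) :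
    ∃ w : Cert, ∀ bits : List Bool, (∀ i < 6,
      jumpInstance w.t x.2 w.k (w.N + i) ∈ MinimalityProblem → bits.getD i false = true) →
      Check x w bits := by
  classical
  have hrep := ht.represents hx
  have hev := hrep.eventually_jumpCoeff hA
  have hnd : ∀ N, NondegCheck (mkCert t x.2 k N b 0 0 0 3) := fun N =>
    hrep.nondegCheck hA hq (hC.mono fun n h => h.ne')
  have hpre : ∀ N, b + k ≤ N → NonoscPre (mkCert t x.2 k N b 0 0 0 3) := by
    intro N hN
    refine ⟨hnd N, ?_, ?_, hN⟩
    · obtain ⟨n, h1, h2, h3, h4⟩ := (hC.and (hev.and ((eventually_gt_atTop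
        (boundL (coeffNum t k))).and (eventually_gt_atTop (boundL (coeffDen t k)))))).exists
      rw [h2] at h1
      show leadSign (coeffNum t k) * leadSign (coeffDen t k) = 1
      rw [leadSign_mul h3 h4, Int.sign_eq_one_iff_pos]
      rcases div_pos_iff.1 h1 with ⟨a, b⟩ | ⟨a, b⟩
      · exact mul_pos (by exact_mod_cast a) (by exact_mod_cast b)
      · exact mul_pos_of_neg_of_neg (by exact_mod_cast a) (by exact_mod_cast b)
    · refine leadSign_ne_neg_one ?_
      filter_upwards [hC1, hev, eventually_gt_atTop b,
        eventually_evalZ_ne_zero (hnd N).2.2.2] with n h1 h2 h3 h4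
      rw [h2] at h1
      rw [evalZ_nonoscPoly]
      exact (nonosc_iff h4 h3).1 h1
  set N1 := (mkCert t x.2 k 0 b 0 0 0 3).bigBound + 1 + (b + k) with hN1
  have hpre1 := hpre N1 (by omega)
  have hB1 : (mkCert t x.2 k N1 b 0 0 0 3).bigBound < N1 := by
    show (mkCert t x.2 k 0 b 0 0 0 3).bigBound < N1
    omega
  -- `m i` is a crossing time of the class of `i` if there is one, and a dummy value otherwise.
  have hex : ∀ i, ∃ m, (∃ m', ExceedsZ t x.2 k b (N1 + i + k * m')) →
      ExceedsZ t x.2 k b (N1 + i + k * m) := by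
    intro i
    by_cases h : ∃ m', ExceedsZ t x.2 k b (N1 + i + k * m')
    · exact ⟨h.choose, fun _ => h.choose_spec⟩
    · exact ⟨0, fun h' => absurd h' h⟩
  choose m hm using hex
  -- The sum dominates every `m i`, and moving `N1` by a multiple of `k` keeps the residue classes
  -- aligned.
  set K := ∑ i ∈ Finset.range k, m i with hK
  have hB2 : (mkCert t x.2 k (N1 + k * K) b 0 0 0 3).bigBound < N1 + k * K := by
    show (mkCert t x.2 k 0 b 0 0 0 3).bigBound < N1 + k * K
    omega
  have hpre2 := hpre (N1 + k * K) (by omega)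
  refine ⟨mkCert t x.2 k (N1 + k * K) b 0 0 0 3, fun bits hbits => ⟨ht.baseCheck hk hk6 hB2,
    Or.inl ⟨wordCheck_mkCert, Or.inr (Or.inr (Or.inr ⟨rfl, hpre2.1, hpre2.2.1, hpre2.2.2.1,
      hpre2.2.2.2, fun i hi => ?_⟩))⟩⟩⟩
  by_cases h : ∃ m', ExceedsZ t x.2 k b (N1 + i + k * m')
  · right
    have hmK : m i ≤ K := Finset.single_le_sum (f := m) (fun _ _ => Nat.zero_le _)
      (Finset.mem_range.2 hi)
    have := hpre1.exceedsZ_add hrep hB1 hk (n := N1 + i + k * m i)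
      (by show N1 ≤ _; omega) (hm i h) (K - m i)
    have e : N1 + i + k * m i + k * (K - m i) = N1 + k * K + i := by
      rw [add_assoc (N1 + i), ← mul_add, Nat.add_sub_cancel' hmK]; ring
    change ExceedsZ t x.2 k b (N1 + i + k * m i + k * (K - m i)) at this
    rw [e] at this
    exact this
  · left
    refine hbits i (lt_of_lt_of_le hi hk6) (hpre2.minimal hrep hB2 hk (Nat.le_add_right _ i)
      (hnz _) fun m' h' => h ⟨K + m', ?_⟩)
    rw [show N1 + i + k * (K + m') = N1 + k * K + i + k * m' by ring]
    exact h'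

theorem oscCheck_mkCert (ht : CodeFor x t) (hx : x.IsValid)
    (hnz : ∀ n, ¬ (x.seq n = 0 ∧ x.seq (n + 1) = 0)) {k M ln ld : ℕ} (hk : 1 ≤ k) (hk6 : k ≤ 6)
    (hA : leadSign (stepL t k).1 ≠ 0) (hq : leadSign t.2.1 ≠ 0)
    (hC : ∀ᶠ n in atTop, jumpCoeff (valueAt x.P) (valueAt x.Q) k n ≠ 0) (hd : 1 ≤ ld)
    (hlim : ∀ᶠ n : ℕ in atTop,
      |jumpCoeff (valueAt x.P) (valueAt x.Q) k n - (ln : ℝ) / ld| * n ≤ M)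
    (hcase : (ln = ld ∧ 1 ≤ M ∧ ∀ᶠ n : ℕ in atTop, 1 + (1 / 4 + 1 / (M : ℝ)) * k ^ 2 / (n : ℝ) ^ 2 ≤
        jumpCoeff (valueAt x.P) (valueAt x.Q) k n) ∨
      (ld < ln ∧ ln ≠ 4 * ld ∧ ln ≠ 2 * ld ∧ 3 * ln ≠ 4 * ld)) :
    ∃ w : Cert, ∀ bits : List Bool, Check x w bits := by
  have hrep := ht.represents hx
  have hev := hrep.eventually_jumpCoeff hA
  set N := (mkCert t x.2 k 0 0 M ln ld 4).bigBound + 1 with hN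
  have hnd : NondegCheck (mkCert t x.2 k N 0 M ln ld 4) := hrep.nondegCheck hA hq hC
  refine ⟨mkCert t x.2 k N 0 M ln ld 4, fun bits => ⟨ht.baseCheck hk hk6 (by omega), Or.inr
    ⟨rfl, hnd, fun h => hnz _ ((Represents.stateZero_iff
      (w := mkCert t x.2 k N 0 M ln ld 4) hrep).1 h), hd, leadSign_ne_neg_one ?_, ?_⟩⟩⟩
  · filter_upwards [hlim, hev, eventually_gt_atTop 0,
      eventually_evalZ_ne_zero hnd.2.2.2] with n h1 h2 h3 h4
    rw [h2] at h1
    rw [evalZ_limPoly]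
    exact (lim_iff h4 h3 hd).1 h1
  · refine hcase.imp (fun h => ⟨h.1, h.2.1, leadSign_ne_neg_one ?_⟩) id
    filter_upwards [h.2.2, hev, eventually_gt_atTop 0,
      eventually_evalZ_ne_zero hnd.2.2.2] with n h1 h2 h3 h4
    rw [h2] at h1
    rw [evalZ_oscPoly]
    exact (osc_iff h4 h3 h.2.1).1 h1

/-- Degenerate instances come first: two consecutive zeros, `P = 0`, `Q = 0`. Otherwise
`exists_jumpBehaviour` supplies `k`, and its alternatives match the remaining modes. -/
theorem exists_check (hx : x.IsValid) : ∃ w : Cert, ∀ bits : List Bool, (∀ i < 6,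
    jumpInstance w.t x.2 w.k (w.N + i) ∈ MinimalityProblem → bits.getD i false = true) →
    Check x w bits := by
  obtain ⟨t, ht⟩ := exists_codeFor hx
  have hrep := ht.represents hx
  have hsol := Represents.solves x
  by_cases hz : ∃ n, x.seq n = 0 ∧ x.seq (n + 1) = 0
  · obtain ⟨n, h0, h1⟩ := hz
    refine ⟨mkCert t x.2 1 ((mkCert t x.2 1 0 0 0 0 0 0).bigBound + 1 + n) 0 0 0 0 0,
      fun bits _ => ⟨ht.baseCheck le_rfl (by norm_num) (by omega), Or.inl ⟨wordCheck_mkCert,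
        Or.inl ⟨rfl, (Represents.stateZero_iff (w := mkCert t x.2 1 _ 0 0 0 0 0) hrep).2
          (hsol.eq_zero_forward (Nat.le_add_left n _) h0 h1)⟩⟩⟩⟩
  rw [not_exists] at hz
  have mode2 : ∀ k, 1 ≤ k → k ≤ 6 → leadSign (stepL t k).1 = 0 → ∃ w : Cert, ∀ bits : List Bool,
      (∀ i < 6, jumpInstance w.t x.2 w.k (w.N + i) ∈ MinimalityProblem →
        bits.getD i false = true) → Check x w bits := fun k hk hk6 hA =>
    ⟨mkCert t x.2 k ((mkCert t x.2 k 0 0 0 0 0 2).bigBound + 1) 0 0 0 0 2,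
      fun bits _ => ⟨ht.baseCheck hk hk6 (by omega), Or.inl ⟨wordCheck_mkCert,
        Or.inr (Or.inr (Or.inl ⟨rfl, hA⟩))⟩⟩⟩
  by_cases hp : leadSign t.1 = 0
  -- At distance `2` the coefficient `stepA` is `P` itself, so `P = 0` is an instance of the mode in
  -- which `stepA` vanishes.
  · refine mode2 2 (by norm_num) (by norm_num) (leadSign_eq_zero_of_eventually
      (Eventually.of_forall fun n => ?_))
    rw [← hrep.stepA_eq_zero_iff]
    simp [stepA_succ, stepB_succ, hrep.valueP, evalZ_eq_zero_of_leadSign hp]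
  by_cases hq : leadSign t.2.1 = 0
  · exact ⟨mkCert t x.2 1 ((mkCert t x.2 1 0 0 0 0 0 1).bigBound + 1) 0 0 0 0 1,
      fun bits _ => ⟨ht.baseCheck le_rfl (by norm_num) (by omega), Or.inl ⟨wordCheck_mkCert,
        Or.inr (Or.inl ⟨rfl, hp, hq⟩)⟩⟩⟩
  have hPr : IsRatSeq (valueAt x.P) := isRatSeq_evalZ_div ht.2.2.1 hrep.valueP
  have hQr : IsRatSeq (valueAt x.Q) := isRatSeq_evalZ_div ht.2.2.1 hrep.valueQ
  have hne : ∀ {l : List ℤ}, leadSign l ≠ 0 → ∀ᶠ n : ℕ in atTop,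
      (evalZ l n : ℝ) / (evalZ t.2.2 n : ℝ) ≠ 0 := fun hl =>
    (eventually_evalZ_ne_zero hl).mono fun n hn =>
      div_ne_zero (by exact_mod_cast hn) (by exact_mod_cast hrep.ne_zero n)
  obtain ⟨k, hk, hk6, hjb⟩ := exists_jumpBehaviour hPr hQr
    ((hne hp).mono fun n hn => by rwa [hrep.valueP]) ((hne hq).mono fun n hn => by rwa [hrep.valueQ])
  have hCr := hPr.jumpCoeff hQr k
  rcases hjb with hA | ⟨hA, hcase⟩
  · exact mode2 k hk hk6 (leadSign_eq_zero_of_eventually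
      (hA.mono fun n hn => (hrep.stepA_eq_zero_iff k n).1 hn))
  have hA' : leadSign (stepL t k).1 ≠ 0 := by
    obtain ⟨n, hn⟩ := hA.exists
    exact leadSign_ne_zero ⟨n, fun h => hn ((hrep.stepA_eq_zero_iff k n).2 h)⟩
  rcases hcase with hL | ⟨hpos, hle⟩ | ⟨L, h1, h4, h2, h3, hL⟩
  · have hpos : ∀ᶠ n in atTop, 0 < jumpCoeff (valueAt x.P) (valueAt x.Q) k n :=
      hL.eventually (lt_mem_nhds one_pos)
    rcases hCr.kneser_dichotomy hk with ⟨b, hb⟩ | ⟨M, hM, hosc⟩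
    · exact exists_nonoscCheck ht hx hz hk hk6 hA' hq hpos hb
    · obtain ⟨M', hM'⟩ := hCr.rate (L := 1) (by simpa using hL)
      -- One number must serve as rate constant and as margin. Enlarging it weakens both conditions.
      refine (oscCheck_mkCert (M := max M M') (ln := 1) (ld := 1) ht hx hz hk hk6 hA' hq
        (hpos.mono fun n h => h.ne') le_rfl
        (hM'.mono fun n hn => by
          have : (M' : ℝ) ≤ (max M M' : ℕ) := by exact_mod_cast le_max_right _ _
          simp only [Nat.cast_one, div_one, Rat.cast_one] at hn ⊢
          exact hn.trans this)
        (Or.inl ⟨rfl, le_max_of_le_left hM, hosc.mono fun n hn => le_trans ?_ hn⟩)).imp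
          fun w hw bits _ => hw bits
      · have a1 : (M : ℝ) ≤ (max M M' : ℕ) := by exact_mod_cast le_max_left _ _
        have a0 : (0 : ℝ) < M := by exact_mod_cast hM
        gcongr
  · refine exists_nonoscCheck (b := 0) ht hx hz hk hk6 hA' hq hpos (hle.mono fun n hn => hn.trans ?_)
    simp only [Nat.cast_zero, sub_zero]
    have : (0 : ℝ) ≤ (k : ℝ) ^ 2 / (4 * (n : ℝ) * ((n : ℝ) + k)) := by positivity
    linarith
  · obtain ⟨M, hM⟩ := hCr.rate hL
    have h1R : (1 : ℝ) < L := by exact_mod_cast h1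
    have hpos : ∀ᶠ n in atTop, 0 < jumpCoeff (valueAt x.P) (valueAt x.Q) k n :=
      hL.eventually (lt_mem_nhds (by linarith))
    have hnum : (L.num.toNat : ℤ) = L.num := Int.toNat_of_nonneg (Rat.num_nonneg.2 (by linarith))
    have hLeq : L = (L.num.toNat : ℚ) / (L.den : ℚ) := by
      have : (L.num.toNat : ℚ) = (L.num : ℚ) := by exact_mod_cast congrArg (Int.cast : ℤ → ℚ) hnum
      rw [this, Rat.num_div_den]
    have hd : (0 : ℚ) < L.den := by exact_mod_cast L.den_pos
    have hLR : (L : ℝ) = (L.num.toNat : ℝ) / (L.den : ℝ) := by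
      conv_lhs => rw [hLeq]
      push_cast; rfl
    refine (oscCheck_mkCert (M := M) (ln := L.num.toNat) (ld := L.den) ht hx hz hk hk6
      hA' hq (hpos.mono fun n h => h.ne') L.den_pos (by rw [← hLR]; exact hM) (Or.inr ?_)).imp
        fun w hw bits _ => hw bits
    · generalize L.num.toNat = a at hLeq
      generalize L.den = d at hLeq hd
      rw [hLeq] at h1 h4 h2 h3
      rw [one_lt_div hd] at h1
      rw [Ne, div_eq_iff hd.ne'] at h4 h2
      rw [← mul_div_assoc, Ne, div_eq_iff hd.ne'] at h3
      exact ⟨by exact_mod_cast h1, by exact_mod_cast h4, by exact_mod_cast h2,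
        by exact_mod_cast h3⟩

end

end HolonomicSign

namespace HolonomicSign

open Filter Topology Polynomial

/-! ### Primitive recursive operations on integers -/

section

variable {α : Type*} [Primcodable α]

theorem encode_int_natCast (m : ℕ) : Encodable.encode (m : ℤ) = 2 * m := rfl

theorem encode_int_negSucc (m : ℕ) : Encodable.encode (Int.negSucc m) = 2 * m + 1 := rfl

/-- Integers are coded by `m ↦ 2 m` and `-(m + 1) ↦ 2 m + 1`, so the sign is the parity of the code.
-/
theorem primrec_toNat : Primrec Int.toNat := by
  refine (Primrec.ite (Primrec.eq.comp (Primrec.nat_mod.comp Primrec.encode (Primrec.const 2))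
    (Primrec.const 0)) (Primrec.nat_div.comp Primrec.encode (Primrec.const 2))
    (Primrec.const 0)).of_eq fun z => ?_
  cases z with
  | ofNat m =>
    rw [Int.ofNat_eq_natCast, encode_int_natCast, if_pos (by omega)]
    simp
  | negSucc m => rw [encode_int_negSucc, if_neg (by omega)]; rfl

theorem primrec_toNat_neg : Primrec fun z : ℤ => (-z).toNat := by
  refine (Primrec.ite (Primrec.eq.comp (Primrec.nat_mod.comp Primrec.encode (Primrec.const 2))
    (Primrec.const 0)) (Primrec.const 0) (Primrec.succ.comp
    (Primrec.nat_div.comp Primrec.encode (Primrec.const 2)))).of_eq fun z => ?_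
  cases z with
  | ofNat m =>
    rw [Int.ofNat_eq_natCast, encode_int_natCast, if_pos (by omega)]
    simp
  | negSucc m =>
    rw [encode_int_negSucc, if_neg (by omega), Int.neg_negSucc]
    show (2 * m + 1) / 2 + 1 = ((m + 1 : ℕ) : ℤ).toNat
    rw [Int.toNat_natCast]
    omega

theorem primrec_int_subNat {f g : α → ℕ} (hf : Primrec f) (hg : Primrec g) :
    Primrec fun a => (f a : ℤ) - (g a : ℤ) := by
  refine Primrec.encode_iff.1 ((Primrec.ite (Primrec.nat_le.comp hg hf)
    (Primrec.nat_mul.comp (Primrec.const 2) (Primrec.nat_sub.comp hf hg))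
    (Primrec.succ.comp (Primrec.nat_mul.comp (Primrec.const 2)
      (Primrec.nat_sub.comp (Primrec.nat_sub.comp hg hf) (Primrec.const 1))))).of_eq fun a => ?_)
  split_ifs with h
  · rw [← encode_int_natCast, Nat.cast_sub h]
  · show 2 * (g a - f a - 1) + 1 = _
    rw [← encode_int_negSucc, Int.negSucc_eq]
    congr 1
    omega

/-- The decomposition into positive and negative parts reduces integer arithmetic to that of natural
numbers. -/
theorem int_eq_toNat_sub (z : ℤ) : z = (z.toNat : ℤ) - ((-z).toNat : ℤ) := by omega

theorem primrec_int_natCast {f : α → ℕ} (hf : Primrec f) : Primrec fun a => (f a : ℤ) :=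
  (primrec_int_subNat hf (Primrec.const 0)).of_eq fun a => by simp

theorem primrec_int_add {f g : α → ℤ} (hf : Primrec f) (hg : Primrec g) :
    Primrec fun a => f a + g a :=
  (primrec_int_subNat (Primrec.nat_add.comp (primrec_toNat.comp hf) (primrec_toNat.comp hg))
    (Primrec.nat_add.comp (primrec_toNat_neg.comp hf) (primrec_toNat_neg.comp hg))).of_eq
    fun a => by push_cast; omega

theorem primrec_int_neg {f : α → ℤ} (hf : Primrec f) : Primrec fun a => -f a :=
  (primrec_int_subNat (primrec_toNat_neg.comp hf) (primrec_toNat.comp hf)).of_eq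
    fun a => by omega

theorem primrec_int_sub {f g : α → ℤ} (hf : Primrec f) (hg : Primrec g) :
    Primrec fun a => f a - g a :=
  (primrec_int_add hf (primrec_int_neg hg)).of_eq fun a => by ring

theorem primrec_int_mul {f g : α → ℤ} (hf : Primrec f) (hg : Primrec g) :
    Primrec fun a => f a * g a :=
  (primrec_int_subNat
    (Primrec.nat_add.comp (Primrec.nat_mul.comp (primrec_toNat.comp hf) (primrec_toNat.comp hg))
      (Primrec.nat_mul.comp (primrec_toNat_neg.comp hf) (primrec_toNat_neg.comp hg)))
    (Primrec.nat_add.comp (Primrec.nat_mul.comp (primrec_toNat.comp hf) (primrec_toNat_neg.comp hg))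
      (Primrec.nat_mul.comp (primrec_toNat_neg.comp hf) (primrec_toNat.comp hg)))).of_eq
    fun a => by
      conv_rhs => rw [int_eq_toNat_sub (f a), int_eq_toNat_sub (g a)]
      push_cast
      ring

theorem primrec_natAbs {f : α → ℤ} (hf : Primrec f) : Primrec fun a => (f a).natAbs :=
  (Primrec.nat_add.comp (primrec_toNat.comp hf) (primrec_toNat_neg.comp hf)).of_eq
    fun a => by omega

theorem primrecPred_int_lt {f g : α → ℤ} (hf : Primrec f) (hg : Primrec g) :
    PrimrecPred fun a => f a < g a :=
  (Primrec.nat_lt.comp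
    (Primrec.nat_add.comp (primrec_toNat.comp hf) (primrec_toNat_neg.comp hg))
    (Primrec.nat_add.comp (primrec_toNat.comp hg) (primrec_toNat_neg.comp hf))).of_eq
    fun a => by omega

theorem primrec_int_sign {f : α → ℤ} (hf : Primrec f) : Primrec fun a => (f a).sign :=
  (Primrec.ite (primrecPred_int_lt (Primrec.const 0) hf) (Primrec.const 1)
    (Primrec.ite (primrecPred_int_lt hf (Primrec.const 0)) (Primrec.const (-1))
      (Primrec.const 0))).of_eq fun a => by
    split_ifs with h1 h2
    · exact (Int.sign_eq_one_of_pos h1).symm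
    · exact (Int.sign_eq_neg_one_of_neg h2).symm
    · rw [show f a = 0 by omega, Int.sign_zero]

theorem primrec_signType {f : α → ℤ} (hf : Primrec f) :
    Primrec fun a => SignType.sign (f a) :=
  (Primrec.ite (primrecPred_int_lt (Primrec.const 0) hf) (Primrec.const 1)
    (Primrec.ite (primrecPred_int_lt hf (Primrec.const 0)) (Primrec.const (-1))
      (Primrec.const 0))).of_eq fun a => by
    split_ifs with h1 h2
    · exact (sign_pos h1).symm
    · exact (sign_neg h2).symm
    · rw [show f a = 0 by omega, sign_zero]

theorem primrecPred_forall_lt {n : α → ℕ} {R : α → ℕ → Prop} (hn : Primrec n)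
    (hR : PrimrecPred fun p : α × ℕ => R p.1 p.2) : PrimrecPred fun a => ∀ i < n a, R a i :=
  ((PrimrecRel.forall_mem_list (R := fun i a => R a i) (PrimrecRel.swap hR)).comp
    (Primrec.list_range.comp hn) Primrec.id).of_eq fun a => by simp

/-! ### Primitive recursive operations on integer polynomials -/

theorem primrec_evalZ {l : α → List ℤ} {n : α → ℤ} (hl : Primrec l) (hn : Primrec n) :
    Primrec fun a => evalZ (l a) (n a) :=
  Primrec.list_foldr hl (Primrec.const 0) (h := fun a p => p.1 + n a * p.2)
    (primrec_int_add (Primrec.fst.comp Primrec.snd)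
      (primrec_int_mul (hn.comp Primrec.fst) (Primrec.snd.comp Primrec.snd)))

theorem primrec_addL {l m : α → List ℤ} (hl : Primrec l) (hm : Primrec m) :
    Primrec fun a => addL (l a) (m a) :=
  Primrec.list_map (Primrec.list_range.comp (Primrec.nat_max.comp (Primrec.list_length.comp hl)
    (Primrec.list_length.comp hm))) (g := fun a i => (l a).getD i 0 + (m a).getD i 0)
    (primrec_int_add ((Primrec.list_getD 0).comp (hl.comp Primrec.fst) Primrec.snd)
      ((Primrec.list_getD 0).comp (hm.comp Primrec.fst) Primrec.snd))

theorem primrec_scaleL {c : α → ℤ} {l : α → List ℤ} (hc : Primrec c) (hl : Primrec l) :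
    Primrec fun a => scaleL (c a) (l a) :=
  Primrec.list_map hl (g := fun a x => c a * x)
    (primrec_int_mul (hc.comp Primrec.fst) Primrec.snd)

theorem primrec_mulL {l m : α → List ℤ} (hl : Primrec l) (hm : Primrec m) :
    Primrec fun a => mulL (l a) (m a) :=
  Primrec.list_foldr hl (Primrec.const []) (h := fun a p => addL (scaleL p.1 (m a)) (0 :: p.2))
    (primrec_addL (primrec_scaleL (Primrec.fst.comp Primrec.snd) (hm.comp Primrec.fst))
      (Primrec.list_cons.comp (Primrec.const 0) (Primrec.snd.comp Primrec.snd)))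

theorem primrec_subL {l m : α → List ℤ} (hl : Primrec l) (hm : Primrec m) :
    Primrec fun a => subL (l a) (m a) :=
  primrec_addL hl (primrec_scaleL (Primrec.const (-1)) hm)

theorem primrec_affL {l : α → List ℤ} {c k : α → ℤ} (hl : Primrec l) (hc : Primrec c)
    (hk : Primrec k) : Primrec fun a => affL (l a) (c a) (k a) :=
  Primrec.list_foldr hl (Primrec.const [])
    (h := fun a p => addL [p.1] (mulL [c a, k a] p.2))
    (primrec_addL (Primrec.list_cons.comp (Primrec.fst.comp Primrec.snd) (Primrec.const []))
      (primrec_mulL (Primrec.list_cons.comp (hc.comp Primrec.fst)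
        (Primrec.list_cons.comp (hk.comp Primrec.fst) (Primrec.const [])))
        (Primrec.snd.comp Primrec.snd)))

theorem primrec_leadSign {l : α → List ℤ} (hl : Primrec l) : Primrec fun a => leadSign (l a) :=
  Primrec.list_foldr hl (Primrec.const 0) (h := fun _ (p : ℤ × ℤ) => if p.2 = 0 then p.1.sign else p.2)
    (Primrec.ite (Primrec.eq.comp (Primrec.snd.comp Primrec.snd) (Primrec.const 0))
      (primrec_int_sign (Primrec.fst.comp Primrec.snd)) (Primrec.snd.comp Primrec.snd))

theorem primrec_boundL {l : α → List ℤ} (hl : Primrec l) : Primrec fun a => boundL (l a) :=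
  Primrec.list_foldr hl (Primrec.const 0) (h := fun _ (p : ℤ × ℕ) => p.1.natAbs + p.2)
    (Primrec.nat_add.comp (primrec_natAbs (Primrec.fst.comp Primrec.snd))
      (Primrec.snd.comp Primrec.snd))

theorem primrec_stepL {t : α → RecCode} {k : α → ℕ} (ht : Primrec t) (hk : Primrec k) :
    Primrec fun a => stepL (t a) (k a) := by
  have s1 : Primrec fun p : α × (ℕ × RecCode) => p.2.2.1 :=
    Primrec.fst.comp (Primrec.snd.comp Primrec.snd)
  have s2 : Primrec fun p : α × (ℕ × RecCode) => p.2.2.2.1 :=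
    Primrec.fst.comp (Primrec.snd.comp (Primrec.snd.comp Primrec.snd))
  have s3 : Primrec fun p : α × (ℕ × RecCode) => p.2.2.2.2 :=
    Primrec.snd.comp (Primrec.snd.comp (Primrec.snd.comp Primrec.snd))
  have t' : Primrec fun p : α × (ℕ × RecCode) => t p.1 := ht.comp Primrec.fst
  have c1 : Primrec fun _ : α × (ℕ × RecCode) => (1 : ℤ) := Primrec.const 1
  refine (Primrec.nat_rec' hk (Primrec.const ([], [1], [1]))
    (h := fun a p => (addL (mulL (affL p.2.1 1 1) (t a).1) (mulL (affL p.2.2.1 1 1) (t a).2.2),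
      mulL (affL p.2.1 1 1) (t a).2.1, mulL (affL p.2.2.2 1 1) (t a).2.2))
    (Primrec.pair (primrec_addL (primrec_mulL (primrec_affL s1 c1 c1) (Primrec.fst.comp t'))
        (primrec_mulL (primrec_affL s2 c1 c1) (Primrec.snd.comp (Primrec.snd.comp t'))))
      (Primrec.pair (primrec_mulL (primrec_affL s1 c1 c1) (Primrec.fst.comp (Primrec.snd.comp t')))
        (primrec_mulL (primrec_affL s3 c1 c1) (Primrec.snd.comp (Primrec.snd.comp t')))))).of_eq
    fun a => ?_
  induction k a with
  | zero => rfl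
  | succ n ih => simp only [stepL, ← ih]

theorem primrec_stateZ {t : α → RecCode} {v : α → RatCode × RatCode} {n : α → ℕ}
    (ht : Primrec t) (hv : Primrec v) (hn : Primrec n) :
    Primrec fun a => stateZ (t a) (v a) (n a) := by
  have s1 : Primrec fun p : α × (ℕ × (ℤ × ℤ × ℤ)) => p.2.2.1 :=
    Primrec.fst.comp (Primrec.snd.comp Primrec.snd)
  have s2 : Primrec fun p : α × (ℕ × (ℤ × ℤ × ℤ)) => p.2.2.2.1 :=
    Primrec.fst.comp (Primrec.snd.comp (Primrec.snd.comp Primrec.snd))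
  have s3 : Primrec fun p : α × (ℕ × (ℤ × ℤ × ℤ)) => p.2.2.2.2 :=
    Primrec.snd.comp (Primrec.snd.comp (Primrec.snd.comp Primrec.snd))
  have sn : Primrec fun p : α × (ℕ × (ℤ × ℤ × ℤ)) => (p.2.1 : ℤ) :=
    primrec_int_natCast (Primrec.fst.comp Primrec.snd)
  have t' : Primrec fun p : α × (ℕ × (ℤ × ℤ × ℤ)) => t p.1 := ht.comp Primrec.fst
  have e1 := primrec_evalZ (Primrec.fst.comp t') sn
  have e2 := primrec_evalZ (Primrec.fst.comp (Primrec.snd.comp t')) sn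
  have e3 := primrec_evalZ (Primrec.snd.comp (Primrec.snd.comp t')) sn
  have v1 : Primrec fun a => (v a).1.1 := Primrec.fst.comp (Primrec.fst.comp hv)
  have v2 : Primrec fun a => (v a).2.1 := Primrec.fst.comp (Primrec.snd.comp hv)
  have d1 : Primrec fun a => ((v a).1.2 : ℤ) + 1 := primrec_int_add (primrec_int_natCast
    (Primrec.snd.comp (Primrec.fst.comp hv))) (Primrec.const 1)
  have d2 : Primrec fun a => ((v a).2.2 : ℤ) + 1 := primrec_int_add (primrec_int_natCast
    (Primrec.snd.comp (Primrec.snd.comp hv))) (Primrec.const 1)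
  refine (Primrec.nat_rec' hn (Primrec.pair (primrec_int_mul v1 d2)
    (Primrec.pair (primrec_int_mul v2 d1) (primrec_int_mul d1 d2)))
    (h := fun a p => (p.2.2.1 * evalZ (t a).2.2 p.1,
      evalZ (t a).1 p.1 * p.2.2.1 + evalZ (t a).2.1 p.1 * p.2.1, p.2.2.2 * evalZ (t a).2.2 p.1))
    (Primrec.pair (primrec_int_mul s2 e3) (Primrec.pair
      (primrec_int_add (primrec_int_mul e1 s2) (primrec_int_mul e2 s1))
      (primrec_int_mul s3 e3)))).of_eq fun a => ?_
  induction n a with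
  | zero => rfl
  | succ n ih => simp only [stateZ, ← ih]

section

variable {t : α → RecCode} {k n : α → ℕ} {v : α → RatCode × RatCode}

theorem primrec_two_mul {f : α → ℕ} (hf : Primrec f) : Primrec fun a => 2 * f a :=
  Primrec.nat_mul.comp (Primrec.const 2) hf

theorem primrec_jumpNumP (ht : Primrec t) (hk : Primrec k) :
    Primrec fun a => jumpNumP (t a) (k a) :=
  primrec_mulL (Primrec.fst.comp (primrec_stepL ht (primrec_two_mul hk)))
    (Primrec.snd.comp (Primrec.snd.comp (primrec_stepL ht hk)))

theorem primrec_jumpDen (ht : Primrec t) (hk : Primrec k) :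
    Primrec fun a => jumpDen (t a) (k a) :=
  primrec_mulL (Primrec.snd.comp (Primrec.snd.comp (primrec_stepL ht (primrec_two_mul hk))))
    (Primrec.fst.comp (primrec_stepL ht hk))

theorem primrec_jumpNumQ (ht : Primrec t) (hk : Primrec k) :
    Primrec fun a => jumpNumQ (t a) (k a) :=
  primrec_subL
    (primrec_mulL (Primrec.fst.comp (Primrec.snd.comp (primrec_stepL ht (primrec_two_mul hk))))
      (Primrec.fst.comp (primrec_stepL ht hk)))
    (primrec_mulL (Primrec.fst.comp (primrec_stepL ht (primrec_two_mul hk)))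
      (Primrec.fst.comp (Primrec.snd.comp (primrec_stepL ht hk))))

theorem primrec_coeffNum (ht : Primrec t) (hk : Primrec k) :
    Primrec fun a => coeffNum (t a) (k a) :=
  primrec_scaleL (Primrec.const (-4)) (primrec_mulL
    (primrec_affL (primrec_jumpNumQ ht hk) (primrec_int_natCast hk) (Primrec.const 1))
    (primrec_jumpDen ht hk))

theorem primrec_coeffDen (ht : Primrec t) (hk : Primrec k) :
    Primrec fun a => coeffDen (t a) (k a) :=
  primrec_mulL
    (primrec_affL (primrec_jumpNumP ht hk) (primrec_int_natCast hk) (Primrec.const 1))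
    (primrec_jumpNumP ht hk)

theorem primrec_signAt (ht : Primrec t) (hv : Primrec v) (hn : Primrec n) :
    Primrec fun a => signAt (t a) (v a) (n a) :=
  primrec_signType (primrec_int_mul (Primrec.fst.comp (primrec_stateZ ht hv hn))
    (Primrec.snd.comp (Primrec.snd.comp (primrec_stateZ ht hv hn))))

theorem primrec_stateCode {s : α → ℤ × ℤ × ℤ} (hs : Primrec s) :
    Primrec fun a => stateCode (s a) :=
  have h3 : Primrec fun a => (s a).2.2 := Primrec.snd.comp (Primrec.snd.comp hs)
  Primrec.pair (primrec_int_mul (Primrec.fst.comp hs) h3)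
    (Primrec.nat_sub.comp (primrec_natAbs (primrec_int_mul h3 h3)) (Primrec.const 1))

theorem primrec_jumpInstance (ht : Primrec t) (hv : Primrec v) (hk : Primrec k)
    (hn : Primrec n) : Primrec fun a => jumpInstance (t a) (v a) (k a) (n a) := by
  have aff : ∀ {l : α → List ℤ}, Primrec l → Primrec fun a => affL (l a) (n a) (k a) :=
    fun hl => primrec_affL hl (primrec_int_natCast hn) (primrec_int_natCast hk)
  exact Primrec.pair (Primrec.pair
      (Primrec.pair (aff (primrec_jumpNumP ht hk)) (aff (primrec_jumpDen ht hk)))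
      (Primrec.pair (aff (primrec_jumpNumQ ht hk)) (aff (primrec_jumpDen ht hk))))
    (Primrec.pair (primrec_stateCode (primrec_stateZ ht hv hn))
      (primrec_stateCode (primrec_stateZ ht hv (Primrec.nat_add.comp hn hk))))

theorem primrecPred_exceedsZ {b : α → ℕ} (ht : Primrec t) (hv : Primrec v) (hk : Primrec k)
    (hb : Primrec b) (hn : Primrec n) :
    PrimrecPred fun a => ExceedsZ (t a) (v a) (k a) (b a) (n a) := by
  have m {f g : α → ℤ} (hf : Primrec f) (hg : Primrec g) := primrec_int_mul hf hg
  have n' := primrec_int_natCast hn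
  have nb := primrec_int_sub n' (primrec_int_natCast hb)
  have k' := primrec_int_natCast hk
  have e1 := primrec_evalZ (primrec_jumpNumP ht hk) n'
  have e2 := primrec_evalZ (primrec_jumpDen ht hk) n'
  have z1 := primrec_stateZ ht hv (Primrec.nat_add.comp hn hk)
  have z2 := primrec_stateZ ht hv (Primrec.nat_add.comp hn (primrec_two_mul hk))
  have z1a := Primrec.fst.comp z1
  have z1b := Primrec.snd.comp (Primrec.snd.comp z1)
  have z2a := Primrec.fst.comp z2
  have z2b := Primrec.snd.comp (Primrec.snd.comp z2)
  exact primrecPred_int_lt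
    (m (primrec_int_add (m (Primrec.const 2) nb) k') (m (m e1 e1) (m (m z1a z1a) (m z2b z2b))))
    (m (m (Primrec.const 4) nb) (m (m e1 e2) (m (m z1a z1b) (m z2a z2b))))

end

/-! ### Checking a certificate is primitive recursive -/

namespace Cert

variable {w : α → Cert}

theorem primrec_t (hw : Primrec w) : Primrec fun a => (w a).t := Primrec.fst.comp hw

theorem primrec_k (hw : Primrec w) : Primrec fun a => (w a).k :=
  Primrec.fst.comp (Primrec.fst.comp (Primrec.snd.comp hw))

theorem primrec_N (hw : Primrec w) : Primrec fun a => (w a).N :=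
  Primrec.fst.comp (Primrec.snd.comp (Primrec.fst.comp (Primrec.snd.comp hw)))

theorem primrec_b (hw : Primrec w) : Primrec fun a => (w a).b :=
  Primrec.fst.comp (Primrec.snd.comp (Primrec.snd.comp (Primrec.fst.comp (Primrec.snd.comp hw))))

theorem primrec_M (hw : Primrec w) : Primrec fun a => (w a).M :=
  Primrec.snd.comp (Primrec.snd.comp (Primrec.snd.comp (Primrec.fst.comp (Primrec.snd.comp hw))))

theorem primrec_limNum (hw : Primrec w) : Primrec fun a => (w a).limNum :=
  Primrec.fst.comp (Primrec.fst.comp (Primrec.snd.comp (Primrec.snd.comp hw)))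

theorem primrec_limDen (hw : Primrec w) : Primrec fun a => (w a).limDen :=
  Primrec.fst.comp (Primrec.snd.comp (Primrec.fst.comp (Primrec.snd.comp (Primrec.snd.comp hw))))

theorem primrec_mode (hw : Primrec w) : Primrec fun a => (w a).mode :=
  Primrec.snd.comp (Primrec.snd.comp (Primrec.fst.comp (Primrec.snd.comp (Primrec.snd.comp hw))))

theorem primrec_word (hw : Primrec w) : Primrec fun a => (w a).word :=
  Primrec.snd.comp (Primrec.snd.comp (Primrec.snd.comp hw))

theorem primrec_answer (hw : Primrec w) : Primrec fun a => (w a).answer :=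
  Primrec.ite (Primrec.nat_le.comp (primrec_mode hw) (Primrec.const 3))
    (Primrec.option_some.comp (Primrec.pair (primrec_word hw)
      (Primrec.nat_add.comp (primrec_N hw) (primrec_k hw)))) (Primrec.const none)

theorem primrec_nonoscPoly (hw : Primrec w) : Primrec fun a => (w a).nonoscPoly := by
  have k := primrec_int_natCast (primrec_k hw)
  have b := primrec_int_natCast (primrec_b hw)
  have U := primrec_coeffNum (primrec_t hw) (primrec_k hw)
  have V := primrec_coeffDen (primrec_t hw) (primrec_k hw)
  have lin {f : α → ℤ} (hf : Primrec f) : Primrec fun a => [f a, 1] :=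
    Primrec.list_cons.comp hf (Primrec.const [1])
  exact primrec_subL (primrec_scaleL (primrec_int_mul k k) (primrec_mulL V V))
    (primrec_scaleL (Primrec.const 4) (primrec_mulL
      (primrec_mulL (lin (primrec_int_neg b)) (lin (primrec_int_sub k b)))
      (primrec_mulL (primrec_subL U V) V)))

theorem primrec_oscPoly (hw : Primrec w) : Primrec fun a => (w a).oscPoly := by
  have k := primrec_int_natCast (primrec_k hw)
  have M := primrec_int_natCast (primrec_M hw)
  have U := primrec_coeffNum (primrec_t hw) (primrec_k hw)
  have V := primrec_coeffDen (primrec_t hw) (primrec_k hw)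
  exact primrec_subL (primrec_scaleL (primrec_int_mul (Primrec.const 4) M)
      (primrec_mulL (Primrec.const [0, 0, 1]) (primrec_mulL (primrec_subL U V) V)))
    (primrec_scaleL (primrec_int_mul (primrec_int_add M (Primrec.const 4)) (primrec_int_mul k k))
      (primrec_mulL V V))

theorem primrec_limDiff (hw : Primrec w) : Primrec fun a => (w a).limDiff :=
  primrec_subL
    (primrec_scaleL (primrec_int_natCast (primrec_limDen hw))
      (primrec_coeffNum (primrec_t hw) (primrec_k hw)))
    (primrec_scaleL (primrec_int_natCast (primrec_limNum hw))
      (primrec_coeffDen (primrec_t hw) (primrec_k hw)))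

theorem primrec_limPoly (hw : Primrec w) : Primrec fun a => (w a).limPoly := by
  have M := primrec_int_natCast (primrec_M hw)
  have d := primrec_int_natCast (primrec_limDen hw)
  have V := primrec_coeffDen (primrec_t hw) (primrec_k hw)
  exact primrec_subL (primrec_scaleL (primrec_int_mul (primrec_int_mul M M) (primrec_int_mul d d))
      (primrec_mulL V V))
    (primrec_mulL (Primrec.const [0, 0, 1])
      (primrec_mulL (primrec_limDiff hw) (primrec_limDiff hw)))

theorem primrec_polys (hw : Primrec w) : Primrec fun a => (w a).polys := by
  have c {f : α → List ℤ} {g : α → List (List ℤ)} (hf : Primrec f) (hg : Primrec g) :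
    Primrec fun a => f a :: g a := Primrec.list_cons.comp hf hg
  have t := primrec_t hw
  have k := primrec_k hw
  have s := primrec_stepL t k
  exact c (Primrec.fst.comp t) <| c (Primrec.fst.comp (Primrec.snd.comp t)) <|
    c (Primrec.snd.comp (Primrec.snd.comp t)) <| c (Primrec.fst.comp s) <|
    c (Primrec.fst.comp (Primrec.snd.comp s)) <| c (Primrec.snd.comp (Primrec.snd.comp s)) <|
    c (primrec_jumpNumP t k) <| c (primrec_jumpDen t k) <| c (primrec_jumpNumQ t k) <|
    c (primrec_coeffNum t k) <| c (primrec_coeffDen t k) <| c (primrec_nonoscPoly hw) <|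
    c (primrec_oscPoly hw) <| c (primrec_limPoly hw) <| Primrec.const []

theorem primrec_bigBound (hw : Primrec w) : Primrec fun a => (w a).bigBound :=
  Primrec.list_foldr (primrec_polys hw) (Primrec.const 0) (h := fun _ p => boundL p.1 + p.2)
    (Primrec.nat_add.comp (primrec_boundL (Primrec.fst.comp Primrec.snd))
      (Primrec.snd.comp Primrec.snd))

end Cert

section

variable {x : α → Instance} {w : α → Cert} {bits : α → List Bool}

theorem primrecPred_eq {β : Type*} [Primcodable β] {f : α → β} (hf : Primrec f) (c : β) :
    PrimrecPred fun a => f a = c := Primrec.eq.comp hf (Primrec.const c)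

theorem primrecPred_baseCheck (hx : Primrec x) (hw : Primrec w) :
    PrimrecPred fun a => BaseCheck (x a) (w a) := by
  have t := Cert.primrec_t hw
  have k := Cert.primrec_k hw
  have d := Primrec.snd.comp (Primrec.snd.comp t)
  have xP := Primrec.fst.comp (Primrec.fst.comp hx)
  have xQ := Primrec.snd.comp (Primrec.fst.comp hx)
  exact (primrecPred_eq (primrec_leadSign (primrec_subL
      (primrec_mulL (Primrec.fst.comp t) (Primrec.snd.comp xP))
      (primrec_mulL (Primrec.fst.comp xP) d))) 0).and <|
    (primrecPred_eq (primrec_leadSign (primrec_subL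
      (primrec_mulL (Primrec.fst.comp (Primrec.snd.comp t)) (Primrec.snd.comp xQ))
      (primrec_mulL (Primrec.fst.comp xQ) d))) 0).and <|
    (primrecPred_eq (primrec_leadSign d) 0).not.and <|
    (primrecPred_forall_lt (R := fun a n => evalZ (w a).t.2.2 n ≠ 0)
      (Primrec.succ.comp (primrec_boundL d))
      (primrecPred_eq (primrec_evalZ (d.comp Primrec.fst)
        (primrec_int_natCast Primrec.snd)) 0).not).and <|
    (Primrec.nat_le.comp (Primrec.const 1) k).and <|
    (Primrec.nat_le.comp k (Primrec.const 6)).and <|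
    Primrec.nat_lt.comp (Cert.primrec_bigBound hw) (Cert.primrec_N hw)

theorem primrecPred_wordCheck (hx : Primrec x) (hw : Primrec w) :
    PrimrecPred fun a => WordCheck (x a) (w a) := by
  have k2 := primrec_two_mul (Cert.primrec_k hw)
  have ix : Primrec fun p : α × ℕ => (w p.1).N + (w p.1).k + p.2 :=
    Primrec.nat_add.comp ((Primrec.nat_add.comp (Cert.primrec_N hw)
      (Cert.primrec_k hw)).comp Primrec.fst) Primrec.snd
  exact (Primrec.eq.comp (Primrec.list_length.comp (Cert.primrec_word hw)) k2).and <|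
    primrecPred_forall_lt (R := fun a i => (w a).word[((w a).N + (w a).k + i) % (2 * (w a).k)]? =
      some (signAt (w a).t (x a).2 ((w a).N + (w a).k + i))) k2
    (Primrec.eq.comp (Primrec.list_getElem?.comp ((Cert.primrec_word hw).comp Primrec.fst)
      (Primrec.nat_mod.comp ix (k2.comp Primrec.fst)))
      (Primrec.option_some.comp (primrec_signAt ((Cert.primrec_t hw).comp Primrec.fst)
        ((Primrec.snd.comp hx).comp Primrec.fst) ix)))

theorem primrecPred_stateZero (hx : Primrec x) (hw : Primrec w) :
    PrimrecPred fun a => StateZero (x a) (w a) :=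
  have s := primrec_stateZ (Cert.primrec_t hw) (Primrec.snd.comp hx) (Cert.primrec_N hw)
  (primrecPred_eq (Primrec.fst.comp s) 0).and
    (primrecPred_eq (Primrec.fst.comp (Primrec.snd.comp s)) 0)

theorem primrecPred_nondegCheck (hw : Primrec w) : PrimrecPred fun a => NondegCheck (w a) := by
  have t := Cert.primrec_t hw
  have k := Cert.primrec_k hw
  have ne {l : α → List ℤ} (hl : Primrec l) := (primrecPred_eq (primrec_leadSign hl) 0).not
  exact (ne (Primrec.fst.comp (primrec_stepL t k))).and <|
    (ne (Primrec.fst.comp (Primrec.snd.comp t))).and <|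
    (ne (primrec_coeffNum t k)).and (ne (primrec_coeffDen t k))

theorem primrecPred_nonoscCheck (hx : Primrec x) (hw : Primrec w) (hb : Primrec bits) :
    PrimrecPred fun a => NonoscCheck (x a) (w a) (bits a) := by
  have t := Cert.primrec_t hw
  have k := Cert.primrec_k hw
  have N := Cert.primrec_N hw
  have b := Cert.primrec_b hw
  exact (primrecPred_nondegCheck hw).and <|
    (primrecPred_eq (primrec_int_mul (primrec_leadSign (primrec_coeffNum t k))
      (primrec_leadSign (primrec_coeffDen t k))) 1).and <|
    (primrecPred_eq (primrec_leadSign (Cert.primrec_nonoscPoly hw)) (-1)).not.and <|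
    (Primrec.nat_le.comp (Primrec.nat_add.comp b k) N).and <|
    primrecPred_forall_lt (R := fun a i => (bits a).getD i false = true ∨
      ExceedsZ (w a).t (x a).2 (w a).k (w a).b ((w a).N + i)) k <|
    (primrecPred_eq ((Primrec.list_getD false).comp (hb.comp Primrec.fst) Primrec.snd) true).or
      (primrecPred_exceedsZ (t.comp Primrec.fst) ((Primrec.snd.comp hx).comp Primrec.fst)
        (k.comp Primrec.fst) (b.comp Primrec.fst)
        (Primrec.nat_add.comp (N.comp Primrec.fst) Primrec.snd))

theorem primrecPred_oscCheck (hx : Primrec x) (hw : Primrec w) :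
    PrimrecPred fun a => OscCheck (x a) (w a) := by
  have ln := Cert.primrec_limNum hw
  have ld := Cert.primrec_limDen hw
  have mul (c : ℕ) {f : α → ℕ} (hf : Primrec f) : Primrec fun a => c * f a :=
    Primrec.nat_mul.comp (Primrec.const c) hf
  exact (primrecPred_nondegCheck hw).and <| (primrecPred_stateZero hx hw).not.and <|
    (Primrec.nat_le.comp (Primrec.const 1) ld).and <|
    (primrecPred_eq (primrec_leadSign (Cert.primrec_limPoly hw)) (-1)).not.and <|
    ((Primrec.eq.comp ln ld).and <|
      (Primrec.nat_le.comp (Primrec.const 1) (Cert.primrec_M hw)).and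
      (primrecPred_eq (primrec_leadSign (Cert.primrec_oscPoly hw)) (-1)).not).or <|
    (Primrec.nat_lt.comp ld ln).and <| (Primrec.eq.comp ln (mul 4 ld)).not.and <|
    (Primrec.eq.comp ln (mul 2 ld)).not.and (Primrec.eq.comp (mul 3 ln) (mul 4 ld)).not

theorem primrecPred_check (hx : Primrec x) (hw : Primrec w) (hb : Primrec bits) :
    PrimrecPred fun a => Check (x a) (w a) (bits a) := by
  have t := Cert.primrec_t hw
  have mode (c : ℕ) := primrecPred_eq (Cert.primrec_mode hw) c
  have eqz {l : α → List ℤ} (hl : Primrec l) := primrecPred_eq (primrec_leadSign hl) 0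
  exact (primrecPred_baseCheck hx hw).and <| PrimrecPred.or
    ((primrecPred_wordCheck hx hw).and <|
      ((mode 0).and (primrecPred_stateZero hx hw)).or <|
      ((mode 1).and ((eqz (Primrec.fst.comp t)).not.and
        (eqz (Primrec.fst.comp (Primrec.snd.comp t))))).or <|
      ((mode 2).and (eqz (Primrec.fst.comp (primrec_stepL t (Cert.primrec_k hw))))).or <|
      (mode 3).and (primrecPred_nonoscCheck hx hw hb))
    ((mode 4).and (primrecPred_oscCheck hx hw))

end

end

end HolonomicSign

namespace HolonomicSign

open Filter Topology Polynomial

/-! ### Algorithms with an oracle -/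

section

variable {α β γ σ : Type*} [Primcodable α] [Primcodable β] [Primcodable γ] [Primcodable σ]
  {O : Set (ℕ →. ℕ)}

theorem recursiveIn_comp {f : β →. σ} {g : α → β} (hf : RecursiveIn O f)
    (hg : ComputableIn O g) : RecursiveIn O fun a => f (g a) :=
  (Nat.RecursiveIn.comp hf hg).of_eq fun n => by
    simp only [Part.map_some, Part.bind_eq_bind]
    rcases e : Encodable.decode (α := α) n with - | a <;> simp [Encodable.encodek]

theorem computableIn_comp {f : β → σ} {g : α → β} (hf : ComputableIn O f)
    (hg : ComputableIn O g) : ComputableIn O fun a => f (g a) :=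
  recursiveIn_comp (f := fun b => Part.some (f b)) hf hg

theorem computableIn_pair {f : α → β} {g : α → γ} (hf : ComputableIn O f)
    (hg : ComputableIn O g) : ComputableIn O fun a => (f a, g a) :=
  (Nat.RecursiveIn.pair hf hg).of_eq fun n => by
    cases Encodable.decode (α := α) n <;> simp [Seq.seq]

theorem recursiveIn_map {f : α →. β} {g : β → σ} (hf : RecursiveIn O f)
    (hg : ComputableIn O g) : RecursiveIn O fun a => (f a).map g :=
  (Nat.RecursiveIn.comp hg hf).of_eq fun n => by
    rcases Encodable.decode (α := α) n with - | a
    · simp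
    · simp only [Part.coe_some, Part.bind_some, Part.bind_eq_bind, Part.bind_map, Part.map_some,
        Encodable.encodek, Part.map_map]
      exact Part.bind_some_eq_map _ _

/-- `Nat.RecursiveIn.rfind` searches for the value `0`, whence the translation of `true` to `0` and
`false` to `1`. -/
theorem recursiveIn_rfind {p : α → ℕ → Bool} (hp : ComputableIn O fun q : α × ℕ => p q.1 q.2) :
    RecursiveIn O fun a => Nat.rfind fun n => Part.some (p a n) :=
  (Nat.RecursiveIn.rfind (recursiveIn_map hp ((Primrec.dom_bool fun b =>
    cond b 0 1).computableIn))).of_eq fun n => by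
    rcases e : Encodable.decode (α := α) n with - | a
    · simpa [e] using Nat.rfind_zero_none _ rfl
    · simp only [Nat.unpair_pair, Encodable.decode_prod_val, e, Encodable.decode_nat]
      simp
      congr 1
      funext m
      cases p a m <;> simp

theorem computableIn_oracleOf (S : Set γ) [DecidablePred (· ∈ S)] :
    ComputableIn {oracleOf S} fun a => decide (a ∈ S) := by
  classical
  have h : ComputableIn {oracleOf S}
      fun n : ℕ => if ∃ x ∈ S, Encodable.encode x = n then 1 else 0 :=
    (RecursiveIn.oracle (oracleOf S) (Set.mem_singleton _)).of_eq fun n => by unfold oracleOf; congr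
  have h2 := computableIn_comp (f := fun n : ℕ => decide (n = 1))
    (Primrec.eq.decide.comp Primrec.id (Primrec.const 1)).computableIn
    (computableIn_comp h (Primrec.encode (α := γ)).computableIn)
  refine RecursiveIn.of_eq h2 fun a => ?_
  have : (∃ x ∈ S, Encodable.encode x = Encodable.encode a) ↔ a ∈ S :=
    ⟨fun ⟨x, hx, e⟩ => Encodable.encode_injective e ▸ hx, fun h => ⟨a, h, rfl⟩⟩
  by_cases ha : a ∈ S <;> simp [ha]

/-- The number of queries is a fixed numeral, so the list of answers is assembled by induction
outside the computation. Six queries suffice since `k ≤ 6`. -/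
theorem computableIn_queries (S : Set γ) [DecidablePred (· ∈ S)] {g : α → ℕ → γ}
    (hg : Primrec fun p : α × ℕ => g p.1 p.2) (m : ℕ) :
    ComputableIn {oracleOf S} fun a => (List.range m).map fun i => decide (g a i ∈ S) := by
  induction m with
  | zero => exact ComputableIn.const []
  | succ m ih =>
    refine (computableIn_comp (f := fun q : List Bool × Bool => q.1 ++ [q.2])
      Primrec.list_concat.computableIn (computableIn_pair ih (computableIn_comp
      (computableIn_oracleOf S) (hg.comp (Primrec.id.pair (Primrec.const m))).computableIn))).of_eq
      fun a => ?_
    simp [List.range_succ]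

end

/-- The answers of the oracle for a certificate. -/
noncomputable def oracleBits (x : Instance) (w : Cert) : List Bool :=
  open Classical in (List.range 6).map fun i =>
    decide (jumpInstance w.t x.2 w.k (w.N + i) ∈ MinimalityProblem)

theorem oracleBits_getD (x : Instance) (w : Cert) {i : ℕ} (hi : i < 6) :
    (oracleBits x w).getD i false = true ↔
      jumpInstance w.t x.2 w.k (w.N + i) ∈ MinimalityProblem := by
  simp [oracleBits, List.getD_eq_getElem?_getD, List.getElem?_range hi]

theorem computableIn_oracleBits :
    ComputableIn {oracleOf MinimalityProblem} fun q : Instance × Cert => oracleBits q.1 q.2 := by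
  classical
  have w : Primrec fun p : (Instance × Cert) × ℕ => p.1.2 := Primrec.snd.comp Primrec.fst
  refine (computableIn_queries MinimalityProblem
    (g := fun (q : Instance × Cert) i => jumpInstance q.2.t q.1.2 q.2.k (q.2.N + i))
    (primrec_jumpInstance (Cert.primrec_t w)
      (Primrec.snd.comp (Primrec.fst.comp Primrec.fst)) (Cert.primrec_k w)
      (Primrec.nat_add.comp (Cert.primrec_N w) Primrec.snd)) 6).of_eq fun q => ?_
  unfold oracleBits
  congr

/-- The `n`-th certificate. -/
noncomputable def certAt (n : ℕ) : Cert :=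
  ((Encodable.decode n : Option Cert)).getD (([], [], []), (0, 0, 0, 0), (0, 0, 0), [])

theorem primrec_certAt : Primrec certAt :=
  Primrec.option_getD.comp Primrec.decode (Primrec.const _)

theorem certAt_encode (w : Cert) : certAt (Encodable.encode w) = w := by
  simp [certAt]

end HolonomicSign

/-! ### The reduction: unbounded search for a certificate. -/

open HolonomicSign in
theorem mainTheorem5 :
    HolonomicSign.TuringReducesTo HolonomicSign.ultimateSignInputs
      HolonomicSign.UltimateSignProblem HolonomicSign.MinimalityProblem := by
  classical
  have hcert : ComputableIn {oracleOf MinimalityProblem}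
      fun q : Instance × ℕ => (q.1, certAt q.2) :=
    (Primrec.pair Primrec.fst (primrec_certAt.comp Primrec.snd)).computableIn
  obtain ⟨hdec, hcheck⟩ := primrecPred_check
    (α := (Instance × Cert) × List Bool) (x := fun q => q.1.1) (w := fun q => q.1.2)
    (bits := fun q => q.2) (Primrec.fst.comp Primrec.fst) (Primrec.snd.comp Primrec.fst) Primrec.snd
  have hp : ComputableIn {oracleOf MinimalityProblem} fun q : Instance × ℕ =>
      decide (Check q.1 (certAt q.2) (oracleBits q.1 (certAt q.2))) := by
    refine RecursiveIn.of_eq (computableIn_comp hcheck.computableIn (computableIn_pair hcert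
      (computableIn_comp computableIn_oracleBits hcert))) fun q => ?_
    exact congrArg Part.some (decide_eq_decide.2 Iff.rfl)
  refine ⟨fun x => (Nat.rfind fun n => Part.some
      (decide (Check x (certAt n) (oracleBits x (certAt n))))).map fun n => (certAt n).answer,
    recursiveIn_map (recursiveIn_rfind
      (p := fun x n => decide (Check x (certAt n) (oracleBits x (certAt n)))) hp)
      (Cert.primrec_answer primrec_certAt).computableIn, fun x hx => ?_⟩
  obtain ⟨w, hw⟩ := exists_check hx
  have hwc := hw (oracleBits x w) fun i hi h => (oracleBits_getD x w hi).2 h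
  obtain ⟨n, hn, -⟩ := Nat.rfind_min'
    (p := fun n => decide (Check x (certAt n) (oracleBits x (certAt n))))
    (m := Encodable.encode w) (by simpa [certAt_encode] using hwc)
  have hc : Check x (certAt n) (oracleBits x (certAt n)) := by
    simpa using Nat.rfind_spec hn
  exact ⟨_, Part.mem_map _ hn, hc.sound hx fun i hi h => (oracleBits_getD x _ hi).1 h⟩
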